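/- Let $F$ be a finite field with $q$ elements, $A=F[t]$, $K=F(t)$, $K_\infty=F((t^{-1}))$ with ring of integers $O=F[[t^{-1}]]$. Let $\mathfrak t$ be the Bruhat–Tits tree at infinity: its vertices are the maximal $O$-orders in $M_2(K_\infty)$, and $D,D'$ are neighbors when in some basis $D=\begin{pmatrix}O&O\\O&O\end{pmatrix}$ and $D'=\begin{pmatrix}O&\pi O\\ \pi^{-1}O&O\end{pmatrix}$, with $\pi$ a uniformizer. For $0\neq f\in A$ let $E(f)=\begin{pmatrix}A&A\\fA&A\end{pmatrix}$, let $N(f)$ be the normalizer of $E(f)$ in $\mathrm{GL}_2(K)$ (the preimage of its normalizer in $\mathrm{PGL}_2(K)$), acting on $\mathfrak t$ by conjugation, and let $\Gamma_0(f)=\left\{\begin{pmatrix}a&b\\c&d\end{pmatrix}\in\mathrm{GL}_2(A): f\mid c\right\}$. The fine quotient of $\mathfrak t$ by $N(f)$ is the quotient of the barycentric subdivision of $\mathfrak t$; its actual vertices are the $N(f)$-orbits of vertices of $\mathfrak t$, its virtual vertices are the orbits of edges of $\mathfrak t$; a virtual vertex of valency 1 gives a half edge. The weighted reduced fine quotient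 (WRFQ) $N(f)|\mathfrak t$ is obtained by replacing multiple edges by one edge, and all loops and half edges at a vertex by one half edge, and by recording for all pairs $(v,w)$ of actual vertices the weight $m_{v,w}$, the number of neighbors in $\mathfrak t$ of one (any) preimage of $v$ whose image is $w$. Up to isomorphism of weighted graphs, $N(f)|\mathfrak t$ is as follows (weights not listed are $0$). 1. If $\deg f=1$ ($q$ arbitrary): the ray $v_0,v_1,v_2,\dots$ with a half edge at $v_0$; $m_{v_0,v_0}=q$, and $m_{v_i,v_{i+1}}=1$, $m_{v_{i+1},v_i}=q$ for $i\ge0$. 2. If $q=2$, $\deg f=2$ and $f$ is a product of two non-associate linear factors (i.e. $f=t(t+1)$): the ray $v_0,v_1,\dots$ with a half edge at $v_0$; $m_{v_0,v_0}=1$, $m_{v_0,v_1}=2$, and $m_{v_i,v_{i-1}}=2$, $m_{v_i,v_{i+1}}=1$ for $i\ge1$. 3. If $q=2$, $\deg f=2$ and $f$ is not squarefree (i.e. $f=t^2$ or $(t+1)^2$): the line $(v_i)_{i\in\mathbb Z}$ without half edges; $m_{v_0,v_{-1}}=1$, $m_{v_0,v_1}=2$, and for $i\neq0$ the weight from $v_i$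 to its neighbor on the side of $v_0$ is $2$ and to its other neighbor $1$. 4. If $q=2$, $\deg f=2$ and $f$ is irreducible (i.e. $f=t^2+t+1$): the ray $v_0,v_1,\dots$ without half edges; $m_{v_0,v_1}=3$, $m_{v_1,v_0}=1$, $m_{v_1,v_2}=2$, and $m_{v_i,v_{i-1}}=2$, $m_{v_i,v_{i+1}}=1$ for $i\ge2$. Moreover, for all these $f$, $N(f)/K^*\Gamma_0(f)$ acts faithfully as the group of flips of the grid of maximal $A$-orders containing $E(f)$. That is: these orders are exactly $D_d=\begin{pmatrix}A&d^{-1}A\\dA&A\end{pmatrix}$ for $d\mid f$, and $D_d=D_{d'}$ if and only if $d,d'$ are associates, so that they form a grid whose coordinates are the multiplicities in $d$ of the primes dividing $f$; for every $n\in N(f)$ there is a factorization $f=gh$ with $g,h$ coprime such that $nD_{ac}n^{-1}=D_{bc}$ whenever $ab=g$ and $c\mid h$ (the flip in the directions of the primes dividing $g$); every factorization $f=gh$ into coprime factors arises in this way from some $n\in N(f)$; and an element of $\mathrm{GL}_2(K)$ lies in $N(f)$ and fixes by conjugation every maximal $A$-order containing $E(f)$ if and only if it lies in $K^*\Gamma_0(f)$.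 -/

import Mathlib

open Polynomial
open scoped Pointwise MatrixGroups

noncomputable section

universe u

/-! ### Orders in `M₂(L)` -/

section Orders

variable (R L : Type*) [CommRing R] [Field L] [Algebra R L]

/-- An `R`-order of maximal rank in `M₂(L)`: a subring containing `R` that is finitely generated as
an `R`-module and spans `M₂(L)` over `L`. -/
def IsOrder (D : Subalgebra R (Matrix (Fin 2) (Fin 2) L)) : Prop :=
  (Subalgebra.toSubmodule D).FG ∧
    Submodule.span L (D : Set (Matrix (Fin 2) (Fin 2) L)) = ⊤

/-- A maximal `R`-order in `M₂(L)`. -/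
def IsMaximalOrder (D : Subalgebra R (Matrix (Fin 2) (Fin 2) L)) : Prop :=
  Maximal (IsOrder R L) D

/-- For `a ≠ 0`, the order `[R, a⁻¹R; aR, R]`. -/
def splitOrder (a : L) : Subalgebra R (Matrix (Fin 2) (Fin 2) L) where
  carrier := {x | x 0 0 ∈ (algebraMap R L).range ∧ a * x 0 1 ∈ (algebraMap R L).range ∧
    (∃ r : R, x 1 0 = a * algebraMap R L r) ∧ x 1 1 ∈ (algebraMap R L).range}
  mul_mem' := by
    rintro x y ⟨hx0, hx1, ⟨r, hr⟩, hx3⟩ ⟨hy0, hy1, ⟨s, hs⟩, hy3⟩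
    have hr' : algebraMap R L r ∈ (algebraMap R L).range := ⟨r, rfl⟩
    have hs' : algebraMap R L s ∈ (algebraMap R L).range := ⟨s, rfl⟩
    simp only [Set.mem_ofPred_eq, Matrix.mul_apply, Fin.sum_univ_two]
    refine ⟨?_, ?_, ?_, ?_⟩
    · have : x 0 0 * y 0 0 + x 0 1 * y 1 0 =
        x 0 0 * y 0 0 + (a * x 0 1) * algebraMap R L s := by rw [hs]; ring
      rw [this]
      exact add_mem (mul_mem hx0 hy0) (mul_mem hx1 hs')
    · have : a * (x 0 0 * y 0 1 + x 0 1 * y 1 1) =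
        x 0 0 * (a * y 0 1) + (a * x 0 1) * y 1 1 := by ring
      rw [this]
      exact add_mem (mul_mem hx0 hy1) (mul_mem hx1 hy3)
    · obtain ⟨p, hp⟩ := hy0
      obtain ⟨q, hq⟩ := hx3
      refine ⟨r * p + q * s, ?_⟩
      rw [hr, hs, ← hp, ← hq, map_add, map_mul, map_mul]
      ring
    · have : x 1 0 * y 0 1 + x 1 1 * y 1 1 =
        algebraMap R L r * (a * y 0 1) + x 1 1 * y 1 1 := by rw [hr]; ring
      rw [this]
      exact add_mem (mul_mem hr' hy1) (mul_mem hx3 hy3)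
  add_mem' := by
    rintro x y ⟨hx0, hx1, ⟨r, hr⟩, hx3⟩ ⟨hy0, hy1, ⟨s, hs⟩, hy3⟩
    refine ⟨add_mem hx0 hy0, ?_, ⟨r + s, ?_⟩, add_mem hx3 hy3⟩
    · rw [Matrix.add_apply, mul_add]
      exact add_mem hx1 hy1
    · rw [Matrix.add_apply, hr, hs, map_add, mul_add]
  algebraMap_mem' := by
    intro r
    refine ⟨⟨r, ?_⟩, ⟨0, ?_⟩, ⟨0, ?_⟩, ⟨r, ?_⟩⟩ <;> simp [Matrix.algebraMap_matrix_apply]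

variable {R L}

/-- The conjugate `g D g⁻¹`, i.e. the set of all `x` with `g⁻¹ x g ∈ D`. -/
def conjOrder (g : GL (Fin 2) L) (D : Subalgebra R (Matrix (Fin 2) (Fin 2) L)) :
    Subalgebra R (Matrix (Fin 2) (Fin 2) L) where
  carrier := {x | ((g⁻¹ : GL (Fin 2) L) : Matrix (Fin 2) (Fin 2) L) * x *
    (g : Matrix (Fin 2) (Fin 2) L) ∈ D}
  mul_mem' := by
    intro x y hx hy
    rw [Set.mem_ofPred_eq] at *
    have := mul_mem hx hy
    simpa only [mul_assoc, Units.mul_inv_cancel_left] using this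
  add_mem' := by
    intro x y hx hy
    rw [Set.mem_ofPred_eq] at *
    rw [mul_add, add_mul]
    exact add_mem hx hy
  algebraMap_mem' := by
    intro r
    rw [Set.mem_ofPred_eq, mul_assoc, Algebra.commutes, Units.inv_mul_cancel_left]
    exact D.algebraMap_mem r

theorem mem_conjOrder {g : GL (Fin 2) L} {D : Subalgebra R (Matrix (Fin 2) (Fin 2) L)}
    {x : Matrix (Fin 2) (Fin 2) L} :
    x ∈ conjOrder g D ↔ ((g⁻¹ : GL (Fin 2) L) : Matrix (Fin 2) (Fin 2) L) * x *
      (g : Matrix (Fin 2) (Fin 2) L) ∈ D :=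
  Iff.rfl

theorem conjOrder_one (D : Subalgebra R (Matrix (Fin 2) (Fin 2) L)) : conjOrder 1 D = D := by
  ext x
  simp [mem_conjOrder]

theorem conjOrder_mul (g h : GL (Fin 2) L) (D : Subalgebra R (Matrix (Fin 2) (Fin 2) L)) :
    conjOrder (g * h) D = conjOrder g (conjOrder h D) := by
  ext x
  rw [mem_conjOrder, mem_conjOrder, mem_conjOrder, mul_inv_rev, Units.val_mul, Units.val_mul]
  simp only [mul_assoc]

theorem conjOrder_mono {g : GL (Fin 2) L} {D D' : Subalgebra R (Matrix (Fin 2) (Fin 2) L)}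
    (h : D ≤ D') : conjOrder g D ≤ conjOrder g D' :=
  fun _ hx => mem_conjOrder.2 (h (mem_conjOrder.1 hx))

theorem IsOrder.conj {D : Subalgebra R (Matrix (Fin 2) (Fin 2) L)} (hD : IsOrder R L D)
    (g : GL (Fin 2) L) : IsOrder R L (conjOrder g D) := by
  refine ⟨?_, ?_⟩
  · have h := hD.1.map ((LinearMap.mulLeft R (g : Matrix (Fin 2) (Fin 2) L)).comp
      (LinearMap.mulRight R ((g⁻¹ : GL (Fin 2) L) : Matrix (Fin 2) (Fin 2) L)))
    have heq : Subalgebra.toSubmodule (conjOrder g D) = (Subalgebra.toSubmodule D).map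
        ((LinearMap.mulLeft R (g : Matrix (Fin 2) (Fin 2) L)).comp
          (LinearMap.mulRight R ((g⁻¹ : GL (Fin 2) L) : Matrix (Fin 2) (Fin 2) L))) := ?_
    · rw [heq]
      exact h
    refine Submodule.ext fun x => ?_
    rw [Subalgebra.mem_toSubmodule, mem_conjOrder, Submodule.mem_map]
    constructor
    · intro hx
      refine ⟨_, hx, ?_⟩
      simp only [LinearMap.comp_apply, LinearMap.mulLeft_apply, LinearMap.mulRight_apply,
        mul_assoc, Units.mul_inv, mul_one, Units.mul_inv_cancel_left]
    · rintro ⟨y, hy, rfl⟩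
      rw [Subalgebra.mem_toSubmodule] at hy
      simpa only [LinearMap.comp_apply, LinearMap.mulLeft_apply, LinearMap.mulRight_apply,
        mul_assoc, Units.inv_mul, mul_one, Units.inv_mul_cancel_left] using hy
  · rw [eq_top_iff]
    intro x _
    have key : ∀ y ∈ Submodule.span L (D : Set (Matrix (Fin 2) (Fin 2) L)),
        (g : Matrix (Fin 2) (Fin 2) L) * y * ((g⁻¹ : GL (Fin 2) L) : Matrix (Fin 2) (Fin 2) L) ∈
          Submodule.span L (conjOrder g D : Set (Matrix (Fin 2) (Fin 2) L)) := by
      intro y hy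
      induction hy using Submodule.span_induction with
      | mem y hy =>
        refine Submodule.subset_span (mem_conjOrder.2 ?_)
        have hy' : y ∈ D := hy
        simpa only [mul_assoc, Units.inv_mul, mul_one, Units.inv_mul_cancel_left] using hy'
      | zero => simp
      | add y z _ _ hy hz =>
        rw [mul_add, add_mul]
        exact add_mem hy hz
      | smul c y _ hy =>
        rw [Matrix.mul_smul, Matrix.smul_mul]
        exact Submodule.smul_mem _ c hy
    have := key (((g⁻¹ : GL (Fin 2) L) : Matrix (Fin 2) (Fin 2) L) * x *
      (g : Matrix (Fin 2) (Fin 2) L)) (by rw [hD.2]; trivial)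
    simpa only [mul_assoc, Units.mul_inv, mul_one, Units.mul_inv_cancel_left] using this

theorem IsMaximalOrder.conj {D : Subalgebra R (Matrix (Fin 2) (Fin 2) L)}
    (hD : IsMaximalOrder R L D) (g : GL (Fin 2) L) : IsMaximalOrder R L (conjOrder g D) := by
  refine ⟨hD.1.conj g, fun E hE hle => ?_⟩
  have h1 : D ≤ conjOrder g⁻¹ E := by
    have := conjOrder_mono (g := g⁻¹) hle
    rwa [← conjOrder_mul, inv_mul_cancel, conjOrder_one] at this
  have h2 := conjOrder_mono (g := g) (hD.2 (hE.conj g⁻¹) h1)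
  rwa [← conjOrder_mul, mul_inv_cancel, conjOrder_one] at h2

end Orders

/-! ### Fine graphs, fine quotients, and weighted reduced fine quotients -/

/-- A fine graph: a bipartite graph on actual and virtual vertices, whose (geometric) edges are the
elements of `Half`, each joining an actual vertex to a virtual one; virtual vertices have valency
`1` or `2`. A virtual vertex of valency `2` is an actual edge between its two ends, one of
valency `1` is a half edge. -/
structure FineGraph where
  Actual : Type u
  Virtual : Type u
  Half : Type u
  actualEnd : Half → Actual
  virtualEnd : Half → Virtual
  valency : ∀ x : Virtual,
    {h | virtualEnd h = x}.encard = 1 ∨ {h | virtualEnd h = x}.encard = 2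

/-- The edges of the reduction of a fine graph: two different actual vertices are joined by one edge
if they are joined by at least one edge in the fine graph, and there is one half edge at an actual
vertex (recorded as an element of the diagonal) if there is at least a half edge or a loop there. -/
def FineGraph.reducedEdges (X : FineGraph) : Set (Sym2 X.Actual) :=
  {e | ∃ x : X.Virtual, ∀ v : X.Actual, v ∈ e ↔ ∃ h, X.virtualEnd h = x ∧ X.actualEnd h = v}

/-- A weighted reduced fine graph with actual vertices `V`. There is at most one virtual vertex
between two given actual vertices and at most one half edge at each actual vertex, so the virtual
vertices are given by a set of unordered pairs; `s(v, v)` stands for a half edge at `v`.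
The number `weight v w` is the one written next to `v` on the edge joining `v` to `w`. -/
structure WeightedFineGraph (V : Type*) where
  edges : Set (Sym2 V)
  weight : V → V → ℕ∞

/-- Two weighted reduced fine graphs are isomorphic. -/
def WeightedFineGraph.Isomorphic {V W : Type*} (X : WeightedFineGraph V)
    (Y : WeightedFineGraph W) : Prop :=
  ∃ e : V ≃ W, (∀ z : Sym2 V, z ∈ X.edges ↔ z.map e ∈ Y.edges) ∧
    ∀ v w : V, X.weight v w = Y.weight (e v) (e w)

section Quotients

variable (G : Type*) {V : Type u} [Group G] [MulAction G V] (T : SimpleGraph V)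

/-- Two edges of `T` in the same `G`-orbit. -/
def EdgeRel (e e' : T.edgeSet) : Prop :=
  ∃ g : G, (e : Sym2 V).map (g • ·) = (e' : Sym2 V)

/-- Two oriented edges of `T` in the same `G`-orbit. -/
def DartRel (a b : T.Dart) : Prop :=
  ∃ g : G, g • a.fst = b.fst ∧ g • a.snd = b.snd

/-- The fine quotient of `T` by `G`, i.e. the quotient of the barycentric subdivision of `T`. The
barycentric subdivision has the vertices of `T` as actual vertices, the (unoriented) edges of `T` as
virtual vertices, and one segment for each oriented edge `a`, joining the source of `a` to
the midpoint of `a`. -/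
def fineQuotient : FineGraph where
  Actual := MulAction.orbitRel.Quotient G V
  Virtual := Quot (EdgeRel G T)
  Half := Quot (DartRel G T)
  actualEnd := Quot.lift (fun a => (Quotient.mk'' a.fst : MulAction.orbitRel.Quotient G V)) (by
    rintro a b ⟨g, h, -⟩
    exact (Quotient.sound' ⟨g, h⟩ : (Quotient.mk'' b.fst : MulAction.orbitRel.Quotient G V) =
      Quotient.mk'' a.fst).symm)
  virtualEnd := Quot.map (fun a => ⟨a.edge, a.edge_mem⟩) (by
    rintro a b ⟨g, h1, h2⟩
    refine ⟨g, ?_⟩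
    change Sym2.map _ s(a.fst, a.snd) = s(b.fst, b.snd)
    rw [Sym2.map_mk, h1, h2])
  valency := by
    intro x
    obtain ⟨e, rfl⟩ := Quot.exists_rep x
    obtain ⟨e, he⟩ := e
    induction e using Sym2.ind with
    | _ u v =>
    have hE : ∀ e e' : T.edgeSet, Quot.mk (EdgeRel G T) e = Quot.mk (EdgeRel G T) e' →
        EdgeRel G T e e' := by
      intro e e' h
      have heq : Equivalence (EdgeRel G T) := by
        refine ⟨fun e => ⟨1, ?_⟩, ?_, ?_⟩
        · simp
        · rintro e e' ⟨g, hg⟩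
          refine ⟨g⁻¹, ?_⟩
          rw [← hg, Sym2.map_map]
          have hid : (g⁻¹ • ·) ∘ (g • ·) = (id : V → V) := by
            ext z
            simp
          rw [hid, Sym2.map_id, id]
        · rintro e e' e'' ⟨g, hg⟩ ⟨k, hk⟩
          refine ⟨k * g, ?_⟩
          rw [← hk, ← hg, Sym2.map_map]
          congr 1
          ext z
          simp [mul_smul]
      exact (heq.eqvGen_iff).1 (Quot.eqvGen_exact h)
    let d : T.Dart := ⟨(u, v), he⟩
    have key : {h : Quot (DartRel G T) | Quot.map (fun a : T.Dart => (⟨a.edge, a.edge_mem⟩ :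
        T.edgeSet)) (by
          rintro a b ⟨g, h1, h2⟩
          refine ⟨g, ?_⟩
          change Sym2.map _ s(a.fst, a.snd) = s(b.fst, b.snd)
          rw [Sym2.map_mk, h1, h2]) h = Quot.mk (EdgeRel G T) ⟨s(u, v), he⟩} =
        {Quot.mk (DartRel G T) d, Quot.mk (DartRel G T) d.symm} := by
      ext h
      obtain ⟨a, rfl⟩ := Quot.exists_rep h
      constructor
      · intro h
        obtain ⟨g, hg⟩ := hE _ _ h
        change Sym2.map _ s(a.fst, a.snd) = s(u, v) at hg
        rw [Sym2.map_mk, Sym2.eq_iff] at hg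
        rcases hg with ⟨h1, h2⟩ | ⟨h1, h2⟩
        · exact Or.inl (Quot.sound ⟨g, h1, h2⟩)
        · exact Or.inr (Quot.sound ⟨g, h1, h2⟩)
      · rintro (h | h)
        · rw [h]; rfl
        · rw [h]
          exact congrArg (Quot.mk _) (Subtype.ext Sym2.eq_swap)
    rw [key]
    by_cases hd : Quot.mk (DartRel G T) d = Quot.mk (DartRel G T) d.symm
    · left
      rw [hd, Set.pair_eq_singleton, Set.encard_singleton]
    · right
      exact Set.encard_pair hd

/-- The weighted reduced fine quotient `G | T`, for a group `G` acting on `T` by graph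
automorphisms: the reduction of the fine quotient, with the weights `weight v w`, the number of
neighbors in `T` of one (any) preimage of `v` whose image is `w`. -/
def weightedReducedFineQuotient (hT : ∀ (g : G) (x y : V), T.Adj x y → T.Adj (g • x) (g • y)) :
    WeightedFineGraph (MulAction.orbitRel.Quotient G V) where
  edges := (fineQuotient G T).reducedEdges
  weight v w := Quotient.liftOn' v
    (fun x => {y : V | T.Adj x y ∧ (Quotient.mk'' y : MulAction.orbitRel.Quotient G V) = w}.encard)
    (by
      have key : ∀ (g : G) (x : V),
          {y : V | T.Adj (g • x) y ∧
            (Quotient.mk'' y : MulAction.orbitRel.Quotient G V) = w}.encard =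
          {y : V | T.Adj x y ∧
            (Quotient.mk'' y : MulAction.orbitRel.Quotient G V) = w}.encard := by
        intro g x
        rw [← (MulAction.injective g).encard_image {y : V | T.Adj x y ∧
          (Quotient.mk'' y : MulAction.orbitRel.Quotient G V) = w}]
        refine congrArg Set.encard (Set.ext fun y => ?_)
        constructor
        · rintro ⟨h1, h2⟩
          refine ⟨g⁻¹ • y, ⟨?_, ?_⟩, smul_inv_smul g y⟩
          · simpa using hT g⁻¹ _ _ h1
          · rw [← h2]
            exact Quotient.sound' ⟨g⁻¹, rfl⟩
        · rintro ⟨z, ⟨h1, h2⟩, rfl⟩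
          refine ⟨hT g _ _ h1, ?_⟩
          rw [← h2]
          exact Quotient.sound' ⟨g, rfl⟩
      rintro x x' ⟨g, rfl⟩
      exact key g x')

end Quotients

/-! ### The Bruhat–Tits tree at infinity of `F(t)` -/

section Tree

variable (F : Type*) [Field F]

/-- The completion `F((t⁻¹))` of `F(t)` at the place at infinity. -/
abbrev KInf : Type _ :=
  letI : DecidableEq (RatFunc F) := Classical.decEq _
  RatFunc.CompletionAtInfty F

/-- The ring of integers `F[[t⁻¹]]` of `F((t⁻¹))`. -/
abbrev OInf : Subring (KInf F) :=
  (Valued.v : Valuation (KInf F) (WithZero (Multiplicative ℤ))).integer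

/-- The vertices of the Bruhat–Tits tree: the maximal orders in `M₂(F((t⁻¹)))`. -/
def TreeVertex : Type _ :=
  {D : Subalgebra (OInf F) (Matrix (Fin 2) (Fin 2) (KInf F)) // IsMaximalOrder (OInf F) (KInf F) D}

/-- The group `GL₂(F(t))` acts on local maximal orders by conjugation. -/
instance : MulAction (GL (Fin 2) (RatFunc F)) (TreeVertex F) where
  smul n D := ⟨conjOrder (Matrix.GeneralLinearGroup.map (algebraMap (RatFunc F) (KInf F)) n) D.1,
    D.2.conj _⟩
  one_smul D := Subtype.ext (by
    change conjOrder (Matrix.GeneralLinearGroup.map (algebraMap (RatFunc F) (KInf F)) 1) D.1 = D.1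
    rw [map_one, conjOrder_one])
  mul_smul m n D := Subtype.ext (by
    change conjOrder (Matrix.GeneralLinearGroup.map (algebraMap (RatFunc F) (KInf F)) (m * n)) D.1 =
      conjOrder (Matrix.GeneralLinearGroup.map (algebraMap (RatFunc F) (KInf F)) m)
        (conjOrder (Matrix.GeneralLinearGroup.map (algebraMap (RatFunc F) (KInf F)) n) D.1)
    rw [map_mul, conjOrder_mul])

/-- Neighbors in the tree: in some basis, `D = [O, O; O, O]` and `D' = [O, πO; π⁻¹O, O]`, where `π`
is a uniformizer. -/
def TreeAdj (D D' : TreeVertex F) : Prop :=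
  ∃ π : KInf F, Valued.v π = (WithZero.exp (-1 : ℤ)) ∧ ∃ g : GL (Fin 2) (KInf F),
    D.1 = conjOrder g (splitOrder (OInf F) (KInf F) 1) ∧
    D'.1 = conjOrder g (splitOrder (OInf F) (KInf F) π⁻¹)

theorem valuation_inv_uniformizer {π : KInf F} (hπ : Valued.v π = (WithZero.exp (-1 : ℤ))) :
    π ≠ 0 ∧ Valued.v π⁻¹ = (WithZero.exp (1 : ℤ)) := by
  refine ⟨?_, ?_⟩
  · rintro rfl
    rw [map_zero] at hπ
    exact WithZero.exp_ne_zero hπ.symm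
  · rw [map_inv₀, hπ, WithZero.exp_neg, inv_inv]

theorem exists_conj_splitOrder {R L : Type*} [CommRing R] [Field L] [Algebra R L] {a : L}
    (ha : a ≠ 0) : ∃ δ : GL (Fin 2) L,
      conjOrder δ (splitOrder R L 1) = splitOrder R L a⁻¹ ∧
      conjOrder δ (splitOrder R L a⁻¹) = splitOrder R L 1 := by
  have h1 : (!![0, a; 1, 0] : Matrix (Fin 2) (Fin 2) L) * !![0, 1; a⁻¹, 0] = 1 := by
    ext i j; fin_cases i <;> fin_cases j <;> simp [ha]
  have h2 : (!![0, 1; a⁻¹, 0] : Matrix (Fin 2) (Fin 2) L) * !![0, a; 1, 0] = 1 := by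
    ext i j; fin_cases i <;> fin_cases j <;> simp [ha]
  have hm : ∀ (c : L) (x : Matrix (Fin 2) (Fin 2) L), x ∈ splitOrder R L c ↔
      x 0 0 ∈ (algebraMap R L).range ∧ c * x 0 1 ∈ (algebraMap R L).range ∧
      (∃ r : R, x 1 0 = c * algebraMap R L r) ∧ x 1 1 ∈ (algebraMap R L).range :=
    fun _ _ => Iff.rfl
  have hc : ∀ x : Matrix (Fin 2) (Fin 2) L, (!![0, 1; a⁻¹, 0] : Matrix (Fin 2) (Fin 2) L) * x *
      !![0, a; 1, 0] = !![x 1 1, x 1 0 * a; a⁻¹ * x 0 1, x 0 0] := by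
    intro x
    ext i j
    fin_cases i <;> fin_cases j <;>
      simp [Matrix.mul_apply, Matrix.vecMul, dotProduct, Fin.sum_univ_two, mul_comm]
    rw [← mul_assoc, mul_inv_cancel₀ ha, one_mul]
  refine ⟨⟨_, _, h1, h2⟩, ?_, ?_⟩
  · ext x
    rw [mem_conjOrder]
    change (!![0, 1; a⁻¹, 0] : Matrix (Fin 2) (Fin 2) L) * x * !![0, a; 1, 0] ∈ _ ↔ _
    rw [hc, hm, hm]
    simp only [Matrix.of_apply, Matrix.cons_val', Matrix.cons_val_zero, Matrix.cons_val_one,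
      Matrix.cons_val_fin_one, one_mul]
    constructor
    · rintro ⟨h1, ⟨r, hr⟩, ⟨s, hs⟩, h4⟩
      refine ⟨h4, ⟨s, hs.symm⟩, ⟨r, ?_⟩, h1⟩
      rw [hr]; field_simp
    · rintro ⟨h1, ⟨s, hs⟩, ⟨r, hr⟩, h4⟩
      refine ⟨h4, ⟨r, ?_⟩, ⟨s, hs.symm⟩, h1⟩
      rw [hr]; field_simp
  · ext x
    rw [mem_conjOrder]
    change (!![0, 1; a⁻¹, 0] : Matrix (Fin 2) (Fin 2) L) * x * !![0, a; 1, 0] ∈ _ ↔ _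
    rw [hc, hm, hm]
    simp only [Matrix.of_apply, Matrix.cons_val', Matrix.cons_val_zero, Matrix.cons_val_one,
      Matrix.cons_val_fin_one, one_mul]
    constructor
    · rintro ⟨h1, ⟨r, hr⟩, ⟨s, hs⟩, h4⟩
      refine ⟨h4, ⟨s, ?_⟩, ⟨r, ?_⟩, h1⟩
      · field_simp at hs; exact hs.symm
      · rw [hr]; field_simp
    · rintro ⟨h1, ⟨s, hs⟩, ⟨r, hr⟩, h4⟩
      refine ⟨h4, ⟨r, ?_⟩, ⟨s, ?_⟩, h1⟩
      · rw [hr]; field_simp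
      · rw [hs]

/-- The Bruhat–Tits tree of `F(t)` at the place at infinity. -/
def bruhatTitsTree : SimpleGraph (TreeVertex F) where
  Adj := TreeAdj F
  symm := by
    refine ⟨?_⟩
    rintro D D' ⟨π, hπ, g, h1, h2⟩
    obtain ⟨δ, hδ1, hδ2⟩ := exists_conj_splitOrder (R := OInf F) (valuation_inv_uniformizer F hπ).1
    refine ⟨π, hπ, g * δ, ?_, ?_⟩
    · rw [conjOrder_mul, hδ1, h2]
    · rw [conjOrder_mul, hδ2, h1]
  loopless := by
    refine ⟨?_⟩
    rintro D ⟨π, hπ, g, h1, h2⟩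
    have h3 : splitOrder (OInf F) (KInf F) 1 = splitOrder (OInf F) (KInf F) π⁻¹ := by
      have := congrArg (conjOrder g⁻¹) (h1.symm.trans h2)
      rwa [← conjOrder_mul, ← conjOrder_mul, inv_mul_cancel, conjOrder_one, conjOrder_one] at this
    have h4 : (!![0, 0; π⁻¹, 0] : Matrix (Fin 2) (Fin 2) (KInf F)) ∈
        splitOrder (OInf F) (KInf F) π⁻¹ :=
      ⟨⟨0, by simp⟩, ⟨0, by simp⟩, ⟨1, by simp⟩, ⟨0, by simp⟩⟩
    rw [← h3] at h4
    obtain ⟨-, -, ⟨r, hr⟩, -⟩ := h4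
    have h5 : π⁻¹ = (r : KInf F) := by
      have : π⁻¹ = 1 * (r : KInf F) := hr
      rwa [one_mul] at this
    have h6 : Valued.v (r : KInf F) ≤ 1 := r.2
    rw [← h5, (valuation_inv_uniformizer F hπ).2, ← WithZero.exp_zero, WithZero.exp_le_exp] at h6
    norm_num at h6

theorem bruhatTitsTree_smul (g : GL (Fin 2) (RatFunc F)) (D D' : TreeVertex F)
    (h : (bruhatTitsTree F).Adj D D') : (bruhatTitsTree F).Adj (g • D) (g • D') := by
  obtain ⟨π, hπ, k, h1, h2⟩ := h
  refine ⟨π, hπ, Matrix.GeneralLinearGroup.map (algebraMap (RatFunc F) (KInf F)) g * k, ?_, ?_⟩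
  · rw [conjOrder_mul, ← h1]; rfl
  · rw [conjOrder_mul, ← h2]; rfl

end Tree

/-! ### Eichler `F[t]`-orders and their normalizers -/

section Eichler

variable {F : Type*} [Field F]

/-- For a nonzero polynomial `d`, the maximal `A`-order `[A, d⁻¹A; dA, A]`, where `A = F[t]`. -/
def polyOrder (d : F[X]) : Subalgebra F[X] (Matrix (Fin 2) (Fin 2) (RatFunc F)) :=
  splitOrder F[X] (RatFunc F) (algebraMap F[X] (RatFunc F) d)

/-- For a nonzero polynomial `f`, the Eichler `A`-order
`E(f) = [A, A; fA, A] = [A, A; A, A] ∩ [A, f⁻¹A; fA, A]` of level `f`. -/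
def eichlerOrder (f : F[X]) : Subalgebra F[X] (Matrix (Fin 2) (Fin 2) (RatFunc F)) :=
  polyOrder 1 ⊓ polyOrder f

/-- The normalizer `N(f)` of `E(f)`, given by its preimage in `GL₂(F(t))`. -/
def eichlerNormalizer (f : F[X]) : Subgroup (GL (Fin 2) (RatFunc F)) where
  carrier := {n | conjOrder n (eichlerOrder f) = eichlerOrder f}
  mul_mem' := by
    intro m n hm hn
    rw [Set.mem_ofPred_eq] at *
    rw [conjOrder_mul, hn, hm]
  one_mem' := conjOrder_one _
  inv_mem' := by
    intro n hn
    rw [Set.mem_ofPred_eq] at *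
    nth_rw 1 [← hn]
    rw [← conjOrder_mul, inv_mul_cancel, conjOrder_one]

/-- The Hecke congruence subgroup `Γ₀(f)` of `GL₂(F[t])`. -/
def heckeGamma0 (f : F[X]) : Subgroup (GL (Fin 2) F[X]) where
  carrier := {γ | f ∣ (γ : Matrix (Fin 2) (Fin 2) F[X]) 1 0}
  mul_mem' := by
    intro x y hx hy
    rw [Set.mem_ofPred_eq] at *
    rw [Units.val_mul, Matrix.mul_apply, Fin.sum_univ_two]
    exact dvd_add (hx.mul_right _) (hy.mul_left _)
  one_mem' := by simp
  inv_mem' := by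
    intro x hx
    rw [Set.mem_ofPred_eq] at *
    rw [Matrix.coe_units_inv, Matrix.inv_def, Matrix.smul_apply, Matrix.adjugate_fin_two]
    exact Dvd.dvd.mul_left (by simpa using hx) _

/-- The weighted reduced fine quotient `N(f) | 𝔱` of the Bruhat–Tits tree at infinity. -/
def eichlerWRFQ (f : F[X]) :
    WeightedFineGraph (MulAction.orbitRel.Quotient (eichlerNormalizer f) (TreeVertex F)) :=
  weightedReducedFineQuotient (eichlerNormalizer f) (bruhatTitsTree F)
    (fun n x y h => bruhatTitsTree_smul F n x y h)

/-- The vertices of the grid of `f` correspond to the divisors of `f`, up to units: `d` corresponds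
to the order `[A, d⁻¹A; dA, A]`, and its coordinates are the multiplicities in `d` of the primes
dividing `f`. If `f = g h` with `g` and `h` coprime, conjugation by `n` acts on the grid
as the flip in the directions of the primes dividing `g` if it takes the vertex `a c`, where
`a ∣ g` and `c ∣ h`, to the vertex `(g / a) c`. -/
def ActsAsFlip (n : GL (Fin 2) (RatFunc F)) (g h : F[X]) : Prop :=
  ∀ a b c : F[X], a * b = g → c ∣ h → conjOrder n (polyOrder (a * c)) = polyOrder (b * c)

end Eichler

/-! ### The weighted graphs of the table -/

/-- The entry for `f` linear: a ray `0, 1, 2, …` with a half edge at `0`. -/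
def tableLinear (q : ℕ) : WeightedFineGraph ℕ where
  edges := {s(0, 0)} ∪ {z | ∃ i : ℕ, z = s(i, i + 1)}
  weight i j :=
    if i = 0 then (if j = 0 then (q : ℕ∞) else if j = 1 then 1 else 0)
    else if j + 1 = i then (q : ℕ∞) else if j = i + 1 then 1 else 0

/-- The entry for `f = t(t + 1)`: a ray `0, 1, 2, …` with a half edge at `0`. -/
def tableSplit : WeightedFineGraph ℕ where
  edges := {s(0, 0)} ∪ {z | ∃ i : ℕ, z = s(i, i + 1)}
  weight i j :=
    if i = 0 then (if j = 0 then 1 else if j = 1 then 2 else 0)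
    else if j + 1 = i then 2 else if j = i + 1 then 1 else 0

/-- The entry for `f = t²`: a line infinite in both directions, with central vertex `0`. -/
def tableSquare : WeightedFineGraph ℤ where
  edges := {z | ∃ i : ℤ, z = s(i, i + 1)}
  weight i j :=
    if i = 0 then (if j = -1 then 1 else if j = 1 then 2 else 0)
    else if 0 < i then (if j = i - 1 then 2 else if j = i + 1 then 1 else 0)
    else (if j = i + 1 then 2 else if j = i - 1 then 1 else 0)

/-- The entry for `f = t² + t + 1`: a ray `0, 1, 2, …`. -/
def tableIrreducible : WeightedFineGraph ℕ where
  edges := {z | ∃ i : ℕ, z = s(i, i + 1)}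
  weight i j :=
    if i = 0 then (if j = 1 then 3 else 0)
    else if i = 1 then (if j = 0 then 1 else if j = 2 then 2 else 0)
    else if j + 1 = i then 2 else if j = i + 1 then 1 else 0

end

/-! Every vertex of the tree is the conjugate of `M₂(O)` by some `[a, b; 0, 1]` and depends only on
the ball with center `b` and radius `|a|`. By density of `F(t)` one may take `b` rational and `a` a
power of `t`. That a matrix takes one ball to another then amounts to five valuation conditions
(`smul_ballVertex_eq`), and the neighbors of `g • M₂(O)` are indexed by the projective line `Option
F` (`bruhatTitsTree_adj_iff`).

A quotient is recognized from a list of candidate vertices (`eichlerWRFQ_isomorphic`): each neighbor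
of a candidate is moved to a candidate by an element of `N(f)`, and different candidates are
inequivalent. As the tree is connected, no orbit is missed. The moves are matrices `[gα, β; fγ, gδ]`
with `gh = f` and `gαδ - hβγ` a unit (`normalizerEquiv_ballVertex`): translations by polynomials,
the inversion `[0, 1; f, 0]`, and special matrices for each type of `f` in degree 2.

Inequivalence comes from the ring `E(f) ∩ x`, which `N(f)` transports by conjugation. Its
cardinality grows along each cusp, and the presence of a nontrivial idempotent separates the cusp at
infinity from the other end of the line (`f` a square) or from the extra end vertex (`f`
irreducible).

For the grid, an order containing `E(f)` contains the diagonal idempotents and can be described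
entry by entry. Hence `n ∈ N(f)` takes `M₂(A)` to some `D_g` with `g ∣ f`. Integrality of `n E(f)
n⁻¹` then forces the shape above up to a scalar (`exists_eq_smul_of_mem_eichlerNormalizer`), the
unit condition makes `g` and `h` coprime, and matrices of this shape act as flips
(`actsAsFlip_of_eq_smul`). The case `g = 1` is `K^* Γ₀(f)`. -/

noncomputable section

/-! ### The place at infinity: density and residues -/

section Infinity

variable {F : Type*} [Field F]

variable (F) in
/-- The valuation at infinity on `F(t)`, with values in `ℤᵐ⁰`. -/
def vInf : Valuation (RatFunc F) (WithZero (Multiplicative ℤ)) :=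
  letI : DecidableEq (RatFunc F) := Classical.decEq _
  RatFunc.inftyValuation F

theorem vInf_polynomial {p : F[X]} (hp : p ≠ 0) :
    vInf F (algebraMap F[X] (RatFunc F) p) = WithZero.exp (p.natDegree : ℤ) := by
  let _ : DecidableEq (RatFunc F) := Classical.decEq _
  exact RatFunc.inftyValuation.polynomial F hp

theorem vInf_polynomial_le_iff {p : F[X]} {n : ℕ} :
    vInf F (algebraMap F[X] (RatFunc F) p) ≤ WithZero.exp (n : ℤ) ↔ p.natDegree ≤ n := by
  by_cases hp : p = 0
  · simp [hp]
  · rw [vInf_polynomial hp, WithZero.exp_le_exp]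
    exact Nat.cast_le

theorem vInf_X : vInf F RatFunc.X = WithZero.exp (1 : ℤ) := by
  let _ : DecidableEq (RatFunc F) := Classical.decEq _
  exact RatFunc.inftyValuation.X F

theorem vInf_X_zpow (n : ℤ) : vInf F (RatFunc.X ^ n) = WithZero.exp n := by
  rw [map_zpow₀, vInf_X, ← WithZero.exp_zsmul]
  simp

theorem vInf_C {c : F} (hc : c ≠ 0) : vInf F (RatFunc.C c) = 1 := by
  let _ : DecidableEq (RatFunc F) := Classical.decEq _
  exact RatFunc.inftyValuation.C F hc

theorem vInf_C_le (c : F) : vInf F (RatFunc.C c) ≤ 1 := by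
  by_cases hc : c = 0
  · simp [hc]
  · exact (vInf_C hc).le

theorem valued_algebraMap (x : RatFunc F) :
    Valued.v (algebraMap (RatFunc F) (KInf F) x) = vInf F x := by
  let _ : DecidableEq (RatFunc F) := Classical.decEq _
  let _ := RatFunc.inftyValued F
  exact Valued.valuedCompletion_apply x

theorem exists_ratFunc_near (x : KInf F) (n : ℤ) :
    ∃ y : RatFunc F, Valued.v (x - algebraMap (RatFunc F) (KInf F) y) < WithZero.exp n := by
  let _ : DecidableEq (RatFunc F) := Classical.decEq _
  have hd : DenseRange (algebraMap (RatFunc F) (KInf F)) := by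
    let _ := RatFunc.inftyValued F
    exact UniformSpace.Completion.denseRange_coe
  -- Scaling by `X ^ (1 - n)` turns the strict bound by `exp n`, that is `≤ exp (n - 1)`, into
  -- membership in the open subring `O`.
  set s : KInf F := algebraMap (RatFunc F) (KInf F) (RatFunc.X ^ (1 - n)) with hs
  have hvs : Valued.v s = (WithZero.exp (1 - n) : WithZero (Multiplicative ℤ)) := by
    rw [hs, valued_algebraMap, vInf_X_zpow]
  have ho : IsOpen ((fun z : KInf F => (x - z) * s) ⁻¹' (OInf F : Set (KInf F))) :=
    (Valued.isOpen_integer (KInf F)).preimage (by fun_prop)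
  obtain ⟨y, hy⟩ := hd.exists_mem_open ho ⟨x, by simp⟩
  refine ⟨y, ?_⟩
  have hy' : Valued.v ((x - algebraMap (RatFunc F) (KInf F) y) * s) ≤
    (1 : WithZero (Multiplicative ℤ)) := hy
  rw [map_mul, hvs] at hy'
  by_cases h0 : Valued.v (x - algebraMap (RatFunc F) (KInf F) y) =
      (0 : WithZero (Multiplicative ℤ))
  · rw [h0]
    exact WithZero.exp_pos
  · rw [← WithZero.exp_log h0, ← WithZero.exp_add, ← WithZero.exp_zero, WithZero.exp_le_exp] at hy'
    rw [← WithZero.exp_log h0, WithZero.exp_lt_exp]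
    omega

/-- Discreteness of the value group: a strict bound by `1` gains a whole uniformizer. -/
theorem lt_one_iff_le_exp {x : WithZero (Multiplicative ℤ)} :
    x < 1 ↔ x ≤ WithZero.exp (-1 : ℤ) := by
  by_cases hx : x = 0
  · simp [hx]
  · rw [← WithZero.exp_log hx, ← WithZero.exp_zero, WithZero.exp_lt_exp, WithZero.exp_le_exp]
    omega

/-- The residue field at infinity is `F`. The denominator is monic, so subtracting the coefficient
of the numerator in the degree of the denominator cancels the top terms. -/
theorem exists_residue_ratFunc (x : RatFunc F) (hx : vInf F x ≤ 1) :
    ∃ c : F, vInf F (x - RatFunc.C c) < 1 := by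
  by_cases h0 : x = 0
  · exact ⟨0, by simp [h0]⟩
  have hd : x.denom ≠ 0 := x.denom_ne_zero
  have hn : x.num ≠ 0 := RatFunc.num_ne_zero h0
  have hd' : algebraMap F[X] (RatFunc F) x.denom ≠ 0 := by simpa using hd
  have hv : vInf F x * vInf F (algebraMap F[X] (RatFunc F) x.denom) =
      vInf F (algebraMap F[X] (RatFunc F) x.num) := by
    rw [← map_mul]
    congr 1
    nth_rw 1 [← RatFunc.num_div_denom x]
    field_simp
  have hle : x.num.natDegree ≤ x.denom.natDegree := by
    have : vInf F (algebraMap F[X] (RatFunc F) x.num) ≤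
        vInf F (algebraMap F[X] (RatFunc F) x.denom) := by
      rw [← hv]
      exact mul_le_of_le_one_left' hx
    rw [vInf_polynomial hd, vInf_polynomial_le_iff] at this
    exact this
  set m := x.denom.natDegree with hm
  set c := x.num.coeff m with hc
  refine ⟨c, ?_⟩
  have hlc : x.denom.coeff m = 1 := by
    have := x.monic_denom
    exact this
  have e : (x - RatFunc.C c) * algebraMap F[X] (RatFunc F) x.denom =
      algebraMap F[X] (RatFunc F) (x.num - C c * x.denom) := by
    rw [sub_mul, map_sub, map_mul, RatFunc.algebraMap_C]
    congr 1
    nth_rw 1 [← RatFunc.num_div_denom x]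
    field_simp
  have hlt : vInf F (algebraMap F[X] (RatFunc F) (x.num - C c * x.denom)) <
      WithZero.exp (m : ℤ) := by
    by_cases hz : x.num - C c * x.denom = 0
    · rw [hz]
      simp
    · rw [vInf_polynomial hz, WithZero.exp_lt_exp]
      norm_cast
      refine lt_of_le_of_ne ?_ ?_
      · refine (natDegree_sub_le _ _).trans (max_le hle ((natDegree_C_mul_le _ _).trans le_rfl))
      · intro h
        have : (x.num - C c * x.denom).coeff m = 0 := by
          rw [coeff_sub, coeff_C_mul, hlc, mul_one, sub_self]
        rw [← h] at this
        exact hz (leadingCoeff_eq_zero.1 this)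
  rw [← e, map_mul, vInf_polynomial hd] at hlt
  by_contra! h
  exact absurd hlt (not_lt.2 (le_mul_of_one_le_left' h))

theorem exists_residue (x : KInf F) (hx : Valued.v x ≤ (1 : WithZero (Multiplicative ℤ))) :
    ∃ c : F, Valued.v (x - algebraMap (RatFunc F) (KInf F) (RatFunc.C c)) <
      (1 : WithZero (Multiplicative ℤ)) := by
  obtain ⟨y, hy⟩ := exists_ratFunc_near x 0
  rw [WithZero.exp_zero] at hy
  have hy1 : vInf F y ≤ 1 := by
    rw [← valued_algebraMap]
    have : algebraMap (RatFunc F) (KInf F) y = x - (x - algebraMap (RatFunc F) (KInf F) y) := by ring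
    rw [this]
    exact (Valuation.map_sub _ _ _).trans (max_le hx hy.le)
  obtain ⟨c, hc⟩ := exists_residue_ratFunc y hy1
  refine ⟨c, ?_⟩
  have : x - algebraMap (RatFunc F) (KInf F) (RatFunc.C c) =
      (x - algebraMap (RatFunc F) (KInf F) y) + algebraMap (RatFunc F) (KInf F) (y - RatFunc.C c) := by
    rw [map_sub]; ring
  rw [this]
  refine (Valuation.map_add _ _ _).trans_lt (max_lt hy ?_)
  rwa [valued_algebraMap]

end Infinity

/-! ### Orders over rings with common generators -/

section GenericOrders

variable {R L : Type*} [CommRing R] [Field L] [Algebra R L]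

theorem conjOrder_eq_iff {g h : GL (Fin 2) L} {D D' : Subalgebra R (Matrix (Fin 2) (Fin 2) L)} :
    conjOrder g D = conjOrder h D' ↔ conjOrder (h⁻¹ * g) D = D' := by
  constructor
  · intro e
    rw [conjOrder_mul, e, ← conjOrder_mul, inv_mul_cancel, conjOrder_one]
  · intro e
    rw [← e, ← conjOrder_mul, mul_inv_cancel_left]

theorem conjOrder_inf (g : GL (Fin 2) L) (D D' : Subalgebra R (Matrix (Fin 2) (Fin 2) L)) :
    conjOrder g (D ⊓ D') = conjOrder g D ⊓ conjOrder g D' := by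
  ext x
  simp only [mem_conjOrder, Algebra.mem_inf]

/-- An order is stable under conjugation by scalar multiples of its units. -/
theorem conjOrder_eq_self {D : Subalgebra R (Matrix (Fin 2) (Fin 2) L)} {k : GL (Fin 2) L} {c : L}
    (hc : c ≠ 0) (h : c • (k : Matrix (Fin 2) (Fin 2) L) ∈ D)
    (h' : c⁻¹ • ((k⁻¹ : GL (Fin 2) L) : Matrix (Fin 2) (Fin 2) L) ∈ D) : conjOrder k D = D := by
  ext x
  rw [mem_conjOrder]
  constructor
  · intro hx
    have := mul_mem (mul_mem h hx) h'
    simpa [mul_assoc, smul_smul, hc] using this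
  · intro hx
    have := mul_mem (mul_mem h' hx) h
    simpa [mul_assoc, smul_smul, hc] using this

theorem mem_splitOrder {a : L} {x : Matrix (Fin 2) (Fin 2) L} : x ∈ splitOrder R L a ↔
    x 0 0 ∈ (algebraMap R L).range ∧ a * x 0 1 ∈ (algebraMap R L).range ∧
      (∃ r : R, x 1 0 = a * algebraMap R L r) ∧ x 1 1 ∈ (algebraMap R L).range :=
  Iff.rfl

theorem mem_splitOrder_one {x : Matrix (Fin 2) (Fin 2) L} :
    x ∈ splitOrder R L 1 ↔ ∀ i j, x i j ∈ (algebraMap R L).range := by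
  rw [mem_splitOrder]
  simp only [Fin.forall_fin_two, one_mul, RingHom.mem_range]
  constructor
  · rintro ⟨h1, h2, ⟨r, h3⟩, h4⟩
    exact ⟨⟨h1, h2⟩, ⟨r, h3.symm⟩, h4⟩
  · rintro ⟨⟨h1, h2⟩, ⟨r, h3⟩, h4⟩
    exact ⟨h1, h2, ⟨r, h3.symm⟩, h4⟩

/-- The matrix `[a, b; 0, 1]`, for `a ≠ 0`. -/
def affGL (a b : L) : GL (Fin 2) L :=
  letI : Decidable (a = 0) := Classical.dec _
  if h : a = 0 then 1 else Matrix.GeneralLinearGroup.mkOfDetNeZero !![a, b; 0, 1] (by simpa using h)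

theorem coe_affGL {a : L} (ha : a ≠ 0) (b : L) :
    (affGL a b : Matrix (Fin 2) (Fin 2) L) = !![a, b; 0, 1] := by
  rw [affGL, dif_neg ha]
  rfl

theorem coe_inv_GL (g : GL (Fin 2) L) : ((g⁻¹ : GL (Fin 2) L) : Matrix (Fin 2) (Fin 2) L) =
    (g 0 0 * g 1 1 - g 0 1 * g 1 0)⁻¹ • !![g 1 1, -g 0 1; -g 1 0, g 0 0] := by
  rw [Matrix.coe_units_inv, Matrix.inv_def, Matrix.adjugate_fin_two, Matrix.det_fin_two,
    Ring.inverse_eq_inv']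

theorem coe_inv_affGL {a : L} (ha : a ≠ 0) (b : L) :
    ((affGL a b)⁻¹ : GL (Fin 2) L).val = !![a⁻¹, -(a⁻¹ * b); 0, 1] := by
  rw [coe_inv_GL, coe_affGL ha]
  ext i j
  fin_cases i <;> fin_cases j <;> simp [ha]

theorem det_GL_ne_zero (g : GL (Fin 2) L) : g 0 0 * g 1 1 - g 0 1 * g 1 0 ≠ 0 := by
  have := g.det_ne_zero
  rwa [Matrix.det_fin_two] at this

theorem affGL_mul {a a' : L} (ha : a ≠ 0) (ha' : a' ≠ 0) (b b' : L) :
    affGL a b * affGL a' b' = affGL (a * a') (a * b' + b) := by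
  apply Units.ext
  rw [Units.val_mul, coe_affGL ha, coe_affGL ha', coe_affGL (mul_ne_zero ha ha')]
  ext i j
  fin_cases i <;> fin_cases j <;> simp [Matrix.mul_apply, Fin.sum_univ_two]

theorem conjOrder_affGL_splitOrder {a : L} (ha : a ≠ 0) :
    conjOrder (affGL a 0) (splitOrder R L 1) = splitOrder R L a⁻¹ := by
  ext x
  rw [mem_conjOrder, coe_inv_affGL ha, coe_affGL ha, mem_splitOrder, mem_splitOrder]
  simp only [Matrix.mul_apply, Fin.sum_univ_two, Matrix.of_apply, Matrix.cons_val',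
    Matrix.cons_val_zero, Matrix.cons_val_one, Matrix.cons_val_fin_one, mul_zero, neg_zero,
    zero_mul, add_zero, zero_add, one_mul, mul_one]
  have e1 : a⁻¹ * x 0 0 * a = x 0 0 := by field_simp
  rw [e1]
  refine and_congr Iff.rfl (and_congr Iff.rfl (and_congr ?_ Iff.rfl))
  refine exists_congr fun r => ?_
  rw [eq_inv_mul_iff_mul_eq₀ ha, mul_comm]

variable (R L) in
/-- Any two elements of `L` have a common generator over `R`. For a fraction field this says
that `R` is a Bézout domain. -/
def HasCommonGenerators : Prop :=
  ∀ x y : L, ∃ z : L, ∃ r s p q : R, z = r • x + s • y ∧ x = p • z ∧ y = q • z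

/-- Finite generation reduces the claim to a sum of two cyclic submodules, and common generators
make such a sum cyclic. -/
theorem HasCommonGenerators.exists_generator (h : HasCommonGenerators R L) {I : Submodule R L}
    (hI : I.FG) : ∃ z ∈ I, ∀ x ∈ I, ∃ r : R, x = r • z := by
  induction I, hI using Submodule.fg_induction with
  | singleton x =>
    refine ⟨x, Submodule.mem_span_singleton_self x, fun y hy => ?_⟩
    obtain ⟨r, rfl⟩ := Submodule.mem_span_singleton.1 hy
    exact ⟨r, rfl⟩
  | sup I J _ _ hI hJ =>
    obtain ⟨x, hx, hx'⟩ := hI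
    obtain ⟨y, hy, hy'⟩ := hJ
    obtain ⟨z, r, s, p, q, hz, hp, hq⟩ := h x y
    refine ⟨z, ?_, fun w hw => ?_⟩
    · rw [hz]
      exact add_mem (Submodule.smul_mem _ _ (Submodule.mem_sup_left hx))
        (Submodule.smul_mem _ _ (Submodule.mem_sup_right hy))
    · obtain ⟨u, hu, v, hv, rfl⟩ := Submodule.mem_sup.1 hw
      obtain ⟨k, rfl⟩ := hx' u hu
      obtain ⟨l, rfl⟩ := hy' v hv
      refine ⟨k * p + l * q, ?_⟩
      rw [add_smul, mul_smul, mul_smul, ← hp, ← hq]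

/-- Integral closedness in disguise: `I = R z` with `z ≠ 0`, and `z * z = s • z` gives `z = s`, so
`I` consists of elements of `R`. -/
theorem HasCommonGenerators.mem_range_of_fg (h : HasCommonGenerators R L) {I : Submodule R L}
    (hI : I.FG) (h1 : (1 : L) ∈ I) (hm : ∀ x ∈ I, ∀ y ∈ I, x * y ∈ I) {x : L} (hx : x ∈ I) :
    x ∈ (algebraMap R L).range := by
  obtain ⟨z, hz, hz'⟩ := h.exists_generator hI
  obtain ⟨r, hr⟩ := hz' 1 h1
  have hz0 : z ≠ 0 := by
    rintro rfl
    simp at hr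
  obtain ⟨s, hs⟩ := hz' _ (hm z hz z hz)
  obtain ⟨k, rfl⟩ := hz' x hx
  refine ⟨k * s, ?_⟩
  rw [Algebra.smul_def] at hs
  rw [map_mul, Algebra.smul_def, mul_right_cancel₀ hz0 hs]

/-- With the idempotent `e` at `(i, i)` in `D`, the corner `e D e` lies in `D`. Hence the `(i, i)`
entries form a finitely generated module closed under products. -/
theorem HasCommonGenerators.entry_mem_range (h : HasCommonGenerators R L)
    {D : Subalgebra R (Matrix (Fin 2) (Fin 2) L)} (hD : IsOrder R L D) {i : Fin 2}
    (hi : Matrix.single i i (1 : L) ∈ D) {x : Matrix (Fin 2) (Fin 2) L} (hx : x ∈ D) :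
    x i i ∈ (algebraMap R L).range := by
  have key : ∀ y : Matrix (Fin 2) (Fin 2) L, y ∈ D → Matrix.single i i (y i i) ∈ D := by
    intro y hy
    have := mul_mem (mul_mem hi hy) hi
    simpa using this
  refine h.mem_range_of_fg (I := (Subalgebra.toSubmodule D).map (Matrix.entryLinearMap R L i i))
    (hD.1.map _) ⟨1, D.one_mem, by simp⟩ ?_ ⟨x, hx, rfl⟩
  rintro _ ⟨y, hy, rfl⟩ _ ⟨z, hz, rfl⟩
  exact ⟨_, D.mul_mem (key y hy) (key z hz), by simp⟩

theorem isOrder_splitOrder_one : IsOrder R L (splitOrder R L 1) := by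
  have hmem : ∀ i j, Matrix.single i j (1 : L) ∈ splitOrder R L 1 := by
    intro i j
    rw [mem_splitOrder_one]
    intro k l
    rw [Matrix.single_apply]
    split_ifs
    · exact one_mem _
    · exact zero_mem _
  refine ⟨?_, ?_⟩
  · refine Submodule.fg_def.2 ⟨Set.range fun p : Fin 2 × Fin 2 => Matrix.single p.1 p.2 (1 : L),
      Set.finite_range _, le_antisymm (Submodule.span_le.2 ?_) ?_⟩
    · rintro _ ⟨p, rfl⟩
      exact hmem _ _
    · intro x hx
      have hx' := mem_splitOrder_one.1 hx
      choose r hr using hx'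
      rw [Matrix.matrix_eq_sum_single x]
      refine sum_mem fun i _ => sum_mem fun j _ => ?_
      have e : Matrix.single i j (x i j) = r i j • Matrix.single i j (1 : L) := by
        rw [Matrix.smul_single, ← hr, Algebra.algebraMap_eq_smul_one]
      rw [e]
      exact Submodule.smul_mem _ _ (Submodule.subset_span ⟨(i, j), rfl⟩)
  · rw [eq_top_iff]
    intro x _
    rw [Matrix.matrix_eq_sum_single x]
    refine sum_mem fun i _ => sum_mem fun j _ => ?_
    have e : Matrix.single i j (x i j) = x i j • Matrix.single i j (1 : L) := by
      rw [Matrix.smul_single, smul_eq_mul, mul_one]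
    rw [e]
    exact Submodule.smul_mem _ _ (Submodule.subset_span (hmem i j))

theorem HasCommonGenerators.isMaximalOrder_splitOrder_one (h : HasCommonGenerators R L) :
    IsMaximalOrder R L (splitOrder R L 1) := by
  refine ⟨isOrder_splitOrder_one, fun D hD hle x hx => ?_⟩
  have hmem : ∀ i j, Matrix.single i j (1 : L) ∈ D := by
    intro i j
    refine hle (mem_splitOrder_one.2 fun k l => ?_)
    rw [Matrix.single_apply]
    split_ifs
    · exact one_mem _
    · exact zero_mem _
  refine mem_splitOrder_one.2 fun i j => ?_
  -- The entry `x i j` is moved to the diagonal as the `(i, i)` entry of `x` times the matrix unit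
  -- at `(j, i)`.
  have := h.entry_mem_range hD (hmem i i) (mul_mem hx (hmem j i))
  simpa using this

theorem HasCommonGenerators.isMaximalOrder_splitOrder (h : HasCommonGenerators R L) {a : L}
    (ha : a ≠ 0) : IsMaximalOrder R L (splitOrder R L a) := by
  have := h.isMaximalOrder_splitOrder_one.conj (affGL a⁻¹ 0)
  rwa [conjOrder_affGL_splitOrder (inv_ne_zero ha), inv_inv] at this

/-- Only scalar multiples of invertible matrices over `R` normalize `M₂(R)`. -/
theorem HasCommonGenerators.exists_smul_mem (h : HasCommonGenerators R L) {k : GL (Fin 2) L}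
    (hk : conjOrder k (splitOrder R L 1) = splitOrder R L 1) :
    ∃ c : L, c ≠ 0 ∧ c • (k : Matrix (Fin 2) (Fin 2) L) ∈ splitOrder R L 1 ∧
      c⁻¹ • ((k⁻¹ : GL (Fin 2) L) : Matrix (Fin 2) (Fin 2) L) ∈ splitOrder R L 1 := by
  -- These products are the entries of the conjugate by `k` of the matrix unit at `(i, j)`.
  have hprod : ∀ p i j q, k p i * (k⁻¹) j q ∈ (algebraMap R L).range := by
    intro p i j q
    have h1 : (k : Matrix (Fin 2) (Fin 2) L) * Matrix.single i j (1 : L) *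
        ((k⁻¹ : GL (Fin 2) L) : Matrix (Fin 2) (Fin 2) L) ∈ splitOrder R L 1 := by
      rw [← hk, mem_conjOrder]
      simp only [mul_assoc, Units.inv_mul, mul_one, Units.inv_mul_cancel_left]
      refine mem_splitOrder_one.2 fun k l => ?_
      rw [Matrix.single_apply]
      split_ifs
      · exact one_mem _
      · exact zero_mem _
    have h2 := mem_splitOrder_one.1 h1 p q
    rw [Matrix.mul_apply] at h2
    simpa [Matrix.mul_single_apply_same, Matrix.mul_single_apply_of_ne, Fin.sum_univ_two,
      Matrix.mul_apply, Matrix.single_apply, ite_and] using h2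
  -- The scalar is the inverse of a generator `z` of the module of entries of `k`. All entries of
  -- `k` are multiples of `z`, and `z` is a combination of them, so `hprod` makes `z k⁻¹` integral.
  obtain ⟨z, hz, hz'⟩ := h.exists_generator
    (I := Submodule.span R (Set.range fun p : Fin 2 × Fin 2 => k p.1 p.2))
    (Submodule.fg_span (Set.finite_range _))
  have hmem : ∀ i j, k i j ∈ Submodule.span R (Set.range fun p : Fin 2 × Fin 2 => k p.1 p.2) :=
    fun i j => Submodule.subset_span ⟨(i, j), rfl⟩
  have hz0 : z ≠ 0 := by
    rintro rfl
    have : ∀ i j, k i j = 0 := fun i j => by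
      obtain ⟨r, hr⟩ := hz' _ (hmem i j)
      rw [hr, smul_zero]
    exact det_GL_ne_zero k (by simp [this])
  refine ⟨z⁻¹, inv_ne_zero hz0, mem_splitOrder_one.2 fun i j => ?_,
    mem_splitOrder_one.2 fun j q => ?_⟩
  · obtain ⟨r, hr⟩ := hz' _ (hmem i j)
    refine ⟨r, ?_⟩
    rw [Matrix.smul_apply, hr, Algebra.smul_def r z, smul_eq_mul]
    field_simp
  · rw [inv_inv, Matrix.smul_apply, smul_eq_mul]
    clear hz' hz0
    induction hz using Submodule.span_induction with
    | mem x hx =>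
      obtain ⟨p, rfl⟩ := hx
      exact hprod _ _ _ _
    | zero => simp
    | add x y _ _ hx hy =>
      rw [add_mul]
      exact add_mem hx hy
    | smul r x _ hx =>
      rw [smul_mul_assoc, Algebra.smul_def]
      exact mul_mem ⟨r, rfl⟩ hx

end GenericOrders

/-! ### Upper triangular form of maximal orders -/

section GenericOrders

variable {R L : Type*} [CommRing R] [Field L] [Algebra R L]

theorem IsOrder.exists_linear_ne_zero {D : Subalgebra R (Matrix (Fin 2) (Fin 2) L)}
    (hD : IsOrder R L D) {φ : Matrix (Fin 2) (Fin 2) L →ₗ[L] L} (hφ : φ ≠ 0) :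
    ∃ x ∈ D, φ x ≠ 0 := by
  by_contra! h
  refine hφ (LinearMap.ext_on hD.2 fun x hx => ?_)
  exact h x hx

/-- Every order is contained in the endomorphism ring of a free lattice, which has a basis in
upper triangular form. -/
theorem HasCommonGenerators.exists_le_conjOrder_affGL (h : HasCommonGenerators R L)
    {D : Subalgebra R (Matrix (Fin 2) (Fin 2) L)} (hD : IsOrder R L D) :
    ∃ a b : L, a ≠ 0 ∧ D ≤ conjOrder (affGL a b) (splitOrder R L 1) := by
  -- The lattice is the set of first columns of elements of `D`, which is stable under `D`. The
  -- column of `μ` generates its projection to the second coordinate.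
  obtain ⟨y, hy, hy'⟩ := h.exists_generator
    (I := (Subalgebra.toSubmodule D).map (Matrix.entryLinearMap R L 1 0)) (hD.1.map _)
  obtain ⟨μ, hμ, rfl⟩ := hy
  replace hy' : ∀ x ∈ D, ∃ r : R, x 1 0 = algebraMap R L r * μ 1 0 := by
    intro x hx
    obtain ⟨r, hr⟩ := hy' _ ⟨x, hx, rfl⟩
    exact ⟨r, by rw [← Algebra.smul_def]; exact hr⟩
  have hy0 : μ 1 0 ≠ 0 := by
    intro h0
    obtain ⟨x, hx, hx'⟩ := hD.exists_linear_ne_zero (φ := Matrix.entryLinearMap L L 1 0) (by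
      intro h
      simpa using LinearMap.congr_fun h (Matrix.single 1 0 1))
    obtain ⟨r, hr⟩ := hy' x hx
    exact hx' (by simpa [h0] using hr)
  set b := μ 0 0 / μ 1 0 with hb
  have hμb : μ 0 0 = b * μ 1 0 := by rw [hb]; field_simp
  -- The form `φ` vanishes on the column of `μ`, so a generator of `φ(D)` yields the basis vector
  -- with second coordinate `0`.
  let φ : Matrix (Fin 2) (Fin 2) L →ₗ[L] L :=
    Matrix.entryLinearMap L L 0 0 - b • Matrix.entryLinearMap L L 1 0
  have hφ : ∀ x, φ x = x 0 0 - b * x 1 0 := fun x => rfl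
  obtain ⟨z, hz, hz'⟩ := h.exists_generator
    (I := (Subalgebra.toSubmodule D).map (φ.restrictScalars R)) (hD.1.map _)
  obtain ⟨ν, hν, rfl⟩ := hz
  replace hz' : ∀ x ∈ D, ∃ r : R, x 0 0 - b * x 1 0 = algebraMap R L r * φ ν := by
    intro x hx
    obtain ⟨r, hr⟩ := hz' _ ⟨x, hx, rfl⟩
    exact ⟨r, by rw [← Algebra.smul_def, ← hφ]; exact hr⟩
  have hz0 : φ ν ≠ 0 := by
    intro h0
    obtain ⟨x, hx, hx'⟩ := hD.exists_linear_ne_zero (φ := φ) (by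
      intro h
      have := LinearMap.congr_fun h (Matrix.single 0 0 1)
      rw [hφ] at this
      simp at this)
    obtain ⟨r, hr⟩ := hz' x hx
    exact hx' (by rw [hφ, hr, h0, mul_zero])
  -- an element of `D` whose first column is a multiple of the first basis vector
  obtain ⟨k, hk⟩ := hy' ν hν
  set κ := ν - k • μ with hκ
  have hκD : κ ∈ D := sub_mem hν (Subalgebra.smul_mem _ hμ _)
  have hκ1 : κ 1 0 = 0 := by
    rw [hκ, Matrix.sub_apply, Matrix.smul_apply, hk, Algebra.smul_def, sub_self]
  have hκ0 : κ 0 0 = φ ν := by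
    rw [hκ, Matrix.sub_apply, Matrix.smul_apply, hφ, hk, Algebra.smul_def, hμb]
    ring
  -- The columns of `κ` and `μ` are `μ 1 0` times the columns of `[a, b; 0, 1]`. Stability of the
  -- lattice under `x`, tested on these two, gives the four entries below.
  set a := φ ν / μ 1 0 with ha
  have ha0 : a ≠ 0 := div_ne_zero hz0 hy0
  have hza : φ ν = a * μ 1 0 := by rw [ha]; field_simp
  refine ⟨a, b, ha0, fun x hx => ?_⟩
  have c1 : ∀ w ∈ D, ∃ r : R, (x * w) 0 0 - b * (x * w) 1 0 = algebraMap R L r * φ ν :=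
    fun w hw => hz' _ (mul_mem hx hw)
  have c2 : ∀ w ∈ D, ∃ r : R, (x * w) 1 0 = algebraMap R L r * μ 1 0 :=
    fun w hw => hy' _ (mul_mem hx hw)
  obtain ⟨r1, h1⟩ := c1 κ hκD
  obtain ⟨r2, h2⟩ := c2 κ hκD
  obtain ⟨r3, h3⟩ := c1 μ hμ
  obtain ⟨r4, h4⟩ := c2 μ hμ
  simp only [Matrix.mul_apply, Fin.sum_univ_two, hκ0, hκ1, mul_zero, add_zero, hμb, hza] at h1 h2 h3 h4
  rw [mem_conjOrder, coe_inv_affGL ha0, coe_affGL ha0, mem_splitOrder_one]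
  intro i j
  fin_cases i <;> fin_cases j <;>
    simp only [Matrix.mul_apply, Fin.sum_univ_two, Matrix.of_apply, Matrix.cons_val',
      Matrix.cons_val_zero, Matrix.cons_val_one, Matrix.cons_val_fin_one, Fin.zero_eta,
      Fin.mk_one, zero_mul, zero_add, one_mul, mul_zero, mul_one, add_zero]
  · refine ⟨r1, mul_right_cancel₀ (mul_ne_zero ha0 hy0) ?_⟩
    rw [← h1]
    field_simp
    ring
  · refine ⟨r3, mul_right_cancel₀ (mul_ne_zero ha0 hy0) ?_⟩
    rw [← h3]
    field_simp
    ring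
  · refine ⟨r2, mul_right_cancel₀ hy0 ?_⟩
    rw [← h2]
    ring
  · refine ⟨r4, mul_right_cancel₀ hy0 ?_⟩
    rw [← h4]
    ring

theorem HasCommonGenerators.exists_eq_conjOrder_affGL (h : HasCommonGenerators R L)
    {D : Subalgebra R (Matrix (Fin 2) (Fin 2) L)} (hD : IsMaximalOrder R L D) :
    ∃ a b : L, a ≠ 0 ∧ D = conjOrder (affGL a b) (splitOrder R L 1) := by
  obtain ⟨a, b, ha, hle⟩ := h.exists_le_conjOrder_affGL hD.1
  exact ⟨a, b, ha, le_antisymm hle (hD.2 (isOrder_splitOrder_one.conj _) hle)⟩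

/-- After clearing denominators, the generator of the ideal spanned by the two numerators serves. -/
theorem hasCommonGenerators_of_isBezout [IsDomain R] [IsBezout R] [IsFractionRing R L] :
    HasCommonGenerators R L := by
  intro x y
  obtain ⟨d, hd⟩ := IsLocalization.exist_integer_multiples_of_finset (nonZeroDivisors R)
    (S := L) ({x, y} : Set L).toFinite.toFinset
  have hx := hd x (by simp)
  have hy := hd y (by simp)
  obtain ⟨p, hp⟩ := hx
  obtain ⟨q, hq⟩ := hy
  have hd0 : algebraMap R L (d : R) ≠ 0 := IsLocalization.to_map_ne_zero_of_mem_nonZeroDivisors L le_rfl d.2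
  obtain ⟨z, hz⟩ := IsBezout.span_pair_isPrincipal p q
  have hz1 : z ∈ Ideal.span {p, q} := by rw [hz]; exact Ideal.mem_span_singleton_self z
  obtain ⟨r, s, hrs⟩ := Ideal.mem_span_pair.1 hz1
  have hp1 : p ∈ Ideal.span {z} := by
    rw [← Ideal.submodule_span_eq, ← hz]; exact Ideal.subset_span (by simp)
  have hq1 : q ∈ Ideal.span {z} := by
    rw [← Ideal.submodule_span_eq, ← hz]; exact Ideal.subset_span (by simp)
  obtain ⟨k, rfl⟩ := Ideal.mem_span_singleton'.1 hp1
  obtain ⟨l, rfl⟩ := Ideal.mem_span_singleton'.1 hq1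
  rw [Algebra.smul_def] at hp hq
  refine ⟨algebraMap R L z / algebraMap R L d, r, s, k, l, ?_, ?_, ?_⟩ <;>
    simp only [Algebra.smul_def]
  · have e := congrArg (algebraMap R L) hrs
    rw [map_add, map_mul _ r, map_mul _ s, hp, hq] at e
    rw [div_eq_iff hd0, ← e]
    field_simp
  · rw [← mul_div_assoc, eq_div_iff hd0, ← map_mul, hp, mul_comm]
  · rw [← mul_div_assoc, eq_div_iff hd0, ← map_mul, hq, mul_comm]

end GenericOrders

/-! ### Common generators over `O` and over `F[t]` -/

section Tree

variable {F : Type*} [Field F]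

theorem mem_range_OInf {x : KInf F} : x ∈ (algebraMap (OInf F) (KInf F)).range ↔
    Valued.v x ≤ (1 : WithZero (Multiplicative ℤ)) :=
  ⟨fun ⟨r, hr⟩ => hr ▸ r.2, fun h => ⟨⟨x, h⟩, rfl⟩⟩

/-- Over a valuation ring, the element of larger valuation divides the other. -/
theorem hasCommonGenerators_OInf : HasCommonGenerators (OInf F) (KInf F) := by
  have key : ∀ x y : KInf F, (Valued.v y : WithZero (Multiplicative ℤ)) ≤ Valued.v x →
      ∃ r : OInf F, y = r • x := by
    intro x y hxy
    by_cases hx : x = 0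
    · refine ⟨0, ?_⟩
      rw [hx, map_zero, le_zero_iff, map_eq_zero] at hxy
      rw [hxy, zero_smul]
    · have hv : (Valued.v x : WithZero (Multiplicative ℤ)) ≠ 0 := by simpa using hx
      refine ⟨⟨y / x, ?_⟩, ?_⟩
      · change Valued.v (y / x) ≤ (1 : WithZero (Multiplicative ℤ))
        rw [map_div₀]
        exact div_le_one_of_le₀ hxy zero_le
      · change y = y / x * x
        field_simp
  intro x y
  rcases le_total (Valued.v y : WithZero (Multiplicative ℤ)) (Valued.v x) with h | h
  · obtain ⟨r, hr⟩ := key _ _ h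
    exact ⟨x, 1, 0, 1, r, by simp, by simp, hr⟩
  · obtain ⟨r, hr⟩ := key _ _ h
    exact ⟨y, 0, 1, r, 1, by simp, hr, by simp⟩

theorem hasCommonGenerators_polynomial : HasCommonGenerators F[X] (RatFunc F) :=
  hasCommonGenerators_of_isBezout

end Tree

/-! ### Vertices of the tree as balls -/

section Tree

variable {F : Type*} [Field F]

/-- The matrix `k / s` has integral entries and determinant of valuation `1`, so it lies in
`GL₂(O)`. -/
theorem conjOrder_splitOrder_one_of_valued {k : GL (Fin 2) (KInf F)} {s : KInf F}
    (h : ∀ i j, (Valued.v (k i j) : WithZero (Multiplicative ℤ)) ≤ Valued.v s)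
    (hdet : (Valued.v (k 0 0 * k 1 1 - k 0 1 * k 1 0) : WithZero (Multiplicative ℤ)) =
      Valued.v s ^ 2) :
    conjOrder k (splitOrder (OInf F) (KInf F) 1) = splitOrder (OInf F) (KInf F) 1 := by
  have hs : s ≠ 0 := by
    rintro rfl
    rw [map_zero, zero_pow two_ne_zero, map_eq_zero] at hdet
    exact det_GL_ne_zero k hdet
  have hvs : (Valued.v s : WithZero (Multiplicative ℤ)) ≠ 0 := by simpa using hs
  refine conjOrder_eq_self (inv_ne_zero hs) ?_ ?_
  · refine mem_splitOrder_one.2 fun i j => mem_range_OInf.2 ?_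
    rw [Matrix.smul_apply, smul_eq_mul, map_mul, map_inv₀]
    exact inv_mul_le_one_of_le₀ (h i j) zero_le
  · rw [inv_inv, coe_inv_GL]
    refine mem_splitOrder_one.2 fun i j => mem_range_OInf.2 ?_
    have key : ∀ y : KInf F, (Valued.v y : WithZero (Multiplicative ℤ)) ≤ Valued.v s →
        (Valued.v (s * ((k 0 0 * k 1 1 - k 0 1 * k 1 0)⁻¹ * y)) :
          WithZero (Multiplicative ℤ)) ≤ 1 := by
      intro y hy
      rw [map_mul, map_mul, map_inv₀, hdet]
      calc _ = (Valued.v s : WithZero (Multiplicative ℤ))⁻¹ * Valued.v y := by field_simp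
        _ ≤ 1 := inv_mul_le_one_of_le₀ hy zero_le
    rw [Matrix.smul_apply, Matrix.smul_apply, smul_eq_mul, smul_eq_mul]
    refine key _ ?_
    fin_cases i <;> fin_cases j <;> simp [h]

/-- For the scalar `c` with `c k` and `c⁻¹ k⁻¹` both integral, the two determinants are integral
with product `1`, hence units. The scale is `s = c⁻¹`. -/
theorem exists_valued_of_conjOrder_splitOrder_one {k : GL (Fin 2) (KInf F)}
    (h : conjOrder k (splitOrder (OInf F) (KInf F) 1) = splitOrder (OInf F) (KInf F) 1) :
    ∃ s : KInf F, s ≠ 0 ∧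
      (∀ i j, (Valued.v (k i j) : WithZero (Multiplicative ℤ)) ≤ Valued.v s) ∧
      (Valued.v (k 0 0 * k 1 1 - k 0 1 * k 1 0) : WithZero (Multiplicative ℤ)) =
        Valued.v s ^ 2 := by
  obtain ⟨c, hc, h1, h2⟩ := hasCommonGenerators_OInf.exists_smul_mem h
  have hvc : (Valued.v c : WithZero (Multiplicative ℤ)) ≠ 0 := by simpa using hc
  rw [mem_splitOrder_one] at h1 h2
  simp only [mem_range_OInf, Matrix.smul_apply, smul_eq_mul] at h1 h2
  have hd : ∀ m : Matrix (Fin 2) (Fin 2) (KInf F),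
      (∀ i j, (Valued.v (m i j) : WithZero (Multiplicative ℤ)) ≤ 1) →
      (Valued.v m.det : WithZero (Multiplicative ℤ)) ≤ 1 := by
    intro m hm
    rw [Matrix.det_fin_two]
    refine (Valuation.map_sub _ _ _).trans (max_le ?_ ?_) <;> rw [map_mul] <;>
      exact mul_le_one' (hm _ _) (hm _ _)
  have e1 := hd (c • (k : Matrix (Fin 2) (Fin 2) (KInf F))) h1
  have e2 := hd (c⁻¹ • ((k⁻¹ : GL (Fin 2) (KInf F)) : Matrix (Fin 2) (Fin 2) (KInf F))) h2
  have e3 : (c • (k : Matrix (Fin 2) (Fin 2) (KInf F))).det *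
      (c⁻¹ • ((k⁻¹ : GL (Fin 2) (KInf F)) : Matrix (Fin 2) (Fin 2) (KInf F))).det = 1 := by
    rw [← Matrix.det_mul, Matrix.smul_mul, Matrix.mul_smul, smul_smul, mul_inv_cancel₀ hc,
      one_smul, Units.mul_inv, Matrix.det_one]
  have e4 : (Valued.v (c • (k : Matrix (Fin 2) (Fin 2) (KInf F))).det :
      WithZero (Multiplicative ℤ)) = 1 := by
    refine le_antisymm e1 ?_
    have := congrArg (Valued.v : Valuation (KInf F) (WithZero (Multiplicative ℤ))) e3
    rw [map_mul, map_one] at this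
    rw [← this]
    exact mul_le_of_le_one_right' e2
  rw [Matrix.det_smul, Matrix.det_fin_two, map_mul, Fintype.card_fin, map_pow] at e4
  refine ⟨c⁻¹, inv_ne_zero hc, fun i j => ?_, ?_⟩
  · have := h1 i j
    rw [map_mul] at this
    rw [map_inv₀]
    exact (le_inv_mul_iff₀ (zero_lt_iff.2 hvc)).2 this |>.trans (by rw [mul_one])
  · rw [map_inv₀, inv_pow]
    exact eq_inv_of_mul_eq_one_right e4

/-- The bounds say that `[a', b'; 0, 1]⁻¹ n [a, b; 0, 1]` is `s` times an element of `GL₂(O)`: four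
for its entries, the last for its determinant. -/
theorem conjOrder_mul_affGL_eq (n : GL (Fin 2) (KInf F)) {a b a' b' s : KInf F} (ha : a ≠ 0)
    (ha' : a' ≠ 0)
    (h1 : (Valued.v (a * (n 0 0 - b' * n 1 0)) : WithZero (Multiplicative ℤ)) ≤
      Valued.v s * Valued.v a')
    (h2 : (Valued.v (n 0 0 * b + n 0 1 - b' * (n 1 0 * b + n 1 1)) :
      WithZero (Multiplicative ℤ)) ≤ Valued.v s * Valued.v a')
    (h3 : (Valued.v (n 1 0 * a) : WithZero (Multiplicative ℤ)) ≤ Valued.v s)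
    (h4 : (Valued.v (n 1 0 * b + n 1 1) : WithZero (Multiplicative ℤ)) ≤ Valued.v s)
    (h5 : (Valued.v (n 0 0 * n 1 1 - n 0 1 * n 1 0) : WithZero (Multiplicative ℤ)) *
      Valued.v a = Valued.v s ^ 2 * Valued.v a') :
    conjOrder (n * affGL a b) (splitOrder (OInf F) (KInf F) 1) =
      conjOrder (affGL a' b') (splitOrder (OInf F) (KInf F) 1) := by
  have hva : (Valued.v a' : WithZero (Multiplicative ℤ)) ≠ 0 := by simpa using ha'
  rw [conjOrder_eq_iff]
  have hk : (((affGL a' b')⁻¹ * (n * affGL a b) : GL (Fin 2) (KInf F)) :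
      Matrix (Fin 2) (Fin 2) (KInf F)) = !![(a * (n 0 0 - b' * n 1 0)) / a',
        (n 0 0 * b + n 0 1 - b' * (n 1 0 * b + n 1 1)) / a'; n 1 0 * a, n 1 0 * b + n 1 1] := by
    rw [Units.val_mul, Units.val_mul, coe_inv_affGL ha', coe_affGL ha]
    ext i j
    fin_cases i <;> fin_cases j <;> simp [Matrix.mul_apply, Fin.sum_univ_two] <;> field_simp <;>
      ring
  refine conjOrder_splitOrder_one_of_valued (s := s) ?_ ?_
  · rw [hk]
    intro i j
    fin_cases i <;> fin_cases j
    · change Valued.v ((a * (n 0 0 - b' * n 1 0)) / a') ≤ _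
      rw [map_div₀]
      exact div_le_of_le_mul₀ zero_le zero_le h1
    · change Valued.v ((n 0 0 * b + n 0 1 - b' * (n 1 0 * b + n 1 1)) / a') ≤ _
      rw [map_div₀]
      exact div_le_of_le_mul₀ zero_le zero_le h2
    · exact h3
    · exact h4
  · rw [hk]
    change Valued.v ((a * (n 0 0 - b' * n 1 0)) / a' * (n 1 0 * b + n 1 1) -
      (n 0 0 * b + n 0 1 - b' * (n 1 0 * b + n 1 1)) / a' * (n 1 0 * a)) = _
    have e : (a * (n 0 0 - b' * n 1 0)) / a' * (n 1 0 * b + n 1 1) -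
      (n 0 0 * b + n 0 1 - b' * (n 1 0 * b + n 1 1)) / a' * (n 1 0 * a) =
      (n 0 0 * n 1 1 - n 0 1 * n 1 0) * a / a' := by
      field_simp
      ring
    rw [e, map_div₀, map_mul, h5]
    field_simp

theorem affGL_one_zero {L : Type*} [Field L] : affGL (1 : L) 0 = 1 := by
  apply Units.ext
  rw [coe_affGL one_ne_zero]
  ext i j
  fin_cases i <;> fin_cases j <;> simp

theorem conjOrder_affGL_eq {a b a' b' : KInf F} (ha : a ≠ 0)
    (h : (Valued.v a : WithZero (Multiplicative ℤ)) = Valued.v a')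
    (hb : (Valued.v (b - b') : WithZero (Multiplicative ℤ)) ≤ Valued.v a') :
    conjOrder (affGL a b) (splitOrder (OInf F) (KInf F) 1) =
      conjOrder (affGL a' b') (splitOrder (OInf F) (KInf F) 1) := by
  have ha' : a' ≠ 0 := by
    rintro rfl
    rw [map_zero, map_eq_zero] at h
    exact ha h
  have := conjOrder_mul_affGL_eq 1 (b := b) (b' := b') (s := 1) ha ha' (by simp [h])
    (by simpa using hb) (by simp) (by simp) (by simp [h])
  rwa [one_mul] at this

/-- The transition matrix `[a / a', (b - b') / a'; 0, 1]` has scale `s`. Its entry `1` gives `|s| ≥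
1`, while `|a / a'| = |s|²` is at most `|s|`. So `|s| = 1`, and vertices are the same as balls. -/
theorem conjOrder_affGL_eq_iff {a b a' b' : KInf F} (ha : a ≠ 0) (ha' : a' ≠ 0) :
    conjOrder (affGL a b) (splitOrder (OInf F) (KInf F) 1) =
      conjOrder (affGL a' b') (splitOrder (OInf F) (KInf F) 1) ↔
    (Valued.v a : WithZero (Multiplicative ℤ)) = Valued.v a' ∧
      (Valued.v (b - b') : WithZero (Multiplicative ℤ)) ≤ Valued.v a' := by
  refine ⟨fun h => ?_, fun h => conjOrder_affGL_eq ha h.1 h.2⟩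
  have hva : (Valued.v a' : WithZero (Multiplicative ℤ)) ≠ 0 := by simpa using ha'
  rw [conjOrder_eq_iff] at h
  obtain ⟨s, hs, h1, h2⟩ := exists_valued_of_conjOrder_splitOrder_one h
  have hk : (((affGL a' b')⁻¹ * affGL a b : GL (Fin 2) (KInf F)) :
      Matrix (Fin 2) (Fin 2) (KInf F)) = !![a / a', (b - b') / a'; 0, 1] := by
    rw [Units.val_mul, coe_inv_affGL ha', coe_affGL ha]
    ext i j
    fin_cases i <;> fin_cases j <;> simp [Matrix.mul_apply, Fin.sum_univ_two] <;> field_simp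
    ring
  rw [hk] at h1 h2
  have h00 := h1 0 0
  have h01 := h1 0 1
  have h11 := h1 1 1
  simp only [Matrix.of_apply, Matrix.cons_val', Matrix.cons_val_zero, Matrix.cons_val_one,
    Matrix.cons_val_fin_one, map_one, mul_one, mul_zero, sub_zero] at h00 h01 h11 h2
  have hvs : (Valued.v s : WithZero (Multiplicative ℤ)) ≠ 0 := by simpa using hs
  have hs1 : (Valued.v s : WithZero (Multiplicative ℤ)) = 1 := by
    refine le_antisymm ?_ h11
    rw [h2, pow_two] at h00
    by_contra! hlt
    exact absurd h00 (not_le.2 (lt_mul_of_one_lt_left (zero_lt_iff.2 hvs) hlt))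
  rw [hs1, one_pow, map_div₀, div_eq_one_iff_eq hva] at h2
  rw [hs1, map_div₀, div_le_one₀ (zero_lt_iff.2 hva)] at h01
  exact ⟨h2, h01⟩

variable (F) in
/-- The vertex `M₂(O)` of the tree. -/
def baseVertex : TreeVertex F :=
  ⟨splitOrder (OInf F) (KInf F) 1, hasCommonGenerators_OInf.isMaximalOrder_splitOrder_one⟩

theorem TreeVertex.smul_val (n : GL (Fin 2) (RatFunc F)) (D : TreeVertex F) :
    (n • D).1 = conjOrder (Matrix.GeneralLinearGroup.map (algebraMap (RatFunc F) (KInf F)) n) D.1 :=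
  rfl

theorem map_affGL {K L : Type*} [Field K] [Field L] (f : K →+* L) {a : K} (ha : a ≠ 0) (b : K) :
    Matrix.GeneralLinearGroup.map f (affGL a b) = affGL (f a) (f b) := by
  apply Units.ext
  rw [coe_affGL (by simpa using ha)]
  change ((affGL a b : GL (Fin 2) K) : Matrix (Fin 2) (Fin 2) K).map f = _
  rw [coe_affGL ha]
  ext i j
  fin_cases i <;> fin_cases j <;> simp

/-- The vertex of the tree corresponding to the ball with center `b` and radius `|a|`. -/
def ballVertex (a b : RatFunc F) : TreeVertex F := affGL a b • baseVertex F

theorem ballVertex_val {a : RatFunc F} (ha : a ≠ 0) (b : RatFunc F) :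
    (ballVertex a b).1 = conjOrder (affGL (algebraMap (RatFunc F) (KInf F) a)
      (algebraMap (RatFunc F) (KInf F) b)) (splitOrder (OInf F) (KInf F) 1) := by
  rw [ballVertex, TreeVertex.smul_val, map_affGL _ ha]
  rfl

theorem ballVertex_eq_iff {a b a' b' : RatFunc F} (ha : a ≠ 0) (ha' : a' ≠ 0) :
    ballVertex a b = ballVertex a' b' ↔ vInf F a = vInf F a' ∧ vInf F (b - b') ≤ vInf F a' := by
  refine Subtype.ext_iff.trans ?_
  rw [ballVertex_val ha, ballVertex_val ha', conjOrder_affGL_eq_iff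
    (by simpa using ha) (by simpa using ha'), ← map_sub, valued_algebraMap, valued_algebraMap,
    valued_algebraMap]

/-- The certificate behind all equivalences below: for rational data everything reduces to degrees,
once the scale `s` is guessed. -/
theorem smul_ballVertex_eq (n : GL (Fin 2) (RatFunc F)) {a b a' b' : RatFunc F} (s : RatFunc F)
    (ha : a ≠ 0) (ha' : a' ≠ 0)
    (h1 : vInf F (a * (n 0 0 - b' * n 1 0)) ≤ vInf F s * vInf F a')
    (h2 : vInf F (n 0 0 * b + n 0 1 - b' * (n 1 0 * b + n 1 1)) ≤ vInf F s * vInf F a')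
    (h3 : vInf F (n 1 0 * a) ≤ vInf F s)
    (h4 : vInf F (n 1 0 * b + n 1 1) ≤ vInf F s)
    (h5 : vInf F (n 0 0 * n 1 1 - n 0 1 * n 1 0) * vInf F a = vInf F s ^ 2 * vInf F a') :
    n • ballVertex a b = ballVertex a' b' := by
  refine Subtype.ext ?_
  rw [TreeVertex.smul_val, ballVertex_val ha, ballVertex_val ha', ← conjOrder_mul]
  refine conjOrder_mul_affGL_eq _ (s := algebraMap (RatFunc F) (KInf F) s) (by simpa using ha)
    (by simpa using ha') ?_ ?_ ?_ ?_ ?_ <;>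
  simpa only [Matrix.GeneralLinearGroup.map_apply, ← map_sub (algebraMap (RatFunc F) (KInf F)),
    ← map_mul (algebraMap (RatFunc F) (KInf F)), ← map_add (algebraMap (RatFunc F) (KInf F)),
    valued_algebraMap]

/-- Moving the center by less than the radius does not change the ball, so density allows a rational
center. -/
theorem exists_eq_ballVertex (x : TreeVertex F) :
    ∃ (n : ℤ) (b : RatFunc F), x = ballVertex (RatFunc.X ^ n) b := by
  obtain ⟨a, b, ha, hx⟩ := hasCommonGenerators_OInf.exists_eq_conjOrder_affGL x.2
  have hva : (Valued.v a : WithZero (Multiplicative ℤ)) ≠ 0 := by simpa using ha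
  obtain ⟨b', hb'⟩ := exists_ratFunc_near b (WithZero.log (Valued.v a))
  rw [WithZero.exp_log hva] at hb'
  refine ⟨WithZero.log (Valued.v a), b', Subtype.ext ?_⟩
  have hv : (Valued.v a : WithZero (Multiplicative ℤ)) =
      Valued.v (algebraMap (RatFunc F) (KInf F) (RatFunc.X ^ (WithZero.log
        (Valued.v a : WithZero (Multiplicative ℤ))))) := by
    rw [valued_algebraMap, vInf_X_zpow, WithZero.exp_log hva]
  rw [hx, ballVertex_val (zpow_ne_zero _ RatFunc.X_ne_zero)]
  exact conjOrder_affGL_eq ha hv (by rw [← hv]; exact hb'.le)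

end Tree

/-! ### Neighbors of a vertex and connectedness -/

section Tree

variable {F : Type*} [Field F]

/-- For `k ∈ s GL₂(O)` the neighbor depends only on the second column of `k / s` modulo the
uniformizer, a point of the projective line over `F`. It is the point at infinity when `|k 1 1| <
|s|`, and otherwise the residue `c` of `k 0 1 / k 1 1`. -/
theorem conjOrder_mul_affGL_uniformizer {k : GL (Fin 2) (KInf F)} {π : KInf F}
    (hπ : Valued.v π = (WithZero.exp (-1 : ℤ)))
    (hk : conjOrder k (splitOrder (OInf F) (KInf F) 1) = splitOrder (OInf F) (KInf F) 1) :
    conjOrder (k * affGL π 0) (splitOrder (OInf F) (KInf F) 1) =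
      conjOrder (affGL (algebraMap (RatFunc F) (KInf F) RatFunc.X) 0)
        (splitOrder (OInf F) (KInf F) 1) ∨
    ∃ c : F, conjOrder (k * affGL π 0) (splitOrder (OInf F) (KInf F) 1) =
      conjOrder (affGL (algebraMap (RatFunc F) (KInf F) RatFunc.X⁻¹)
        (algebraMap (RatFunc F) (KInf F) (RatFunc.C c))) (splitOrder (OInf F) (KInf F) 1) := by
  obtain ⟨s, hs, h1, h2⟩ := exists_valued_of_conjOrder_splitOrder_one hk
  have hπ0 := (valuation_inv_uniformizer F hπ).1
  have hvs : (Valued.v s : WithZero (Multiplicative ℤ)) ≠ 0 := by simpa using hs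
  have hX : (Valued.v (algebraMap (RatFunc F) (KInf F) RatFunc.X) :
      WithZero (Multiplicative ℤ)) = WithZero.exp (1 : ℤ) := by
    rw [valued_algebraMap, vInf_X]
  have hX' : (Valued.v (algebraMap (RatFunc F) (KInf F) RatFunc.X⁻¹) :
      WithZero (Multiplicative ℤ)) = WithZero.exp (-1 : ℤ) := by
    rw [map_inv₀, map_inv₀, hX, WithZero.exp_neg]
  have hX0 : algebraMap (RatFunc F) (KInf F) RatFunc.X ≠ 0 := by
    simpa using RatFunc.X_ne_zero
  have hX0' : algebraMap (RatFunc F) (KInf F) RatFunc.X⁻¹ ≠ 0 := by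
    simpa using RatFunc.X_ne_zero
  have hone : (WithZero.exp (-1 : ℤ) : WithZero (Multiplicative ℤ)) * WithZero.exp (1 : ℤ) = 1 := by
    rw [← WithZero.exp_add]; simp
  have hle : (WithZero.exp (-1 : ℤ) : WithZero (Multiplicative ℤ)) ≤ 1 := by
    rw [← WithZero.exp_zero, WithZero.exp_le_exp]; norm_num
  rcases (h1 1 1).lt_or_eq with h | h
  · left
    have hlt : (Valued.v (k 1 1) : WithZero (Multiplicative ℤ)) ≤
        Valued.v s * WithZero.exp (-1 : ℤ) := by
      have : (Valued.v (k 1 1 / s) : WithZero (Multiplicative ℤ)) < 1 := by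
        rw [map_div₀, div_lt_one₀ (zero_lt_iff.2 hvs)]
        exact h
      rw [lt_one_iff_le_exp, map_div₀, div_le_iff₀ (zero_lt_iff.2 hvs), mul_comm] at this
      exact this
    -- The scale drops by one uniformizer: the target radius is `|X|` instead of `|π|`, and the
    -- determinant condition is quadratic in the scale.
    refine conjOrder_mul_affGL_eq k (s := s * algebraMap (RatFunc F) (KInf F) RatFunc.X⁻¹) hπ0 hX0
      ?_ ?_ ?_ ?_ ?_
    · rw [map_mul, map_mul, hπ, hX, hX', mul_assoc, hone, mul_one, zero_mul, sub_zero]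
      exact mul_le_of_le_one_of_le hle (h1 0 0)
    · rw [map_mul, hX, hX', mul_assoc, hone, mul_one, zero_mul, sub_zero, mul_zero, zero_add]
      exact h1 0 1
    · rw [map_mul, map_mul, hπ, hX']
      exact mul_le_mul_left (h1 1 0) _
    · rw [mul_zero, zero_add, map_mul, hX']
      exact hlt
    · rw [h2, hπ, map_mul, hX, hX', mul_pow, pow_two (WithZero.exp (-1 : ℤ)), mul_assoc, mul_assoc,
        hone, mul_one]
  · right
    have hk11 : k 1 1 ≠ 0 := by
      intro h0
      rw [h0, map_zero] at h
      exact hvs h.symm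
    obtain ⟨c, hc⟩ := exists_residue (k 0 1 / k 1 1) (by
      rw [map_div₀, div_le_one₀ (by rw [h]; exact zero_lt_iff.2 hvs), h]
      exact h1 0 1)
    refine ⟨c, conjOrder_mul_affGL_eq k (s := s) hπ0 hX0' ?_ ?_ ?_ ?_ ?_⟩
    · rw [map_mul, hπ, hX', mul_comm]
      refine mul_le_mul_left ((Valuation.map_sub _ _ _).trans (max_le (h1 0 0) ?_)) _
      rw [map_mul, valued_algebraMap]
      exact mul_le_of_le_one_of_le (vInf_C_le c) (h1 1 0)
    · rw [mul_zero, zero_add, mul_zero, zero_add, hX', ← h, mul_comm (Valued.v (k 1 1)),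
        ← div_le_iff₀ (by rw [h]; exact zero_lt_iff.2 hvs), ← map_div₀, sub_div,
        mul_div_cancel_right₀ _ hk11]
      exact lt_one_iff_le_exp.1 hc
    · rw [map_mul, hπ]
      exact mul_le_of_le_of_le_one (h1 1 0) hle
    · rw [mul_zero, zero_add]
      exact h1 1 1
    · rw [h2, hπ, hX']

/-- The matrices taking `M₂(O)` to its neighbors. -/
def neighborGL : Option F → GL (Fin 2) (RatFunc F)
  | none => affGL RatFunc.X 0
  | some c => affGL RatFunc.X⁻¹ (RatFunc.C c)

theorem smul_baseVertex_val (g : GL (Fin 2) (RatFunc F)) : (g • baseVertex F).1 =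
    conjOrder (Matrix.GeneralLinearGroup.map (algebraMap (RatFunc F) (KInf F)) g)
      (splitOrder (OInf F) (KInf F) 1) :=
  rfl

theorem bruhatTitsTree_adj_neighborGL (o : Option F) :
    (bruhatTitsTree F).Adj (baseVertex F) (neighborGL o • baseVertex F) := by
  set π := algebraMap (RatFunc F) (KInf F) RatFunc.X⁻¹ with hπd
  have hπ : Valued.v π = (WithZero.exp (-1 : ℤ)) := by
    rw [valued_algebraMap, map_inv₀, vInf_X, WithZero.exp_neg]
  have hπ0 := (valuation_inv_uniformizer F hπ).1
  cases o with
  | none =>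
    -- Seen from the larger ball, `M₂(O)` is the standard smaller neighbor, with uniformizer `X⁻¹`.
    refine SimpleGraph.Adj.symm ?_
    refine ⟨π, hπ, affGL (algebraMap (RatFunc F) (KInf F) RatFunc.X) 0, ?_, ?_⟩
    · change conjOrder (Matrix.GeneralLinearGroup.map (algebraMap (RatFunc F) (KInf F))
        (affGL RatFunc.X 0)) _ = _
      rw [map_affGL _ RatFunc.X_ne_zero, map_zero]
      rfl
    · have hX0 : algebraMap (RatFunc F) (KInf F) RatFunc.X ≠ 0 := by
        simpa using RatFunc.X_ne_zero
      rw [← conjOrder_affGL_splitOrder hπ0, ← conjOrder_mul, affGL_mul hX0 hπ0, hπd, ← map_mul,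
        mul_inv_cancel₀ RatFunc.X_ne_zero, map_one, mul_zero, add_zero, affGL_one_zero,
        conjOrder_one]
      rfl
  | some c =>
    refine ⟨π, hπ, affGL 1 (algebraMap (RatFunc F) (KInf F) (RatFunc.C c)), ?_, ?_⟩
    · change splitOrder (OInf F) (KInf F) 1 = _
      refine Eq.trans ?_ (conjOrder_affGL_eq (a := 1) (b := 0) one_ne_zero rfl ?_)
      · rw [affGL_one_zero, conjOrder_one]
      · rw [zero_sub, Valuation.map_neg, valued_algebraMap, map_one]
        exact vInf_C_le c
    · rw [← conjOrder_affGL_splitOrder hπ0, ← conjOrder_mul, affGL_mul one_ne_zero hπ0, mul_zero,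
        zero_add, one_mul]
      change conjOrder (Matrix.GeneralLinearGroup.map (algebraMap (RatFunc F) (KInf F))
        (affGL RatFunc.X⁻¹ (RatFunc.C c))) _ = _
      rw [map_affGL _ (inv_ne_zero RatFunc.X_ne_zero)]
      rfl

theorem bruhatTitsTree_adj_iff (g : GL (Fin 2) (RatFunc F)) (y : TreeVertex F) :
    (bruhatTitsTree F).Adj (g • baseVertex F) y ↔
      ∃ o : Option F, (g * neighborGL o) • baseVertex F = y := by
  constructor
  · intro h
    have h' := bruhatTitsTree_smul F g⁻¹ _ _ h
    rw [inv_smul_smul] at h'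
    suffices ∃ o : Option F, neighborGL o • baseVertex F = g⁻¹ • y by
      obtain ⟨o, ho⟩ := this
      exact ⟨o, by rw [mul_smul, ho, smul_inv_smul]⟩
    obtain ⟨π, hπ, k, h1, h2⟩ := h'
    rw [← conjOrder_affGL_splitOrder (valuation_inv_uniformizer F hπ).1, ← conjOrder_mul] at h2
    rcases conjOrder_mul_affGL_uniformizer hπ h1.symm with h | ⟨c, h⟩
    · refine ⟨none, Subtype.ext ?_⟩
      rw [h2, h, smul_baseVertex_val, neighborGL, map_affGL _ RatFunc.X_ne_zero, map_zero]
    · refine ⟨some c, Subtype.ext ?_⟩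
      rw [h2, h, smul_baseVertex_val, neighborGL, map_affGL _ (inv_ne_zero RatFunc.X_ne_zero)]
  · rintro ⟨o, rfl⟩
    rw [mul_smul]
    exact bruhatTitsTree_smul F g _ _ (bruhatTitsTree_adj_neighborGL o)

/-- The radius separates `none` from the others. Two different constants are at distance `1`, more
than the radius `|X⁻¹|`. -/
theorem neighborGL_smul_injective (g : GL (Fin 2) (RatFunc F)) :
    Function.Injective fun o : Option F => (g * neighborGL o) • baseVertex F := by
  intro o o' h
  simp only [mul_smul] at h
  replace h := MulAction.injective g h
  have hX := RatFunc.X_ne_zero (K := F)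
  have hne : vInf F RatFunc.X ≠ vInf F RatFunc.X⁻¹ := by
    rw [map_inv₀, vInf_X, ← WithZero.exp_neg]
    intro h
    have := WithZero.exp_injective h
    omega
  cases o with
  | none =>
    cases o' with
    | none => rfl
    | some c => exact absurd ((ballVertex_eq_iff hX (inv_ne_zero hX)).1 h).1 hne
  | some c =>
    cases o' with
    | none => exact absurd ((ballVertex_eq_iff (inv_ne_zero hX) hX).1 h).1 hne.symm
    | some c' =>
      have := ((ballVertex_eq_iff (inv_ne_zero hX) (inv_ne_zero hX)).1 h).2
      rw [← map_sub, map_inv₀, vInf_X, ← WithZero.exp_neg, ← lt_one_iff_le_exp] at this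
      by_contra hc
      rw [vInf_C] at this
      · exact lt_irrefl _ this
      · rw [sub_ne_zero]
        rintro rfl
        exact hc rfl

theorem affGL_smul_neighbor {a : RatFunc F} (ha : a ≠ 0) (b : RatFunc F) :
    (affGL a b * neighborGL none) • baseVertex F = ballVertex (a * RatFunc.X) b := by
  rw [neighborGL, affGL_mul ha RatFunc.X_ne_zero, mul_zero, zero_add]
  rfl

theorem affGL_smul_neighbor_some {a : RatFunc F} (ha : a ≠ 0) (b : RatFunc F) (c : F) :
    (affGL a b * neighborGL (some c)) • baseVertex F =
      ballVertex (a * RatFunc.X⁻¹) (a * RatFunc.C c + b) := by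
  rw [neighborGL, affGL_mul ha (inv_ne_zero RatFunc.X_ne_zero)]
  rfl

/-- The tree is connected. -/
theorem bruhatTitsTree_induction {P : TreeVertex F → Prop} {x₀ : TreeVertex F} (h₀ : P x₀)
    (h : ∀ x y, (bruhatTitsTree F).Adj x y → P x → P y) (x : TreeVertex F) : P x := by
  have hX := RatFunc.X_ne_zero (K := F)
  -- Enlarging a ball with fixed center moves along edges, and two balls of equal, large enough
  -- radius coincide whatever their centers. So any two vertices are joined through a large ball
  -- around `0`.
  have hup : ∀ (n : ℤ) (b : RatFunc F), (bruhatTitsTree F).Adj (ballVertex (RatFunc.X ^ n) b)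
      (ballVertex (RatFunc.X ^ (n + 1)) b) := by
    intro n b
    refine (bruhatTitsTree_adj_iff _ _).2 ⟨none, ?_⟩
    rw [affGL_smul_neighbor (zpow_ne_zero _ hX), zpow_add_one₀ hX]
  have hiff : ∀ (b : RatFunc F) (n : ℤ) (k : ℕ), P (ballVertex (RatFunc.X ^ n) b) ↔
      P (ballVertex (RatFunc.X ^ (n + k)) b) := by
    intro b n k
    induction k with
    | zero => simp
    | succ k ih =>
      rw [ih, Nat.cast_succ, ← add_assoc]
      exact ⟨h _ _ (hup _ _), h _ _ (hup _ _).symm⟩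
  have hlarge : ∀ b : RatFunc F, ∃ N : ℤ, ∀ n ≥ N,
      ballVertex (RatFunc.X ^ n) b = ballVertex (RatFunc.X ^ n) 0 := by
    intro b
    refine ⟨WithZero.log (vInf F b), fun n hn => ?_⟩
    rw [ballVertex_eq_iff (zpow_ne_zero _ hX) (zpow_ne_zero _ hX), sub_zero, vInf_X_zpow]
    refine ⟨rfl, ?_⟩
    by_cases hb : vInf F b = 0
    · rw [hb]; exact zero_le
    · rw [← WithZero.exp_log hb, WithZero.exp_le_exp]
      exact hn
  have hall : ∀ (n m : ℤ) (b c : RatFunc F), P (ballVertex (RatFunc.X ^ n) b) →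
      P (ballVertex (RatFunc.X ^ m) c) := by
    intro n m b c hP
    obtain ⟨N, hN⟩ := hlarge b
    obtain ⟨M, hM⟩ := hlarge c
    obtain ⟨k, hk⟩ := Int.le.dest (show n ≤ max (max n m) (max N M) by simp)
    obtain ⟨l, hl⟩ := Int.le.dest (show m ≤ max (max n m) (max N M) by simp)
    rw [hiff _ _ k, hk, hN _ (by simp)] at hP
    rw [hiff _ _ l, hl, hM _ (by simp)]
    exact hP
  obtain ⟨n, b, rfl⟩ := exists_eq_ballVertex x
  obtain ⟨m, c, rfl⟩ := exists_eq_ballVertex x₀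
  exact hall _ _ _ _ h₀

end Tree

/-! ### Edges of the reduced fine quotient -/

section Quotients

variable {G : Type*} {V : Type u} [Group G] [MulAction G V] (T : SimpleGraph V)

/-- The pair of ends of a virtual vertex of the fine quotient. -/
def virtualEnds (x : (fineQuotient G T).Virtual) : Sym2 (MulAction.orbitRel.Quotient G V) :=
  Quot.lift (fun e : T.edgeSet => (e : Sym2 V).map Quotient.mk'') (by
    rintro e e' ⟨g, hg⟩
    rw [← hg, Sym2.map_map]
    congr 1
    funext v
    exact (Quotient.sound' ⟨g, rfl⟩ : (Quotient.mk'' (g • v) : MulAction.orbitRel.Quotient G V) =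
      Quotient.mk'' v).symm) x

theorem mem_virtualEnds (x : (fineQuotient G T).Virtual) (v : MulAction.orbitRel.Quotient G V) :
    v ∈ virtualEnds T x ↔
      ∃ h, (fineQuotient G T).virtualEnd h = x ∧ (fineQuotient G T).actualEnd h = v := by
  constructor
  · obtain ⟨⟨e, he⟩, rfl⟩ := Quot.exists_rep x
    induction e using Sym2.ind with
    | _ a b =>
    intro hv
    change v ∈ Sym2.map Quotient.mk'' s(a, b) at hv
    rw [Sym2.map_mk, Sym2.mem_iff] at hv
    rcases hv with rfl | rfl
    · exact ⟨Quot.mk _ ⟨(a, b), he⟩, rfl, rfl⟩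
    · refine ⟨Quot.mk _ ⟨(b, a), T.adj_symm he⟩, ?_, rfl⟩
      exact congrArg (Quot.mk _) (Subtype.ext Sym2.eq_swap)
  · rintro ⟨h, rfl, rfl⟩
    obtain ⟨a, rfl⟩ := Quot.exists_rep h
    change Quotient.mk'' a.fst ∈ Sym2.map Quotient.mk'' s(a.fst, a.snd)
    simp

/-- An element of `Sym2` is determined by its members, so multiple edges merge, and loops and half
edges both become a diagonal pair. -/
theorem mem_reducedEdges_fineQuotient {z : Sym2 (MulAction.orbitRel.Quotient G V)} :
    z ∈ (fineQuotient G T).reducedEdges ↔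
      ∃ u v : V, T.Adj u v ∧ z = s(Quotient.mk'' u, Quotient.mk'' v) := by
  constructor
  · rintro ⟨x, hx⟩
    have hz : z = virtualEnds T x := by
      refine Sym2.ext fun v => ?_
      rw [mem_virtualEnds]
      exact hx v
    obtain ⟨⟨e, he⟩, rfl⟩ := Quot.exists_rep x
    induction e using Sym2.ind with
    | _ a b => exact ⟨a, b, he, hz⟩
  · rintro ⟨u, v, h, rfl⟩
    exact ⟨Quot.mk _ ⟨s(u, v), h⟩, fun w => mem_virtualEnds T (Quot.mk _ ⟨s(u, v), h⟩) w⟩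

end Quotients

/-! ### Recognizing the quotient from representatives -/

section Tree

variable {F : Type*} [Field F]

/-- A weighted graph is the weighted reduced fine quotient if its vertices are represented by
pairwise inequivalent vertices of the tree, whose neighbors are distributed as in the graph. -/
theorem eichlerWRFQ_isomorphic {f : F[X]} {W : Type*} [Nonempty W] {Y : WeightedFineGraph W}
    (ρ : W → GL (Fin 2) (RatFunc F)) (τ : W → Option F → W)
    (hτ : ∀ w o, ∃ n ∈ eichlerNormalizer f,
      n • (ρ w * neighborGL o) • baseVertex F = ρ (τ w o) • baseVertex F)
    (hinj : ∀ w w', ∀ n ∈ eichlerNormalizer f,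
      n • ρ w • baseVertex F = ρ w' • baseVertex F → w = w')
    (hweight : ∀ w w', {o | τ w o = w'}.encard = Y.weight w w')
    (hedges : ∀ z, z ∈ Y.edges ↔ ∃ w o, z = s(w, τ w o)) :
    (eichlerWRFQ f).Isomorphic Y := by
  let π : W → MulAction.orbitRel.Quotient (eichlerNormalizer f) (TreeVertex F) :=
    fun w => Quotient.mk'' (ρ w • baseVertex F)
  have hsmul : ∀ (n : GL (Fin 2) (RatFunc F)) (_ : n ∈ eichlerNormalizer f) (x : TreeVertex F),
      (Quotient.mk'' (n • x) : MulAction.orbitRel.Quotient (eichlerNormalizer f) (TreeVertex F)) =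
        Quotient.mk'' x :=
    fun n hn x => Quotient.sound' ⟨⟨n, hn⟩, rfl⟩
  have hexact : ∀ x y : TreeVertex F,
      (Quotient.mk'' x : MulAction.orbitRel.Quotient (eichlerNormalizer f) (TreeVertex F)) =
        Quotient.mk'' y → ∃ n ∈ eichlerNormalizer f, n • y = x := by
    intro x y h
    obtain ⟨n, hn⟩ := Quotient.exact' h
    exact ⟨n.1, n.2, hn⟩
  have hnb : ∀ w o, (Quotient.mk'' ((ρ w * neighborGL o) • baseVertex F) :
      MulAction.orbitRel.Quotient (eichlerNormalizer f) (TreeVertex F)) = π (τ w o) := by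
    intro w o
    obtain ⟨n, hn, h⟩ := hτ w o
    rw [← hsmul n hn, h]
  have hadj : ∀ w n, n ∈ eichlerNormalizer f → ∀ y,
      (bruhatTitsTree F).Adj (n • ρ w • baseVertex F) y →
        ∃ o, (Quotient.mk'' y : MulAction.orbitRel.Quotient (eichlerNormalizer f) (TreeVertex F)) =
          π (τ w o) := by
    intro w n hn y h
    rw [← mul_smul, bruhatTitsTree_adj_iff] at h
    obtain ⟨o, rfl⟩ := h
    refine ⟨o, ?_⟩
    rw [mul_assoc, mul_smul, hsmul n hn, hnb]
  have hbij : Function.Bijective π := by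
    refine ⟨fun w w' h => ?_, fun q => ?_⟩
    · obtain ⟨n, hn, h⟩ := hexact _ _ h
      exact (hinj _ _ n hn h).symm
    · obtain ⟨x, rfl⟩ := Quotient.exists_rep q
      -- Surjectivity: the vertices equivalent to some representative are closed under passing to
      -- neighbors, and the tree is connected.
      obtain ⟨w₀⟩ := ‹Nonempty W›
      refine bruhatTitsTree_induction (P := fun x => ∃ w, π w = Quotient.mk'' x) ⟨w₀, rfl⟩ ?_ x
      rintro x y h ⟨w, hw⟩
      obtain ⟨n, hn, rfl⟩ := hexact _ _ hw.symm
      obtain ⟨o, ho⟩ := hadj w n hn y h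
      exact ⟨_, ho.symm⟩
  let e := Equiv.ofBijective π hbij
  have he : ∀ w, e.symm (π w) = w := fun w => e.symm_apply_apply w
  refine ⟨e.symm, fun z => ?_, fun v v' => ?_⟩
  · rw [hedges]
    change z ∈ (fineQuotient _ _).reducedEdges ↔ _
    rw [mem_reducedEdges_fineQuotient]
    constructor
    · rintro ⟨u, v, h, rfl⟩
      obtain ⟨w, hw⟩ := hbij.2 (Quotient.mk'' u)
      obtain ⟨n, hn, rfl⟩ := hexact _ _ hw.symm
      obtain ⟨o, ho⟩ := hadj w n hn v h
      refine ⟨w, o, ?_⟩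
      rw [Sym2.map_mk, hsmul n hn, ho, he]
      exact congrArg (fun q => s(w, q)) (he _)
    · rintro ⟨w, o, h⟩
      refine ⟨ρ w • baseVertex F, (ρ w * neighborGL o) • baseVertex F,
        (bruhatTitsTree_adj_iff _ _).2 ⟨o, rfl⟩, ?_⟩
      rw [hnb]
      have := congrArg (Sym2.map e) h
      rw [Sym2.map_map, e.self_comp_symm, Sym2.map_id, id, Sym2.map_mk] at this
      exact this
  · obtain ⟨w, rfl⟩ := hbij.2 v
    obtain ⟨w', rfl⟩ := hbij.2 v'
    -- Different `o` give different neighbors, so counting indices `o` counts neighbors.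
    rw [he, he, ← hweight, ← (neighborGL_smul_injective (ρ w)).encard_image]
    change Set.encard {y : TreeVertex F | (bruhatTitsTree F).Adj (ρ w • baseVertex F) y ∧
      (Quotient.mk'' y : MulAction.orbitRel.Quotient (eichlerNormalizer f) (TreeVertex F)) =
        π w'} = _
    congr 1
    ext y
    simp only [Set.mem_ofPred_eq, Set.mem_image, bruhatTitsTree_adj_iff]
    constructor
    · rintro ⟨⟨o, rfl⟩, h⟩
      rw [hnb] at h
      exact ⟨o, hbij.1 h, rfl⟩
    · rintro ⟨o, rfl, rfl⟩
      exact ⟨⟨o, rfl⟩, hnb _ _⟩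

end Tree

/-! ### The grid of maximal orders and the normalizer -/

section Eichler

variable {F : Type*} [Field F]

theorem mem_polyOrder {d : F[X]} {x : Matrix (Fin 2) (Fin 2) (RatFunc F)} :
    x ∈ polyOrder d ↔ x 0 0 ∈ (algebraMap F[X] (RatFunc F)).range ∧
      algebraMap F[X] (RatFunc F) d * x 0 1 ∈ (algebraMap F[X] (RatFunc F)).range ∧
      (∃ r : F[X], x 1 0 = algebraMap F[X] (RatFunc F) d * algebraMap F[X] (RatFunc F) r) ∧
      x 1 1 ∈ (algebraMap F[X] (RatFunc F)).range :=
  Iff.rfl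

theorem mem_eichlerOrder {f : F[X]} {x : Matrix (Fin 2) (Fin 2) (RatFunc F)} :
    x ∈ eichlerOrder f ↔ ∃ a b c d : F[X], x = !![algebraMap F[X] (RatFunc F) a,
      algebraMap F[X] (RatFunc F) b; algebraMap F[X] (RatFunc F) (f * c),
      algebraMap F[X] (RatFunc F) d] := by
  rw [eichlerOrder, Algebra.mem_inf, mem_polyOrder, mem_polyOrder]
  constructor
  · rintro ⟨⟨⟨a, ha⟩, ⟨b, hb⟩, -, -⟩, -, -, ⟨c, hc⟩, ⟨d, hd⟩⟩
    refine ⟨a, b, c, d, ?_⟩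
    rw [map_one, one_mul] at hb
    ext i j
    fin_cases i <;> fin_cases j
    · exact ha.symm
    · exact hb.symm
    · exact hc.trans (map_mul _ _ _).symm
    · exact hd.symm
  · rintro ⟨a, b, c, d, rfl⟩
    refine ⟨⟨⟨a, rfl⟩, ⟨b, ?_⟩, ⟨f * c, ?_⟩, ⟨d, rfl⟩⟩, ⟨a, rfl⟩, ⟨f * b, ?_⟩, ⟨c, ?_⟩, ⟨d, rfl⟩⟩ <;>
      simp

theorem algebraMap_ratFunc_ne_zero {d : F[X]} (hd : d ≠ 0) :
    algebraMap F[X] (RatFunc F) d ≠ 0 := by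
  simpa using hd

theorem polyOrder_eq_conjOrder {d : F[X]} (hd : d ≠ 0) : polyOrder d =
    conjOrder (affGL (algebraMap F[X] (RatFunc F) d)⁻¹ 0) (splitOrder F[X] (RatFunc F) 1) := by
  rw [conjOrder_affGL_splitOrder (inv_ne_zero (algebraMap_ratFunc_ne_zero hd)), inv_inv, polyOrder]

theorem conjOrder_eq_of_isUnit {k : GL (Fin 2) (RatFunc F)} {c : RatFunc F} {p q r s : F[X]}
    (hk : (k : Matrix (Fin 2) (Fin 2) (RatFunc F)) = c • !![algebraMap F[X] (RatFunc F) p,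
      algebraMap F[X] (RatFunc F) q; algebraMap F[X] (RatFunc F) r,
      algebraMap F[X] (RatFunc F) s]) (hu : IsUnit (p * s - q * r)) :
    conjOrder k (splitOrder F[X] (RatFunc F) 1) = splitOrder F[X] (RatFunc F) 1 := by
  have hc : c ≠ 0 := by
    rintro rfl
    exact det_GL_ne_zero k (by simp [hk])
  obtain ⟨v, hv⟩ := isUnit_iff_exists_inv'.1 hu
  have hv' : algebraMap F[X] (RatFunc F) v * (algebraMap F[X] (RatFunc F) p *
      algebraMap F[X] (RatFunc F) s - algebraMap F[X] (RatFunc F) q *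
      algebraMap F[X] (RatFunc F) r) = 1 := by
    rw [← map_mul, ← map_mul, ← map_sub, ← map_mul, hv, map_one]
  refine conjOrder_eq_self (inv_ne_zero hc) (mem_splitOrder_one.2 fun i j => ?_)
    (mem_splitOrder_one.2 fun i j => ?_)
  · rw [hk, smul_smul, inv_mul_cancel₀ hc, one_smul]
    fin_cases i <;> fin_cases j <;> exact ⟨_, rfl⟩
  · have e : c⁻¹⁻¹ • ((k⁻¹ : GL (Fin 2) (RatFunc F)) : Matrix (Fin 2) (Fin 2) (RatFunc F)) =
        !![algebraMap F[X] (RatFunc F) (v * s), algebraMap F[X] (RatFunc F) (v * -q);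
          algebraMap F[X] (RatFunc F) (v * -r), algebraMap F[X] (RatFunc F) (v * p)] := by
      have hd := eq_inv_of_mul_eq_one_left hv'
      rw [coe_inv_GL, hk, inv_inv]
      ext i j
      fin_cases i <;> fin_cases j <;> simp [hd] <;> field_simp
    rw [e]
    fin_cases i <;> fin_cases j <;> exact ⟨_, rfl⟩

/-- The flip in the directions of the primes dividing `g`. -/
theorem actsAsFlip_of_eq_smul {f g h α β γ δ : F[X]} (hf : f ≠ 0) (hgh : g * h = f)
    (hu : IsUnit (g * α * δ - h * β * γ)) {n : GL (Fin 2) (RatFunc F)} {c : RatFunc F}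
    (hn : (n : Matrix (Fin 2) (Fin 2) (RatFunc F)) = c • !![algebraMap F[X] (RatFunc F) (g * α),
      algebraMap F[X] (RatFunc F) β; algebraMap F[X] (RatFunc F) (f * γ),
      algebraMap F[X] (RatFunc F) (g * δ)]) : ActsAsFlip n g h := by
  rintro a b k hab ⟨l, hl⟩
  have ha : a ≠ 0 := by rintro rfl; apply hf; rw [← hgh, ← hab]; ring
  have hb : b ≠ 0 := by rintro rfl; apply hf; rw [← hgh, ← hab]; ring
  have hk : k ≠ 0 := by rintro rfl; apply hf; rw [← hgh, hl]; ring
  rw [polyOrder_eq_conjOrder (mul_ne_zero ha hk), polyOrder_eq_conjOrder (mul_ne_zero hb hk),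
    ← conjOrder_mul, conjOrder_eq_iff]
  have hιa := algebraMap_ratFunc_ne_zero ha
  have hιb := algebraMap_ratFunc_ne_zero hb
  have hιk := algebraMap_ratFunc_ne_zero hk
  -- Conjugating to `M₂(A)` on both sides, the matrix becomes `diag(bk, 1) n diag((ak)⁻¹, 1)`. With
  -- `g = ab` and `h = kl` all entries have the common factor `c b`, and the remaining determinant
  -- is again `gαδ - hβγ`.
  refine conjOrder_eq_of_isUnit (c := c * algebraMap F[X] (RatFunc F) b) (p := b * α) (q := β * k)
    (r := l * γ) (s := a * δ) ?_ ?_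
  · rw [Units.val_mul, Units.val_mul,
      coe_inv_affGL (inv_ne_zero (algebraMap_ratFunc_ne_zero (mul_ne_zero hb hk))),
      coe_affGL (inv_ne_zero (algebraMap_ratFunc_ne_zero (mul_ne_zero ha hk))), hn,
      ← hgh, ← hab, hl]
    ext i j
    fin_cases i <;> fin_cases j <;> simp [Matrix.mul_apply, Fin.sum_univ_two] <;> field_simp
  · convert hu using 1
    rw [← hab, hl]
    ring

/-- For coprime `g` and `h`, Bézout gives `g⁻¹A ∩ h⁻¹A = A` in the upper right corner, and `gA ∩ hA
= fA` in the lower left. -/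
theorem polyOrder_inf_polyOrder {f g h : F[X]} (hf : f ≠ 0) (hgh : g * h = f)
    (hc : IsCoprime g h) : polyOrder g ⊓ polyOrder h = eichlerOrder f := by
  have hg : g ≠ 0 := by rintro rfl; apply hf; rw [← hgh]; ring
  have hh : h ≠ 0 := by rintro rfl; apply hf; rw [← hgh]; ring
  ext x
  rw [Algebra.mem_inf, mem_polyOrder, mem_polyOrder, mem_eichlerOrder]
  constructor
  · rintro ⟨⟨⟨a, ha⟩, ⟨b, hb⟩, ⟨c, hc1⟩, ⟨d, hd⟩⟩, -, ⟨b', hb'⟩, ⟨c', hc2⟩, -⟩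
    have hc' := hc
    obtain ⟨u, v, huv⟩ := hc
    have e : g * c = h * c' := by
      apply FaithfulSMul.algebraMap_injective F[X] (RatFunc F)
      rw [map_mul, map_mul, ← hc1, ← hc2]
    obtain ⟨c'', rfl⟩ := hc'.symm.dvd_of_dvd_mul_left ⟨c', e⟩
    refine ⟨a, u * b + v * b', c'', d, ?_⟩
    have huv' := congrArg (algebraMap F[X] (RatFunc F)) huv
    simp only [map_add, map_mul, map_one] at huv'
    ext i j
    fin_cases i <;> fin_cases j
    · exact ha.symm
    · change x 0 1 = algebraMap F[X] (RatFunc F) (u * b + v * b')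
      rw [map_add, map_mul, map_mul, hb, hb']
      linear_combination -(x 0 1) * huv'
    · change x 1 0 = algebraMap F[X] (RatFunc F) (f * c'')
      rw [hc1, ← hgh, ← map_mul]
      congr 1
      ring
    · exact hd.symm
  · rintro ⟨a, b, c, d, rfl⟩
    refine ⟨⟨⟨a, rfl⟩, ⟨g * b, ?_⟩, ⟨h * c, ?_⟩, ⟨d, rfl⟩⟩, ⟨a, rfl⟩, ⟨h * b, ?_⟩, ⟨g * c, ?_⟩,
      ⟨d, rfl⟩⟩ <;> simp [← hgh] <;> ring

/-- `E(f)` is the intersection of the opposite corners `D_1` and `D_f`. The flip takes them to `D_g`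
and `D_h`, which are opposite corners again. -/
theorem ActsAsFlip.mem_eichlerNormalizer {f g h : F[X]} (hf : f ≠ 0) (hgh : g * h = f)
    (hc : IsCoprime g h) {n : GL (Fin 2) (RatFunc F)} (hn : ActsAsFlip n g h) :
    n ∈ eichlerNormalizer f := by
  change conjOrder n (eichlerOrder f) = eichlerOrder f
  have h1 := hn 1 g 1 (one_mul g) (one_dvd h)
  have h2 := hn g 1 h (mul_one g) dvd_rfl
  rw [one_mul, mul_one] at h1
  rw [one_mul, hgh] at h2
  rw [eichlerOrder, conjOrder_inf, h1, h2, polyOrder_inf_polyOrder hf hgh hc]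
  rfl

/-- The supply of explicit elements of `N(f)`. The determinant is `g` times the given unit, which
also exhibits `g` and `h` as coprime. -/
theorem exists_mem_eichlerNormalizer {f g h : F[X]} (α β γ δ : F[X]) (hf : f ≠ 0)
    (hgh : g * h = f) (hu : IsUnit (g * α * δ - h * β * γ)) :
    ∃ n ∈ eichlerNormalizer f, ActsAsFlip n g h ∧
      (n : Matrix (Fin 2) (Fin 2) (RatFunc F)) = !![algebraMap F[X] (RatFunc F) (g * α),
      algebraMap F[X] (RatFunc F) β; algebraMap F[X] (RatFunc F) (f * γ),
      algebraMap F[X] (RatFunc F) (g * δ)] := by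
  have hg : g ≠ 0 := by rintro rfl; apply hf; rw [← hgh]; ring
  have hc : IsCoprime g h := by
    obtain ⟨v, hv⟩ := isUnit_iff_exists_inv'.1 hu
    exact ⟨v * (α * δ), -v * (β * γ), by rw [← hv]; ring⟩
  let n : GL (Fin 2) (RatFunc F) := Matrix.GeneralLinearGroup.mkOfDetNeZero
    !![algebraMap F[X] (RatFunc F) (g * α),
      algebraMap F[X] (RatFunc F) β; algebraMap F[X] (RatFunc F) (f * γ),
      algebraMap F[X] (RatFunc F) (g * δ)] (by
    rw [Matrix.det_fin_two_of, ← map_mul, ← map_mul, ← map_sub]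
    refine algebraMap_ratFunc_ne_zero ?_
    have : g * α * (g * δ) - β * (f * γ) = g * (g * α * δ - h * β * γ) := by rw [← hgh]; ring
    rw [this]
    exact mul_ne_zero hg hu.ne_zero)
  have hn : ActsAsFlip n g h := actsAsFlip_of_eq_smul (c := 1) hf hgh hu (by rw [one_smul]; rfl)
  exact ⟨n, hn.mem_eichlerNormalizer hf hgh hc, hn, rfl⟩

theorem exists_actsAsFlip {f g h : F[X]} (hf : f ≠ 0) (hgh : g * h = f) (hc : IsCoprime g h) :
    ∃ n ∈ eichlerNormalizer f, ActsAsFlip n g h := by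
  obtain ⟨u, v, huv⟩ := hc
  -- Bézout `u g + v h = 1` is the unit condition for `α = u`, `β = δ = 1`, `γ = -v`.
  obtain ⟨n, hn, hn', -⟩ := exists_mem_eichlerNormalizer (f := f) (g := g) (h := h) u 1 (-v) 1 hf hgh
    (by
      have : g * u * 1 - h * 1 * -v = 1 := by linear_combination huv
      rw [this]
      exact isUnit_one)
  exact ⟨n, hn, hn'⟩

theorem isMaximalOrder_polyOrder {d : F[X]} (hd : d ≠ 0) :
    IsMaximalOrder F[X] (RatFunc F) (polyOrder d) :=
  hasCommonGenerators_polynomial.isMaximalOrder_splitOrder (algebraMap_ratFunc_ne_zero hd)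

theorem eichlerOrder_le_polyOrder {f d : F[X]} (hd : d ∣ f) : eichlerOrder f ≤ polyOrder d := by
  intro x hx
  obtain ⟨a, b, c, e, rfl⟩ := mem_eichlerOrder.1 hx
  obtain ⟨k, rfl⟩ := hd
  refine mem_polyOrder.2 ⟨⟨a, rfl⟩, ⟨d * b, ?_⟩, ⟨k * c, ?_⟩, ⟨e, rfl⟩⟩ <;> simp [mul_assoc]

/-- The maximal orders containing `E(f)`. -/
theorem isMaximalOrder_and_eichlerOrder_le_iff {f : F[X]} (hf : f ≠ 0)
    {D : Subalgebra F[X] (Matrix (Fin 2) (Fin 2) (RatFunc F))} :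
    (IsMaximalOrder F[X] (RatFunc F) D ∧ eichlerOrder f ≤ D) ↔
      ∃ d : F[X], d ∣ f ∧ D = polyOrder d := by
  constructor
  · rintro ⟨hD, hle⟩
    have h00 : Matrix.single 0 0 (1 : RatFunc F) ∈ D := by
      refine hle (mem_eichlerOrder.2 ⟨1, 0, 0, 0, ?_⟩)
      ext i j; fin_cases i <;> fin_cases j <;> simp
    have h11 : Matrix.single 1 1 (1 : RatFunc F) ∈ D := by
      refine hle (mem_eichlerOrder.2 ⟨0, 0, 0, 1, ?_⟩)
      ext i j; fin_cases i <;> fin_cases j <;> simp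
    have h01 : Matrix.single 0 1 (1 : RatFunc F) ∈ D := by
      refine hle (mem_eichlerOrder.2 ⟨0, 1, 0, 0, ?_⟩)
      ext i j; fin_cases i <;> fin_cases j <;> simp
    have h10 : Matrix.single 1 0 (algebraMap F[X] (RatFunc F) f) ∈ D := by
      refine hle (mem_eichlerOrder.2 ⟨0, 0, 1, 0, ?_⟩)
      ext i j; fin_cases i <;> fin_cases j <;> simp
    -- The upper right entries of `D` form a cyclic module containing `1`, so its generator `ν 0 1`
    -- is `d⁻¹` for a polynomial `d`.
    obtain ⟨_, ⟨ν, hν, rfl⟩, hz⟩ := hasCommonGenerators_polynomial.exists_generator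
      (I := (Subalgebra.toSubmodule D).map (Matrix.entryLinearMap F[X] (RatFunc F) 0 1))
      (hD.1.1.map _)
    replace hz : ∀ x ∈ D, ∃ r : F[X], x 0 1 = algebraMap F[X] (RatFunc F) r * ν 0 1 := by
      intro x hx
      obtain ⟨r, hr⟩ := hz _ ⟨x, hx, rfl⟩
      exact ⟨r, by rw [← Algebra.smul_def]; exact hr⟩
    obtain ⟨d, hd⟩ := hz _ h01
    rw [Matrix.single_apply_same] at hd
    have hle' : D ≤ polyOrder d := by
      intro x hx
      have hD11 : ∀ {y}, y ∈ D → y 1 1 ∈ (algebraMap F[X] (RatFunc F)).range :=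
        hasCommonGenerators_polynomial.entry_mem_range hD.1 h11
      refine mem_polyOrder.2
        ⟨hasCommonGenerators_polynomial.entry_mem_range hD.1 h00 hx, ?_, ?_, hD11 hx⟩
      · obtain ⟨r, hr⟩ := hz x hx
        refine ⟨r, ?_⟩
        rw [hr]
        linear_combination algebraMap F[X] (RatFunc F) r * hd
      -- Multiplying `x` by `ν` between diagonal idempotents brings `x 1 0 * d⁻¹` to the diagonal,
      -- where entries are polynomials.
      · obtain ⟨r, hr⟩ := hD11 (mul_mem (mul_mem (mul_mem hx h00) hν) h11)
        refine ⟨r, ?_⟩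
        have e : (x * Matrix.single 0 0 1 * ν * Matrix.single 1 1 1 :
            Matrix (Fin 2) (Fin 2) (RatFunc F)) 1 1 = x 1 0 * ν 0 1 := by
          simp [Matrix.mul_apply, Fin.sum_univ_two, Matrix.single_apply]
        rw [hr, e]
        linear_combination x 1 0 * hd
    -- The matrix with `f` in the lower left corner lies in `D`, hence `d ∣ f`.
    obtain ⟨-, -, ⟨r, hr⟩, -⟩ := mem_polyOrder.1 (hle' h10)
    have hdf : d ∣ f := by
      refine ⟨r, FaithfulSMul.algebraMap_injective F[X] (RatFunc F) ?_⟩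
      rw [map_mul, ← hr, Matrix.single_apply_same]
    have hd0 : d ≠ 0 := ne_zero_of_dvd_ne_zero hf hdf
    exact ⟨d, hdf, le_antisymm hle' (hD.2 (isMaximalOrder_polyOrder hd0).1 hle')⟩
  · rintro ⟨d, hd, rfl⟩
    exact ⟨isMaximalOrder_polyOrder (ne_zero_of_dvd_ne_zero hf hd), eichlerOrder_le_polyOrder hd⟩

theorem dvd_of_polyOrder_le {d d' : F[X]} (h : polyOrder d ≤ polyOrder d') : d' ∣ d := by
  have hmem : Matrix.single 1 0 (algebraMap F[X] (RatFunc F) d) ∈ polyOrder d :=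
    mem_polyOrder.2 ⟨⟨0, by simp⟩, ⟨0, by simp⟩, ⟨1, by simp⟩, ⟨0, by simp⟩⟩
  obtain ⟨-, -, ⟨r, hr⟩, -⟩ := mem_polyOrder.1 (h hmem)
  refine ⟨r, FaithfulSMul.algebraMap_injective F[X] (RatFunc F) ?_⟩
  rw [map_mul, ← hr, Matrix.single_apply_same]

theorem polyOrder_le_of_associated {d d' : F[X]} (h : Associated d d') :
    polyOrder d ≤ polyOrder d' := by
  intro x hx
  obtain ⟨u, hu⟩ := h.symm
  obtain ⟨v, rfl⟩ := h
  obtain ⟨h1, ⟨b, hb⟩, ⟨c, hc⟩, h4⟩ := mem_polyOrder.1 hx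
  refine mem_polyOrder.2 ⟨h1, ⟨b * v, ?_⟩, ⟨u * c, ?_⟩, h4⟩
  · rw [map_mul, hb, map_mul]
    ring
  · rw [hc, ← map_mul, ← map_mul, ← mul_assoc, hu]

theorem polyOrder_eq_iff {d d' : F[X]} : polyOrder d = polyOrder d' ↔ Associated d d' :=
  ⟨fun h => associated_of_dvd_dvd (dvd_of_polyOrder_le h.ge) (dvd_of_polyOrder_le h.le),
    fun h => le_antisymm (polyOrder_le_of_associated h) (polyOrder_le_of_associated h.symm)⟩

theorem mul_single_mul_apply {L : Type*} [Field L] (x y : Matrix (Fin 2) (Fin 2) L)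
    (i j p q : Fin 2) : (x * Matrix.single i j 1 * y : Matrix (Fin 2) (Fin 2) L) p q = x p i * y j q := by
  simp [Matrix.mul_apply, Matrix.single_apply, ite_and]

/-- The elements of `N(f)`, given their effect on `M₂(A)`. -/
theorem exists_eq_smul_of_mem_eichlerNormalizer {f g h : F[X]} (hf : f ≠ 0) (hgh : g * h = f)
    {n : GL (Fin 2) (RatFunc F)} (hn : n ∈ eichlerNormalizer f)
    (hng : conjOrder n (polyOrder 1) = polyOrder g) :
    ∃ (c : RatFunc F) (α β γ δ : F[X]), c ≠ 0 ∧ IsUnit (g * α * δ - h * β * γ) ∧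
      (n : Matrix (Fin 2) (Fin 2) (RatFunc F)) = c • !![algebraMap F[X] (RatFunc F) (g * α),
        algebraMap F[X] (RatFunc F) β; algebraMap F[X] (RatFunc F) (f * γ),
        algebraMap F[X] (RatFunc F) (g * δ)] := by
  have hg : g ≠ 0 := by rintro rfl; apply hf; rw [← hgh]; ring
  have hιg := algebraMap_ratFunc_ne_zero hg
  have hpo : polyOrder (1 : F[X]) = splitOrder F[X] (RatFunc F) 1 := by rw [polyOrder, map_one]
  rw [polyOrder_eq_conjOrder hg, hpo, conjOrder_eq_iff] at hng
  -- After removing the diagonal matrix that takes `M₂(A)` to `D_g`, a scalar multiple `M` of what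
  -- remains is invertible over `A`. Divisibility of two entries of `M` is still to be shown.
  obtain ⟨c, hc, h1, h2⟩ := hasCommonGenerators_polynomial.exists_smul_mem hng
  set k := (affGL (algebraMap F[X] (RatFunc F) g)⁻¹ 0)⁻¹ * n with hk
  have hnk : n = affGL (algebraMap F[X] (RatFunc F) g)⁻¹ 0 * k := by rw [hk, mul_inv_cancel_left]
  have h1' := mem_splitOrder_one.1 h1
  have h2' := mem_splitOrder_one.1 h2
  obtain ⟨M, hM⟩ : ∃ M : Matrix (Fin 2) (Fin 2) F[X], ∀ i j, algebraMap F[X] (RatFunc F) (M i j) =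
      (c • (k : Matrix (Fin 2) (Fin 2) (RatFunc F))) i j := by
    choose M hM using h1'
    exact ⟨M, hM⟩
  obtain ⟨M', hM'⟩ : ∃ M : Matrix (Fin 2) (Fin 2) F[X], ∀ i j, algebraMap F[X] (RatFunc F) (M i j) =
      (c⁻¹ • ((k⁻¹ : GL (Fin 2) (RatFunc F)) : Matrix (Fin 2) (Fin 2) (RatFunc F))) i j := by
    choose M hM using h2'
    exact ⟨M, hM⟩
  have hMM : M * M' = (1 : Matrix (Fin 2) (Fin 2) F[X]) := by
    have e1 : (algebraMap F[X] (RatFunc F)).mapMatrix M =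
        c • (k : Matrix (Fin 2) (Fin 2) (RatFunc F)) := Matrix.ext hM
    have e2 : (algebraMap F[X] (RatFunc F)).mapMatrix M' =
        c⁻¹ • ((k⁻¹ : GL (Fin 2) (RatFunc F)) : Matrix (Fin 2) (Fin 2) (RatFunc F)) := Matrix.ext hM'
    have e3 : (algebraMap F[X] (RatFunc F)).mapMatrix (M * M') =
        (algebraMap F[X] (RatFunc F)).mapMatrix 1 := by
      rw [map_mul, e1, e2, map_one, Matrix.smul_mul, Matrix.mul_smul, smul_smul, mul_inv_cancel₀ hc,
        one_smul, Units.mul_inv]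
    exact Matrix.map_injective (FaithfulSMul.algebraMap_injective F[X] (RatFunc F)) e3
  have hu : IsUnit (M 0 0 * M 1 1 - M 0 1 * M 1 0) := by
    have := congrArg Matrix.det hMM
    rw [Matrix.det_mul, Matrix.det_one] at this
    rw [← Matrix.det_fin_two]
    exact IsUnit.of_mul_eq_one _ this
  set c' := c⁻¹ * (algebraMap F[X] (RatFunc F) g)⁻¹ with hc'
  have hc0 : c' ≠ 0 := mul_ne_zero (inv_ne_zero hc) (inv_ne_zero hιg)
  have hkM : ∀ i j, k i j = c⁻¹ * algebraMap F[X] (RatFunc F) (M i j) := by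
    intro i j
    rw [hM, Matrix.smul_apply, smul_eq_mul, inv_mul_cancel_left₀ hc]
  have hnM : (n : Matrix (Fin 2) (Fin 2) (RatFunc F)) = c' • !![algebraMap F[X] (RatFunc F) (M 0 0),
      algebraMap F[X] (RatFunc F) (M 0 1); algebraMap F[X] (RatFunc F) (g * M 1 0),
      algebraMap F[X] (RatFunc F) (g * M 1 1)] := by
    rw [hnk, Units.val_mul, coe_affGL (inv_ne_zero hιg)]
    ext i j
    fin_cases i <;> fin_cases j <;>
      simp [Matrix.mul_apply, Fin.sum_univ_two, hkM, hc'] <;> field_simp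
  set u := M 0 0 * M 1 1 - M 0 1 * M 1 0 with hud
  have hιu := algebraMap_ratFunc_ne_zero hu.ne_zero
  have hninv : ((n⁻¹ : GL (Fin 2) (RatFunc F)) : Matrix (Fin 2) (Fin 2) (RatFunc F)) =
      (c' * algebraMap F[X] (RatFunc F) g * algebraMap F[X] (RatFunc F) u)⁻¹ •
      !![algebraMap F[X] (RatFunc F) (g * M 1 1), -algebraMap F[X] (RatFunc F) (M 0 1);
        -algebraMap F[X] (RatFunc F) (g * M 1 0), algebraMap F[X] (RatFunc F) (M 0 0)] := by
    have hdet : n 0 0 * n 1 1 - n 0 1 * n 1 0 =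
        c' * (c' * algebraMap F[X] (RatFunc F) g * algebraMap F[X] (RatFunc F) u) := by
      rw [hnM, hud, map_sub, map_mul, map_mul]
      simp
      ring
    rw [coe_inv_GL, hdet, hnM]
    ext i j
    fin_cases i <;> fin_cases j <;> simp <;> field_simp
  have hconj : ∀ x ∈ eichlerOrder f, (n : Matrix (Fin 2) (Fin 2) (RatFunc F)) * x *
      ((n⁻¹ : GL (Fin 2) (RatFunc F)) : Matrix (Fin 2) (Fin 2) (RatFunc F)) ∈ eichlerOrder f := by
    intro x hx
    have : conjOrder n (eichlerOrder f) = eichlerOrder f := hn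
    rw [← this, mem_conjOrder]
    simpa only [mul_assoc, Units.inv_mul, mul_one, Units.inv_mul_cancel_left] using hx
  have hinj := FaithfulSMul.algebraMap_injective F[X] (RatFunc F)
  have hdvd : ∀ (x y z : F[X]), algebraMap F[X] (RatFunc F) x / (algebraMap F[X] (RatFunc F) y *
      algebraMap F[X] (RatFunc F) u) = algebraMap F[X] (RatFunc F) z → y ≠ 0 → y ∣ x := by
    intro x y z hxyz hy
    rw [div_eq_iff (mul_ne_zero (algebraMap_ratFunc_ne_zero hy) hιu), ← map_mul, ← map_mul] at hxyz
    exact ⟨z * u, by rw [hinj hxyz]; ring⟩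
  have hh : h ≠ 0 := by rintro rfl; apply hf; rw [← hgh]; ring
  -- The off-diagonal entries of the conjugates of the matrix units at `(0, 0)` and `(0, 1)` are
  -- products of entries of `M` over `g` or `h`. Their integrality gives `g1` to `g4`.
  obtain ⟨a1, b1, c1, d1, e1⟩ := mem_eichlerOrder.1 (hconj (Matrix.single 0 0 1)
    (mem_eichlerOrder.2 ⟨1, 0, 0, 0, by
      ext i j; fin_cases i <;> fin_cases j <;> simp⟩))
  obtain ⟨a2, b2, c2, d2, e2⟩ := mem_eichlerOrder.1 (hconj (Matrix.single 0 1 1)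
    (mem_eichlerOrder.2 ⟨0, 1, 0, 0, by
      ext i j; fin_cases i <;> fin_cases j <;> simp⟩))
  rw [hnM, hninv] at e1 e2
  have e101 := congrFun (congrFun e1 0) 1
  have e110 := congrFun (congrFun e1 1) 0
  have e201 := congrFun (congrFun e2 0) 1
  have e210 := congrFun (congrFun e2 1) 0
  have hιf := algebraMap_ratFunc_ne_zero hf
  have hιh := algebraMap_ratFunc_ne_zero hh
  rw [mul_single_mul_apply] at e101 e110 e201 e210
  simp only [Matrix.smul_apply, smul_eq_mul, Matrix.of_apply, Matrix.cons_val', Matrix.cons_val_zero,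
    Matrix.cons_val_one, Matrix.cons_val_fin_one, map_mul, ← hgh] at e101 e110 e201 e210
  rw [← hgh, map_mul] at hιf
  have g1 : g ∣ M 0 0 * M 0 1 := hdvd _ _ (-b1) (by
    rw [map_neg, ← e101, map_mul]
    field_simp) hg
  have g2 : g ∣ M 0 0 * M 0 0 := hdvd _ _ b2 (by
    rw [← e201, map_mul]
    field_simp) hg
  have g3 : h ∣ M 1 0 * M 1 1 := hdvd _ _ c1 (by
    refine mul_left_cancel₀ hιf ?_
    rw [← e110, map_mul]
    field_simp) hh
  have g4 : h ∣ M 1 0 * M 1 0 := hdvd _ _ (-c2) (by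
    refine mul_left_cancel₀ hιf ?_
    rw [map_neg, mul_neg, ← e210, map_mul]
    field_simp) hh
  -- As `det M` is a unit, the row `(M 0 0, M 0 1)` is unimodular. Since `g` divides its product
  -- with `M 0 0`, it divides `M 0 0`. The second row gives `h ∣ M 1 0` in the same way.
  have g5 : g ∣ M 0 0 := by
    rw [← hu.dvd_mul_right (b := M 0 0)]
    have : M 0 0 * u = M 0 0 * M 0 0 * M 1 1 - M 0 0 * M 0 1 * M 1 0 := by rw [hud]; ring
    rw [this]
    exact dvd_sub (g2.mul_right _) (g1.mul_right _)
  have g6 : h ∣ M 1 0 := by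
    rw [← hu.dvd_mul_right (b := M 1 0)]
    have : M 1 0 * u = M 1 0 * M 1 1 * M 0 0 - M 1 0 * M 1 0 * M 0 1 := by rw [hud]; ring
    rw [this]
    exact dvd_sub (g3.mul_right _) (g4.mul_right _)
  obtain ⟨α, hα⟩ := g5
  obtain ⟨γ, hγ⟩ := g6
  refine ⟨c', α, M 0 1, γ, M 1 1, hc0, ?_, ?_⟩
  · convert hu using 1
    rw [hud, hα, hγ]
    ring
  · rw [hnM, hα, hγ, ← hgh, mul_assoc g h γ]

/-- Conjugation by `n` permutes the maximal orders containing `E(f)`, so the image of `D_1` is some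
`D_g`, and this determines the shape of `n`. -/
theorem exists_factorization_actsAsFlip {f : F[X]} (hf : f ≠ 0) {n : GL (Fin 2) (RatFunc F)}
    (hn : n ∈ eichlerNormalizer f) :
    ∃ g h : F[X], g * h = f ∧ IsCoprime g h ∧ ActsAsFlip n g h := by
  have h1 : IsMaximalOrder F[X] (RatFunc F) (conjOrder n (polyOrder 1)) ∧
      eichlerOrder f ≤ conjOrder n (polyOrder 1) := by
    refine ⟨(isMaximalOrder_polyOrder one_ne_zero).conj n, ?_⟩
    have : conjOrder n (eichlerOrder f) = eichlerOrder f := hn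
    rw [← this]
    exact conjOrder_mono (eichlerOrder_le_polyOrder (one_dvd f))
  obtain ⟨g, ⟨h, rfl⟩, hg⟩ := (isMaximalOrder_and_eichlerOrder_le_iff hf).1 h1
  obtain ⟨c, α, β, γ, δ, hc, hu, he⟩ := exists_eq_smul_of_mem_eichlerNormalizer hf rfl hn hg
  refine ⟨g, h, rfl, ?_, actsAsFlip_of_eq_smul hf rfl hu he⟩
  obtain ⟨v, hv⟩ := isUnit_iff_exists_inv'.1 hu
  exact ⟨v * (α * δ), -v * (β * γ), by rw [← hv]; ring⟩

/-- Fixing the corner `D_1` alone puts `n` in the shape with `g = 1`, which is a scalar times an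
element of `Γ₀(f)`. Conversely, the flip for `g = 1` is trivial on the whole grid. -/
theorem mem_eichlerNormalizer_and_fixes_iff {f : F[X]} (hf : f ≠ 0) (n : GL (Fin 2) (RatFunc F)) :
    (n ∈ eichlerNormalizer f ∧
      ∀ D : Subalgebra F[X] (Matrix (Fin 2) (Fin 2) (RatFunc F)),
        IsMaximalOrder F[X] (RatFunc F) D → eichlerOrder f ≤ D → conjOrder n D = D) ↔
    ∃ c : (RatFunc F)ˣ, ∃ γ ∈ heckeGamma0 f,
      (n : Matrix (Fin 2) (Fin 2) (RatFunc F)) =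
        (c : RatFunc F) • (Matrix.GeneralLinearGroup.map (algebraMap F[X] (RatFunc F)) γ :
          Matrix (Fin 2) (Fin 2) (RatFunc F)) := by
  constructor
  · rintro ⟨hn, hfix⟩
    obtain ⟨c, α, β, γ, δ, hc, hu, he⟩ := exists_eq_smul_of_mem_eichlerNormalizer hf (one_mul f) hn
      (hfix _ (isMaximalOrder_polyOrder one_ne_zero) (eichlerOrder_le_polyOrder (one_dvd f)))
    have hdet : IsUnit (!![α, β; f * γ, δ] : Matrix (Fin 2) (Fin 2) F[X]).det := by
      rw [Matrix.det_fin_two_of]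
      convert hu using 1
      ring
    refine ⟨Units.mk0 c hc, Matrix.GeneralLinearGroup.mk'' _ hdet, ?_, ?_⟩
    · exact Dvd.intro γ rfl
    · rw [he]
      congr 1
      ext i j
      fin_cases i <;> fin_cases j <;> simp [Matrix.GeneralLinearGroup.mk'', Matrix.nonsingInvUnit]
  · rintro ⟨c, γ, ⟨k, hk⟩, he⟩
    have hflip : ActsAsFlip n 1 f := by
      refine actsAsFlip_of_eq_smul (α := γ 0 0) (β := γ 0 1) (γ := k) (δ := γ 1 1) (c := c) hf
        (one_mul f) ?_ ?_
      · have := (Matrix.isUnits_det_units γ)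
        rw [Matrix.det_fin_two] at this
        convert this using 1
        rw [hk]
        ring
      · rw [he, ← hk]
        congr 1
        ext i j
        fin_cases i <;> fin_cases j <;> simp
    refine ⟨hflip.mem_eichlerNormalizer hf (one_mul f) isCoprime_one_left, fun D hD hle => ?_⟩
    obtain ⟨d, hd, rfl⟩ := (isMaximalOrder_and_eichlerOrder_le_iff hf).1 ⟨hD, hle⟩
    simpa using hflip 1 1 d (one_mul 1) hd

end Eichler

/-! ### Global sections as invariants of orbits -/

section Sections

variable {F : Type*} [Field F]

/-- The elements of `E(f)` that lie in the local maximal order `x`. -/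
def globalSections (f : F[X]) (x : TreeVertex F) : Set (Matrix (Fin 2) (Fin 2) (RatFunc F)) :=
  {M | M ∈ eichlerOrder f ∧ M.map (algebraMap (RatFunc F) (KInf F)) ∈ x.1}

/-- Conjugation by `n` preserves `E(f)` and carries the local order to its translate. So
cardinality, trace and determinant of global sections give invariants of orbits. -/
theorem conj_mem_globalSections {f : F[X]} {x : TreeVertex F} {n : GL (Fin 2) (RatFunc F)}
    (hn : n ∈ eichlerNormalizer f) {M : Matrix (Fin 2) (Fin 2) (RatFunc F)}
    (hM : M ∈ globalSections f x) :
    (n : Matrix (Fin 2) (Fin 2) (RatFunc F)) * M *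
      ((n⁻¹ : GL (Fin 2) (RatFunc F)) : Matrix (Fin 2) (Fin 2) (RatFunc F)) ∈
        globalSections f (n • x) := by
  constructor
  · have h : conjOrder n (eichlerOrder f) = eichlerOrder f := hn
    rw [← h, mem_conjOrder]
    simpa only [mul_assoc, Units.inv_mul, mul_one, Units.inv_mul_cancel_left] using hM.1
  · rw [TreeVertex.smul_val, mem_conjOrder]
    have e : ((n : Matrix (Fin 2) (Fin 2) (RatFunc F)) * M *
        ((n⁻¹ : GL (Fin 2) (RatFunc F)) : Matrix (Fin 2) (Fin 2) (RatFunc F))).map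
          (algebraMap (RatFunc F) (KInf F)) =
        (Matrix.GeneralLinearGroup.map (algebraMap (RatFunc F) (KInf F)) n).val *
          M.map (algebraMap (RatFunc F) (KInf F)) *
          ((Matrix.GeneralLinearGroup.map (algebraMap (RatFunc F) (KInf F)) n)⁻¹).val := by
      rw [Matrix.map_mul, Matrix.map_mul, ← map_inv]
      rfl
    rw [e]
    simpa only [mul_assoc, Units.inv_mul, mul_one, Units.inv_mul_cancel_left] using hM.2

theorem card_globalSections_smul {f : F[X]} (x : TreeVertex F) {n : GL (Fin 2) (RatFunc F)}
    (hn : n ∈ eichlerNormalizer f) :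
    Nat.card (globalSections f (n • x)) = Nat.card (globalSections f x) := by
  have hinj : Function.Injective fun M : Matrix (Fin 2) (Fin 2) (RatFunc F) =>
      (n : Matrix (Fin 2) (Fin 2) (RatFunc F)) * M *
      ((n⁻¹ : GL (Fin 2) (RatFunc F)) : Matrix (Fin 2) (Fin 2) (RatFunc F)) := by
    intro M M' h
    have h' := congrArg (fun z => ((n⁻¹ : GL (Fin 2) (RatFunc F)) :
      Matrix (Fin 2) (Fin 2) (RatFunc F)) * z * (n : Matrix (Fin 2) (Fin 2) (RatFunc F))) h
    simpa only [mul_assoc, Units.inv_mul, mul_one, Units.inv_mul_cancel_left] using h'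
  rw [← Nat.card_image_of_injective hinj (globalSections f x)]
  congr 2
  ext M
  constructor
  · intro hM
    have := conj_mem_globalSections (inv_mem hn) hM
    rw [inv_smul_smul, inv_inv] at this
    refine ⟨_, this, ?_⟩
    simp [mul_assoc]
  · rintro ⟨M, hM, rfl⟩
    exact conj_mem_globalSections hn hM

/-- The existence of a nontrivial idempotent among the global sections. -/
def HasIdempotentSection (f : F[X]) (x : TreeVertex F) : Prop :=
  ∃ M ∈ globalSections f x, M.trace = 1 ∧ M.det = 0

theorem HasIdempotentSection.smul {f : F[X]} {x : TreeVertex F} {n : GL (Fin 2) (RatFunc F)}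
    (hn : n ∈ eichlerNormalizer f) (h : HasIdempotentSection f x) :
    HasIdempotentSection f (n • x) := by
  obtain ⟨M, hM, h1, h2⟩ := h
  exact ⟨_, conj_mem_globalSections hn hM, by rw [Matrix.trace_units_conj, h1],
    by rw [Matrix.det_units_conj, h2]⟩

theorem mem_globalSections_ballVertex {f : F[X]} {a b : RatFunc F} (ha : a ≠ 0)
    {M : Matrix (Fin 2) (Fin 2) (RatFunc F)} :
    M ∈ globalSections f (ballVertex a b) ↔ M ∈ eichlerOrder f ∧
      vInf F (M 0 0 - b * M 1 0) ≤ 1 ∧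
      vInf F (M 0 0 * b + M 0 1 - b * (M 1 0 * b + M 1 1)) ≤ vInf F a ∧
      vInf F (M 1 0 * a) ≤ 1 ∧ vInf F (M 1 0 * b + M 1 1) ≤ 1 := by
  have hva : vInf F a ≠ 0 := by simpa using ha
  have ha' : algebraMap (RatFunc F) (KInf F) a ≠ 0 := by simpa using ha
  refine and_congr Iff.rfl ?_
  have e : ((affGL (algebraMap (RatFunc F) (KInf F) a) (algebraMap (RatFunc F) (KInf F) b))⁻¹).val *
      M.map (algebraMap (RatFunc F) (KInf F)) *
      (affGL (algebraMap (RatFunc F) (KInf F) a) (algebraMap (RatFunc F) (KInf F) b)).val =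
      !![algebraMap (RatFunc F) (KInf F) (M 0 0 - b * M 1 0), algebraMap (RatFunc F) (KInf F)
        ((M 0 0 * b + M 0 1 - b * (M 1 0 * b + M 1 1)) / a);
        algebraMap (RatFunc F) (KInf F) (M 1 0 * a),
        algebraMap (RatFunc F) (KInf F) (M 1 0 * b + M 1 1)] := by
    rw [coe_inv_affGL ha', coe_affGL ha']
    ext i j
    fin_cases i <;> fin_cases j <;> simp only [Matrix.mul_apply, Fin.sum_univ_two,
      Matrix.of_apply, Matrix.cons_val', Matrix.cons_val_zero, Matrix.cons_val_one,
      Matrix.cons_val_fin_one, Fin.zero_eta, Fin.mk_one, Matrix.map_apply, map_add, map_sub, map_mul,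
      map_div₀] <;> (try field_simp) <;> ring
  rw [ballVertex_val ha, mem_conjOrder, e, mem_splitOrder_one]
  simp only [Fin.forall_fin_two, mem_range_OInf, Matrix.of_apply, Matrix.cons_val',
    Matrix.cons_val_zero, Matrix.cons_val_one, Matrix.cons_val_fin_one, valued_algebraMap]
  rw [map_div₀, div_le_one₀ (zero_lt_iff.2 hva), and_assoc]

theorem vInf_polynomial_le_one_iff {p : F[X]} :
    vInf F (algebraMap F[X] (RatFunc F) p) ≤ 1 ↔ ∃ c : F, p = C c := by
  rw [← WithZero.exp_zero]
  have := vInf_polynomial_le_iff (p := p) (n := 0)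
  rw [Nat.cast_zero] at this
  rw [this, Nat.le_zero, natDegree_eq_zero]
  exact exists_congr fun c => eq_comm

theorem vInf_polynomial_lt_iff {p : F[X]} {n : ℕ} :
    vInf F (algebraMap F[X] (RatFunc F) p) ≤ WithZero.exp ((n : ℤ) - 1) ↔ p ∈ degreeLT F n := by
  rw [mem_degreeLT]
  by_cases hp : p = 0
  · simp [hp]
  · rw [vInf_polynomial hp, WithZero.exp_le_exp, degree_eq_natDegree hp, Nat.cast_lt]
    omega

theorem card_degreeLT [Fintype F] (n : ℕ) : Nat.card (degreeLT F n) = Fintype.card F ^ n := by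
  rw [Nat.card_congr (degreeLTEquiv F n).toEquiv]
  simp

variable (F) in
theorem algebraMap_injective_ratFunc : Function.Injective (algebraMap F[X] (RatFunc F)) :=
  FaithfulSMul.algebraMap_injective F[X] (RatFunc F)

theorem one_lt_vInf_algebraMap {p : F[X]} (hp : p ≠ 0) :
    1 ≤ vInf F (algebraMap F[X] (RatFunc F) p) := by
  rw [vInf_polynomial hp, ← WithZero.exp_zero, WithZero.exp_le_exp]
  omega

theorem eq_zero_of_vInf_lt_one {p : F[X]} (h : vInf F (algebraMap F[X] (RatFunc F) p) < 1) :
    p = 0 := by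
  by_contra hp
  exact absurd (one_lt_vInf_algebraMap hp) (not_le.2 h)

variable (F) in
/-- The matrices taking `M₂(O)` to the vertices on a path towards the cusp `∞`. -/
def cuspGL (j : ℕ) : GL (Fin 2) (RatFunc F) := affGL (RatFunc.X ^ ((j : ℤ) - 1)) 0

theorem X_zpow_ne_zero (n : ℤ) : (RatFunc.X : RatFunc F) ^ n ≠ 0 :=
  zpow_ne_zero _ RatFunc.X_ne_zero

theorem cuspGL_smul (j : ℕ) : cuspGL F j • baseVertex F = ballVertex (RatFunc.X ^ ((j : ℤ) - 1)) 0 :=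
  rfl

/-- Under `hj`, a nonzero lower left entry `f c` would have degree exceeding `1 - j`, so sections
are upper triangular, with constants on the diagonal and a polynomial of degree below `j` above it.
-/
theorem globalSections_cuspGL {f : F[X]} (hf : f ≠ 0) {j : ℕ} (hj : 1 < f.natDegree + j) :
    globalSections f (cuspGL F j • baseVertex F) =
      Set.range fun z : F × F × degreeLT F j =>
        !![algebraMap F[X] (RatFunc F) (C z.1), algebraMap F[X] (RatFunc F) (z.2.2 : F[X]);
          0, algebraMap F[X] (RatFunc F) (C z.2.1)] := by
  ext M
  rw [cuspGL_smul, mem_globalSections_ballVertex (X_zpow_ne_zero _), mem_eichlerOrder]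
  constructor
  · rintro ⟨⟨a, b, c, d, rfl⟩, h1, h2, h3, h4⟩
    simp only [Matrix.of_apply, Matrix.cons_val', Matrix.cons_val_zero, Matrix.cons_val_one,
      Matrix.cons_val_fin_one, mul_zero, zero_mul, sub_zero, zero_add, vInf_X_zpow, map_mul]
      at h1 h2 h3 h4
    obtain ⟨a, rfl⟩ := vInf_polynomial_le_one_iff.1 h1
    obtain ⟨d, rfl⟩ := vInf_polynomial_le_one_iff.1 h4
    have hc : c = 0 := by
      by_contra hc
      rw [vInf_polynomial hf, vInf_polynomial hc, ← WithZero.exp_add, ← WithZero.exp_add,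
        ← WithZero.exp_zero, WithZero.exp_le_exp] at h3
      omega
    exact ⟨(a, d, ⟨b, vInf_polynomial_lt_iff.1 h2⟩), by simp [hc]⟩
  · rintro ⟨⟨a, d, b⟩, rfl⟩
    refine ⟨⟨C a, b, 0, C d, by simp⟩, ?_, ?_, ?_, ?_⟩ <;>
      simp only [Matrix.of_apply, Matrix.cons_val', Matrix.cons_val_zero, Matrix.cons_val_one,
      Matrix.cons_val_fin_one, mul_zero, zero_mul, sub_zero, zero_add, vInf_X_zpow]
    · exact vInf_polynomial_le_one_iff.2 ⟨a, rfl⟩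
    · exact vInf_polynomial_lt_iff.2 b.2
    · simp
    · exact vInf_polynomial_le_one_iff.2 ⟨d, rfl⟩

theorem card_globalSections_cuspGL [Fintype F] {f : F[X]} (hf : f ≠ 0) {j : ℕ}
    (hj : 1 < f.natDegree + j) :
    Nat.card (globalSections f (cuspGL F j • baseVertex F)) = Fintype.card F ^ (j + 2) := by
  rw [globalSections_cuspGL hf hj, Nat.card_range_of_injective, Nat.card_prod, Nat.card_prod,
    card_degreeLT, Nat.card_eq_fintype_card]
  · ring
  · rintro ⟨a, d, b⟩ ⟨a', d', b'⟩ h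
    have h00 := C_injective (algebraMap_injective_ratFunc F (congrFun (congrFun h 0) 0))
    have h01 := algebraMap_injective_ratFunc F (congrFun (congrFun h 0) 1)
    have h11 := C_injective (algebraMap_injective_ratFunc F (congrFun (congrFun h 1) 1))
    simp only at h00 h01 h11
    rw [h00, h11, Subtype.ext h01]

theorem hasIdempotentSection_cuspGL {f : F[X]} (hf : f ≠ 0) {j : ℕ} (hj : 1 < f.natDegree + j) :
    HasIdempotentSection f (cuspGL F j • baseVertex F) := by
  refine ⟨!![1, 0; 0, 0], ?_, by simp [Matrix.trace_fin_two], by simp⟩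
  rw [globalSections_cuspGL hf hj]
  exact ⟨(1, 0, 0), by simp⟩

/-- At the cusp `p⁻¹` the sections are scalars plus polynomial multiples of the nilpotent matrix
`[p, -1; p², -p]`, which kills the vector `(1, p)`. Unlike at infinity, the two eigenvalues are
forced to agree. -/
theorem globalSections_square {p : F[X]} (hp : p.natDegree = 1) (m : ℕ) :
    globalSections (p ^ 2) (affGL (algebraMap F[X] (RatFunc F) p ^ (-(m + 2 : ℤ)))
        (algebraMap F[X] (RatFunc F) p)⁻¹ • baseVertex F) =
      Set.range fun z : F × degreeLT F (m + 1) =>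
        !![algebraMap F[X] (RatFunc F) (C z.1 + p * z.2), algebraMap F[X] (RatFunc F) (-z.2);
          algebraMap F[X] (RatFunc F) (p ^ 2 * z.2),
          algebraMap F[X] (RatFunc F) (C z.1 - p * z.2)] := by
  have hp0 : p ≠ 0 := by
    rintro rfl
    simp at hp
  have hι := algebraMap_ratFunc_ne_zero hp0
  have hvp : vInf F (algebraMap F[X] (RatFunc F) p) = WithZero.exp (1 : ℤ) := by
    rw [vInf_polynomial hp0, hp, Nat.cast_one]
  have hvpn : ∀ k : ℤ, vInf F (algebraMap F[X] (RatFunc F) p ^ k) = WithZero.exp k := by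
    intro k
    rw [map_zpow₀, hvp, ← WithZero.exp_zsmul]
    simp
  have key : ∀ c : F[X], vInf F (algebraMap F[X] (RatFunc F) (p ^ 2 * c) *
      algebraMap F[X] (RatFunc F) p ^ (-(m + 2 : ℤ))) ≤ 1 ↔ c ∈ degreeLT F (m + 1) := by
    intro c
    rw [← vInf_polynomial_lt_iff]
    by_cases hc : c = 0
    · simp [hc]
    · rw [map_mul, map_mul, map_mul, map_pow, map_pow, hvp, hvpn, vInf_polynomial hc,
        WithZero.exp_le_exp, ← WithZero.exp_nsmul, ← WithZero.exp_add, ← WithZero.exp_add,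
        ← WithZero.exp_zero, WithZero.exp_le_exp]
      push_cast
      constructor <;> intro h <;> simp only [nsmul_eq_mul] at * <;> push_cast at * <;> omega
  ext M
  change M ∈ globalSections (p ^ 2) (ballVertex _ _) ↔ _
  rw [mem_globalSections_ballVertex (zpow_ne_zero _ hι), mem_eichlerOrder]
  constructor
  · rintro ⟨⟨a, b, c, d, rfl⟩, h1, h2, h3, h4⟩
    simp only [Matrix.of_apply, Matrix.cons_val', Matrix.cons_val_zero, Matrix.cons_val_one,
      Matrix.cons_val_fin_one] at h1 h2 h3 h4
    have e1 : algebraMap F[X] (RatFunc F) a - (algebraMap F[X] (RatFunc F) p)⁻¹ *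
        algebraMap F[X] (RatFunc F) (p ^ 2 * c) = algebraMap F[X] (RatFunc F) (a - p * c) := by
      simp only [map_sub, map_mul, map_pow]
      field_simp
    have e4 : algebraMap F[X] (RatFunc F) (p ^ 2 * c) * (algebraMap F[X] (RatFunc F) p)⁻¹ +
        algebraMap F[X] (RatFunc F) d = algebraMap F[X] (RatFunc F) (d + p * c) := by
      simp only [map_add, map_mul, map_pow]
      field_simp
      ring
    rw [e1] at h1
    rw [e4] at h4 h2
    obtain ⟨a', ha'⟩ := vInf_polynomial_le_one_iff.1 h1
    obtain ⟨d', hd'⟩ := vInf_polynomial_le_one_iff.1 h4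
    -- This polynomial is `p` times the upper right entry of the conjugated section, so its
    -- valuation is at most `exp (-(m + 1)) < 1` and it vanishes.
    have hQ : C a' - C d' + p * (b + c) = 0 := by
      apply eq_zero_of_vInf_lt_one
      have e2 : algebraMap F[X] (RatFunc F) (C a' - C d' + p * (b + c)) =
          algebraMap F[X] (RatFunc F) p * (algebraMap F[X] (RatFunc F) a *
            (algebraMap F[X] (RatFunc F) p)⁻¹ + algebraMap F[X] (RatFunc F) b -
            (algebraMap F[X] (RatFunc F) p)⁻¹ * algebraMap F[X] (RatFunc F) (d + p * c)) := by
        rw [← ha', ← hd']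
        simp only [map_add, map_sub, map_mul]
        field_simp
        ring
      rw [e2, map_mul, hvp]
      refine lt_of_le_of_lt (mul_le_mul_right h2 _) ?_
      rw [hvpn, ← WithZero.exp_add, ← WithZero.exp_zero, WithZero.exp_lt_exp]
      omega
    have hbc : b + c = 0 := by
      by_contra hne
      have h0 : p * (b + c) = C (d' - a') := by
        rw [C_sub]
        linear_combination hQ
      have := congrArg natDegree h0
      rw [natDegree_mul hp0 hne, natDegree_C, hp] at this
      omega
    have had : a' = d' := by
      rw [hbc, mul_zero, add_zero, sub_eq_zero] at hQ
      exact C_injective hQ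
    refine ⟨(a', ⟨c, (key c).1 h3⟩), ?_⟩
    have ea : a = C a' + p * c := by linear_combination ha'
    have ed : d = C a' - p * c := by rw [had]; linear_combination hd'
    have eb : b = -c := by linear_combination hbc
    rw [ea, eb, ed]
  · rintro ⟨⟨a, c⟩, rfl⟩
    refine ⟨⟨_, _, c, _, rfl⟩, ?_, ?_, ?_, ?_⟩ <;>
      simp only [Matrix.of_apply, Matrix.cons_val', Matrix.cons_val_zero, Matrix.cons_val_one,
      Matrix.cons_val_fin_one]
    · refine le_of_eq_of_le (congrArg _ ?_) (vInf_polynomial_le_one_iff.2 ⟨a, rfl⟩)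
      simp only [map_add, map_mul, map_pow]
      field_simp
      ring
    · refine le_of_eq_of_le (congrArg _ (a₂ := 0) ?_) (by simp)
      simp only [map_add, map_mul, map_pow, map_sub, map_neg]
      field_simp
      ring
    · exact (key _).2 c.2
    · refine le_of_eq_of_le (congrArg _ ?_) (vInf_polynomial_le_one_iff.2 ⟨a, rfl⟩)
      simp only [map_mul, map_pow, map_sub]
      field_simp
      ring

theorem card_globalSections_square [Fintype F] {p : F[X]} (hp : p.natDegree = 1) (m : ℕ) :
    Nat.card (globalSections (p ^ 2) (affGL (algebraMap F[X] (RatFunc F) p ^ (-(m + 2 : ℤ)))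
        (algebraMap F[X] (RatFunc F) p)⁻¹ • baseVertex F)) = Fintype.card F ^ (m + 2) := by
  rw [globalSections_square hp, Nat.card_range_of_injective, Nat.card_prod, card_degreeLT,
    Nat.card_eq_fintype_card]
  · ring
  · rintro ⟨a, c⟩ ⟨a', c'⟩ h
    have h00 := algebraMap_injective_ratFunc F (congrFun (congrFun h 0) 0)
    have h01 := algebraMap_injective_ratFunc F (congrFun (congrFun h 0) 1)
    simp only [neg_inj] at h00 h01
    rw [h01, add_left_inj] at h00
    rw [C_injective h00, Subtype.ext h01]

/-- A scalar plus a nilpotent has trace `2a`, which is `0` in characteristic 2. -/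
theorem not_hasIdempotentSection_square (h2 : (2 : F) = 0) {p : F[X]} (hp : p.natDegree = 1)
    (m : ℕ) : ¬ HasIdempotentSection (p ^ 2) (affGL (algebraMap F[X] (RatFunc F) p ^ (-(m + 2 : ℤ)))
      (algebraMap F[X] (RatFunc F) p)⁻¹ • baseVertex F) := by
  rintro ⟨M, hM, h1, -⟩
  rw [globalSections_square hp] at hM
  obtain ⟨⟨a, c⟩, rfl⟩ := hM
  have e : C a + p * c + (C a - p * c) = C (2 * a) := by
    rw [C_mul]
    simp only [C_ofNat]
    ring
  rw [Matrix.trace_fin_two_of, ← map_add, e, h2, zero_mul, C_0, map_zero] at h1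
  exact zero_ne_one h1

/-- The bounds make `c` constant and `a`, `d` of degree at most `1`. Determinant zero gives `f ∣ a
d`, so irreducibility makes one of `a`, `d` zero and the trace makes the other `1`. Then `c = 0`,
and the last bound would put `X⁻¹` within `exp (-2)` of a polynomial. -/
theorem not_hasIdempotentSection_irreducible {f : F[X]} (hf : f.natDegree = 2)
    (hirr : Irreducible f) : ¬ HasIdempotentSection f (affGL ((RatFunc.X : RatFunc F) ^ (-2 : ℤ)) RatFunc.X⁻¹ •
      baseVertex F) := by
  rintro ⟨M, hM, htr, hdet⟩
  have hX := RatFunc.X_ne_zero (K := F)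
  have hf0 := hirr.ne_zero
  change M ∈ globalSections f (ballVertex _ _) at hM
  rw [mem_globalSections_ballVertex (X_zpow_ne_zero _), mem_eichlerOrder] at hM
  obtain ⟨⟨a, b, c, d, rfl⟩, h1, h2, h3, h4⟩ := hM
  simp only [Matrix.of_apply, Matrix.cons_val', Matrix.cons_val_zero, Matrix.cons_val_one,
    Matrix.cons_val_fin_one, vInf_X_zpow] at h1 h2 h3 h4
  rw [Matrix.trace_fin_two_of, ← map_add, ← map_one (algebraMap F[X] (RatFunc F))] at htr
  replace htr := algebraMap_injective_ratFunc F htr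
  rw [Matrix.det_fin_two_of, ← map_mul, ← map_mul, ← map_sub, map_eq_zero_iff _
    (algebraMap_injective_ratFunc F)] at hdet
  have hc : vInf F (algebraMap F[X] (RatFunc F) c) ≤ 1 := by
    rw [map_mul, vInf_X_zpow, map_mul, map_mul, vInf_polynomial hf0, hf, mul_right_comm,
      ← WithZero.exp_add] at h3
    simpa using h3
  obtain ⟨c, rfl⟩ := vInf_polynomial_le_one_iff.1 hc
  have hle : ∀ x y : RatFunc F, vInf F x ≤ WithZero.exp (1 : ℤ) → vInf F (y + x) ≤ 1 →
      vInf F y ≤ WithZero.exp (1 : ℤ) := by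
    intro x y hx hy
    have : y = (y + x) - x := by ring
    rw [this]
    refine (Valuation.map_sub _ _ _).trans (max_le (hy.trans ?_) hx)
    rw [← WithZero.exp_zero, WithZero.exp_le_exp]
    norm_num
  have hfc : vInf F (RatFunc.X⁻¹ * algebraMap F[X] (RatFunc F) (f * C c)) ≤
      WithZero.exp (1 : ℤ) := by
    rw [map_mul, map_mul, map_mul, vInf_polynomial hf0, hf, map_inv₀, vInf_X, ← WithZero.exp_neg,
      ← mul_assoc, ← WithZero.exp_add]
    exact mul_le_of_le_of_le_one (by norm_num) hc
  have ha : a.natDegree ≤ 1 := by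
    rw [← vInf_polynomial_le_iff, Nat.cast_one]
    refine hle (-(RatFunc.X⁻¹ * algebraMap F[X] (RatFunc F) (f * C c))) _ ?_ ?_
    · rwa [Valuation.map_neg]
    · rwa [← sub_eq_add_neg]
  have hd : d.natDegree ≤ 1 := by
    rw [← vInf_polynomial_le_iff, Nat.cast_one]
    refine hle (RatFunc.X⁻¹ * algebraMap F[X] (RatFunc F) (f * C c)) _ hfc ?_
    rwa [add_comm, mul_comm]
  have hc0 : ∀ y : F[X], vInf F (algebraMap F[X] (RatFunc F) (f * C c) * RatFunc.X⁻¹ +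
      algebraMap F[X] (RatFunc F) y) ≤ 1 → vInf F (algebraMap F[X] (RatFunc F) y) ≤ 1 →
      c = 0 := by
    intro y h hy
    by_contra hc0
    have h' : vInf F (algebraMap F[X] (RatFunc F) (f * C c) * RatFunc.X⁻¹) ≤ 1 := by
      have : algebraMap F[X] (RatFunc F) (f * C c) * RatFunc.X⁻¹ =
        (algebraMap F[X] (RatFunc F) (f * C c) * RatFunc.X⁻¹ +
        algebraMap F[X] (RatFunc F) y) - algebraMap F[X] (RatFunc F) y := by ring
      rw [this]
      exact (Valuation.map_sub _ _ _).trans (max_le h hy)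
    rw [map_mul, map_mul, map_mul, vInf_polynomial hf0, hf, map_inv₀, vInf_X, ← WithZero.exp_neg,
      RatFunc.algebraMap_C, vInf_C hc0, mul_one, ← WithZero.exp_add, ← WithZero.exp_zero,
      WithZero.exp_le_exp] at h'
    norm_num at h'
  have hsmall : ∀ y : F[X], y.natDegree ≤ 1 → f ∣ y → y = 0 := by
    intro y hy hfy
    by_contra hy0
    have := natDegree_le_of_dvd hfy hy0
    omega
  -- Multiplied by `X`, the left side becomes the polynomial `1 + X * b'`, which is nonzero since
  -- its value at `0` is `1`.
  have hX' : ∀ b' : F[X], ¬ vInf F (RatFunc.X⁻¹ + algebraMap F[X] (RatFunc F) b') ≤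
      WithZero.exp (-2 : ℤ) := by
    intro b' h
    have e : RatFunc.X * (RatFunc.X⁻¹ + algebraMap F[X] (RatFunc F) b') =
        algebraMap F[X] (RatFunc F) (1 + X * b') := by
      rw [mul_add, mul_inv_cancel₀ hX, map_add, map_one, map_mul, RatFunc.algebraMap_X]
    have h0 : 1 + X * b' = 0 := by
      apply eq_zero_of_vInf_lt_one
      rw [← e, map_mul, vInf_X]
      refine lt_of_le_of_lt (mul_le_mul_right h _) ?_
      rw [← WithZero.exp_add, ← WithZero.exp_zero, WithZero.exp_lt_exp]
      norm_num
    have := congrArg (eval 0) h0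
    simp at this
  have hdvd : f ∣ a * d := ⟨b * C c, by linear_combination hdet⟩
  rcases hirr.prime.dvd_or_dvd hdvd with h | h
  · have ha0 := hsmall a ha h
    have hd1 : d = 1 := by rw [ha0, zero_add] at htr; exact htr
    subst ha0 hd1
    have hc0 := hc0 1 (by simpa using h4) (by simp)
    rw [hc0] at h2
    apply hX' (-b)
    rw [← Valuation.map_neg]
    convert h2 using 2
    simp
    ring
  · have hd0 := hsmall d hd h
    have ha1 : a = 1 := by rw [hd0, add_zero] at htr; exact htr
    subst hd0 ha1
    have hc0 := hc0 (-1) (by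
      rw [← Valuation.map_neg]
      convert h1 using 2
      simp
      ring) (by simp [Valuation.map_neg])
    rw [hc0] at h2
    apply hX' b
    convert h2 using 2
    simp

end Sections

/-! ### Explicit equivalences of balls under the normalizer -/

section Equivalence

variable {F : Type*} [Field F]

/-- Two vertices of the tree in the same orbit of `N(f)`. -/
def NormalizerEquiv (f : F[X]) (x y : TreeVertex F) : Prop :=
  ∃ n ∈ eichlerNormalizer f, n • x = y

theorem NormalizerEquiv.of_eq {f : F[X]} {x y : TreeVertex F} (h : x = y) :
    NormalizerEquiv f x y :=
  ⟨1, one_mem _, by rw [one_smul, h]⟩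

theorem NormalizerEquiv.trans {f : F[X]} {x y z : TreeVertex F} (h : NormalizerEquiv f x y)
    (h' : NormalizerEquiv f y z) : NormalizerEquiv f x z := by
  obtain ⟨n, hn, rfl⟩ := h
  obtain ⟨m, hm, rfl⟩ := h'
  exact ⟨m * n, mul_mem hm hn, mul_smul _ _ _⟩

theorem NormalizerEquiv.card_eq {f : F[X]} {x y : TreeVertex F} (h : NormalizerEquiv f x y) :
    Nat.card (globalSections f x) = Nat.card (globalSections f y) := by
  obtain ⟨n, hn, rfl⟩ := h
  exact (card_globalSections_smul x hn).symm

theorem NormalizerEquiv.symm {f : F[X]} {x y : TreeVertex F} (h : NormalizerEquiv f x y) :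
    NormalizerEquiv f y x := by
  obtain ⟨n, hn, rfl⟩ := h
  exact ⟨n⁻¹, inv_mem hn, inv_smul_smul _ _⟩

theorem NormalizerEquiv.hasIdempotentSection {f : F[X]} {x y : TreeVertex F}
    (h : NormalizerEquiv f x y) (hx : HasIdempotentSection f x) : HasIdempotentSection f y := by
  obtain ⟨n, hn, rfl⟩ := h
  exact hx.smul hn

/-- Equivalence of balls under an element of `N(f)` given by a coprime factorization `f = g h`. -/
theorem normalizerEquiv_ballVertex {f g h : F[X]} (α β γ δ : F[X]) (hf : f ≠ 0) (hgh : g * h = f)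
    (hu : IsUnit (g * α * δ - h * β * γ)) {a b a' b' : RatFunc F} (s : RatFunc F)
    (ha : a ≠ 0) (ha' : a' ≠ 0)
    (h1 : vInf F (a * (algebraMap F[X] (RatFunc F) (g * α) -
      b' * algebraMap F[X] (RatFunc F) (f * γ))) ≤ vInf F s * vInf F a')
    (h2 : vInf F (algebraMap F[X] (RatFunc F) (g * α) * b + algebraMap F[X] (RatFunc F) β -
      b' * (algebraMap F[X] (RatFunc F) (f * γ) * b + algebraMap F[X] (RatFunc F) (g * δ))) ≤
        vInf F s * vInf F a')
    (h3 : vInf F (algebraMap F[X] (RatFunc F) (f * γ) * a) ≤ vInf F s)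
    (h4 : vInf F (algebraMap F[X] (RatFunc F) (f * γ) * b +
      algebraMap F[X] (RatFunc F) (g * δ)) ≤ vInf F s)
    (h5 : vInf F (algebraMap F[X] (RatFunc F) g) * vInf F a = vInf F s ^ 2 * vInf F a') :
    NormalizerEquiv f (ballVertex a b) (ballVertex a' b') := by
  obtain ⟨n, hn, -, he⟩ := exists_mem_eichlerNormalizer α β γ δ hf hgh hu
  refine ⟨n, hn, smul_ballVertex_eq n s ha ha' ?_ ?_ ?_ ?_ ?_⟩
  · rw [he]; exact h1
  · rw [he]; exact h2
  · rw [he]; exact h3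
  · rw [he]; exact h4
  · rw [he]
    change vInf F (algebraMap F[X] (RatFunc F) (g * α) * algebraMap F[X] (RatFunc F) (g * δ) -
      algebraMap F[X] (RatFunc F) β * algebraMap F[X] (RatFunc F) (f * γ)) * _ = _
    have e : algebraMap F[X] (RatFunc F) (g * α) * algebraMap F[X] (RatFunc F) (g * δ) -
        algebraMap F[X] (RatFunc F) β * algebraMap F[X] (RatFunc F) (f * γ) =
        algebraMap F[X] (RatFunc F) g * algebraMap F[X] (RatFunc F) (g * α * δ - h * β * γ) := by
      rw [← map_mul, ← map_mul, ← map_sub, ← map_mul, ← hgh]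
      congr 1
      ring
    have hv : vInf F (algebraMap F[X] (RatFunc F) (g * α * δ - h * β * γ)) = 1 := by
      rw [vInf_polynomial hu.ne_zero, natDegree_eq_zero_of_isUnit hu, Nat.cast_zero,
        WithZero.exp_zero]
    rw [e, map_mul, hv, mul_one, h5]

/-- Translation by a polynomial, given by `[1, -r; 0, 1] ∈ Γ₀(f)`. -/
theorem normalizerEquiv_ballVertex_add {f : F[X]} (hf : f ≠ 0) {a : RatFunc F} (ha : a ≠ 0)
    (b : RatFunc F) (r : F[X]) :
    NormalizerEquiv f (ballVertex a (algebraMap F[X] (RatFunc F) r + b)) (ballVertex a b) := by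
  refine normalizerEquiv_ballVertex (g := 1) (h := f) 1 (-r) 0 1 hf (one_mul f) (by simp) 1 ha ha
    ?_ ?_ ?_ ?_ ?_ <;> simp

/-- The inversion `z ↦ 1 / (f z)`, given by `[0, 1; f, 0]`, the flip in all directions. -/
theorem normalizerEquiv_ballVertex_inv {f : F[X]} (hf : f ≠ 0) {a : RatFunc F} (ha : a ≠ 0) :
    NormalizerEquiv f (ballVertex a 0)
      (ballVertex (algebraMap F[X] (RatFunc F) f * a)⁻¹ 0) := by
  have hι := algebraMap_ratFunc_ne_zero hf
  have hva : vInf F a ≠ 0 := by simpa using ha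
  have hvf : vInf F (algebraMap F[X] (RatFunc F) f) ≠ 0 := by simpa using hf
  refine normalizerEquiv_ballVertex (g := f) (h := 1) 0 1 1 0 hf (mul_one f) (by simp)
    (algebraMap F[X] (RatFunc F) f * a) ha (inv_ne_zero (mul_ne_zero hι ha)) ?_ ?_ ?_ ?_ ?_
  · simp
  · rw [← map_mul, mul_inv_cancel₀ (mul_ne_zero hι ha)]
    simp
  · simp
  · simp
  · rw [map_inv₀, map_mul]
    field_simp

theorem cuspGL_smul_neighborGL_none (j : ℕ) :
    (cuspGL F j * neighborGL none) • baseVertex F = cuspGL F (j + 1) • baseVertex F := by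
  rw [cuspGL, affGL_smul_neighbor (X_zpow_ne_zero _), cuspGL_smul, ← zpow_add_one₀
    RatFunc.X_ne_zero]
  congr 2
  push_cast
  ring

/-- The center `c X ^ j` of the smaller ball is a polynomial, so a translation moves it to `0`. -/
theorem cuspGL_succ_smul_neighborGL_some {f : F[X]} (hf : f ≠ 0) (j : ℕ) (c : F) :
    NormalizerEquiv f ((cuspGL F (j + 1) * neighborGL (some c)) • baseVertex F)
      (cuspGL F j • baseVertex F) := by
  rw [cuspGL, affGL_smul_neighbor_some (X_zpow_ne_zero _), cuspGL_smul, ← zpow_sub_one₀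
    RatFunc.X_ne_zero]
  have e1 : (((j + 1 : ℕ) : ℤ) - 1 - 1) = (j : ℤ) - 1 := by push_cast; ring
  have e2 : (RatFunc.X : RatFunc F) ^ (((j + 1 : ℕ) : ℤ) - 1) * RatFunc.C c =
      algebraMap F[X] (RatFunc F) (X ^ j * C c) := by
    rw [map_mul, map_pow, RatFunc.algebraMap_X, RatFunc.algebraMap_C, ← zpow_natCast]
    congr 2
    push_cast
    ring
  rw [e1, e2]
  exact normalizerEquiv_ballVertex_add hf (X_zpow_ne_zero _) _ _

/-- Inversion reflects exponents of radii in `-deg f / 2`. For degree 1 it swaps the adjacent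
exponents `0` and `-1`, whence a half edge. For degree 2 it fixes `-1`, the exponent of `cuspGL F
0`. -/
theorem normalizerEquiv_inv_X_zpow {f : F[X]} (hf : f ≠ 0) (k l : ℤ)
    (hkl : l = -(f.natDegree + k)) :
    NormalizerEquiv f (ballVertex (RatFunc.X ^ k) 0) (ballVertex (RatFunc.X ^ l) 0) := by
  have hι := algebraMap_ratFunc_ne_zero hf
  refine (normalizerEquiv_ballVertex_inv hf (X_zpow_ne_zero k)).trans (.of_eq ?_)
  rw [ballVertex_eq_iff (inv_ne_zero (mul_ne_zero hι (X_zpow_ne_zero _))) (X_zpow_ne_zero _)]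
  refine ⟨?_, by simp⟩
  rw [map_inv₀, map_mul, vInf_polynomial hf, vInf_X_zpow, vInf_X_zpow, hkl, WithZero.exp_neg,
    WithZero.exp_add]

theorem cuspGL_zero_smul_neighborGL_zero {f : F[X]} (hf : f.natDegree = 2) :
    NormalizerEquiv f ((cuspGL F 0 * neighborGL (some 0)) • baseVertex F)
      (cuspGL F 1 • baseVertex F) := by
  have hf0 : f ≠ 0 := by rintro rfl; simp at hf
  rw [cuspGL, affGL_smul_neighbor_some (X_zpow_ne_zero _), cuspGL_smul, ← zpow_sub_one₀
    RatFunc.X_ne_zero, map_zero, mul_zero, zero_add]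
  exact normalizerEquiv_inv_X_zpow hf0 _ _ (by rw [hf]; norm_num)

/-- For `q = 2` and degree 2 this is the one neighbor of the start of the cusp not settled by
translation or inversion. Its orbit depends on the type of `f`. -/
theorem cuspGL_zero_smul_neighborGL_one :
    (cuspGL F 0 * neighborGL (some 1)) • baseVertex F =
      ballVertex (RatFunc.X ^ (-2 : ℤ)) RatFunc.X⁻¹ := by
  rw [cuspGL, affGL_smul_neighbor_some (X_zpow_ne_zero _), ← zpow_sub_one₀
    RatFunc.X_ne_zero, map_one, mul_one, add_zero]
  congr 1
  rw [Nat.cast_zero, zero_sub, zpow_neg_one]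

theorem eq_zero_or_eq_one_of_card [Fintype F] (hF : Fintype.card F = 2) (c : F) :
    c = 0 ∨ c = 1 := by
  have := FiniteField.pow_card c
  rw [hF] at this
  have h : c * (c - 1) = 0 := by linear_combination this
  rcases mul_eq_zero.1 h with h | h
  · exact Or.inl h
  · exact Or.inr (sub_eq_zero.1 h)

theorem two_eq_zero_of_card [Fintype F] (hF : Fintype.card F = 2) : (2 : F) = 0 := by
  have := Nat.cast_card_eq_zero F
  rw [hF] at this
  exact_mod_cast this

theorem two_eq_zero_ratFunc_of_card [Fintype F] (hF : Fintype.card F = 2) :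
    (2 : RatFunc F) = 0 := by
  have := map_ofNat (RatFunc.C (K := F)) 2
  rw [two_eq_zero_of_card hF, map_zero] at this
  exact this.symm

theorem encard_fiber_option {W : Type*} [DecidableEq W] (u : W) (v : F → W) (w : W) :
    {o : Option F | o.elim u v = w}.encard = (if u = w then 1 else 0) + {c | v c = w}.encard := by
  have e : {o : Option F | o.elim u v = w} = {o | o = none ∧ u = w} ∪ some '' {c : F | v c = w} := by
    ext o
    cases o <;> simp
  rw [e, Set.encard_union_eq, (Option.some_injective F).encard_image]
  · congr 1
    split_ifs with h <;> simp [h]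
  · rw [Set.disjoint_left]
    rintro o ⟨rfl, -⟩
    simp

theorem encard_fiber_const {ι : Type*} [Fintype ι] {W : Type*} [DecidableEq W] (u w : W) :
    {c : ι | (fun _ => u) c = w}.encard = if u = w then (Fintype.card ι : ℕ∞) else 0 := by
  split_ifs with h
  · simp [h, Set.encard_univ]
  · simp [h]

theorem encard_fiber_of_card_eq_two [Fintype F] (hF : Fintype.card F = 2) {W : Type*}
    [DecidableEq W] (v : F → W) (w : W) :
    {c | v c = w}.encard = (if v 0 = w then 1 else 0) + (if v 1 = w then 1 else 0) := by
  have e : {c | v c = w} = {c | c = 0 ∧ v 0 = w} ∪ {c | c = 1 ∧ v 1 = w} := by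
    ext c
    rcases eq_zero_or_eq_one_of_card hF c with rfl | rfl <;> simp
  rw [e, Set.encard_union_eq]
  · congr 1
    · split_ifs with h <;> simp [h]
    · split_ifs with h <;> simp [h]
  · rw [Set.disjoint_left]
    rintro o ⟨rfl, -⟩
    simp

end Equivalence

/-! ### The ray quotients -/

section Tables

variable {F : Type*} [Field F]

/-- The number `q ^ (j + 2)` of global sections determines `j`. -/
theorem cuspGL_injective [Fintype F] {f : F[X]} (hf : f ≠ 0) {j k : ℕ}
    (hj : 1 < f.natDegree + j) (hk : 1 < f.natDegree + k)
    (h : NormalizerEquiv f (cuspGL F j • baseVertex F) (cuspGL F k • baseVertex F)) : j = k := by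
  have := h.card_eq
  rw [card_globalSections_cuspGL hf hj, card_globalSections_cuspGL hf hk] at this
  have := Nat.pow_right_injective (Nat.succ_le_of_lt Fintype.one_lt_card) this
  omega

theorem isomorphic_tableLinear [Fintype F] {f : F[X]} (hf : f.natDegree = 1) :
    (eichlerWRFQ f).Isomorphic (tableLinear (Fintype.card F)) := by
  have hf0 : f ≠ 0 := by rintro rfl; simp at hf
  -- The ray starts at radius exponent `0`, hence the shift. At `i = 0` the truncated `i - 1 = 0` is
  -- intended: these `q` neighbors have exponent `-1` and are inverted back to exponent `0`.
  refine eichlerWRFQ_isomorphic (fun i => cuspGL F (i + 1)) (fun i o => o.elim (i + 1) fun _ => i - 1)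
    ?_ ?_ ?_ ?_
  · rintro i (_ | c)
    · exact NormalizerEquiv.of_eq (cuspGL_smul_neighborGL_none _)
    · refine (cuspGL_succ_smul_neighborGL_some hf0 i c).trans ?_
      cases i with
      | zero => exact normalizerEquiv_inv_X_zpow hf0 _ _ (by rw [hf]; norm_num)
      | succ i => exact .of_eq rfl
  · intro i j n hn h
    have := cuspGL_injective hf0 (by omega) (by omega) ⟨n, hn, h⟩
    omega
  · intro i j
    rw [encard_fiber_option, encard_fiber_const]
    simp only [tableLinear]
    split_ifs <;> first | omega | simp
  · intro z
    constructor
    · rintro (rfl | ⟨i, rfl⟩)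
      · exact ⟨0, some 0, rfl⟩
      · exact ⟨i, none, rfl⟩
    · rintro ⟨i, _ | c, rfl⟩
      · exact Or.inr ⟨i, rfl⟩
      · cases i with
        | zero => exact Or.inl rfl
        | succ i => exact Or.inr ⟨i, Sym2.eq_swap⟩

theorem isomorphic_tableSplit [Fintype F] (hF : Fintype.card F = 2) :
    (eichlerWRFQ (X * (X + 1) : F[X])).Isomorphic tableSplit := by
  classical
  have h2' := two_eq_zero_ratFunc_of_card hF
  have hX1 : (X + 1 : F[X]).natDegree = 1 := natDegree_X_add_C 1
  have hX10 : (X + 1 : F[X]) ≠ 0 := by intro h; simp [h] at hX1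
  have hf0 : (X * (X + 1) : F[X]) ≠ 0 := mul_ne_zero X_ne_zero hX10
  have hf : (X * (X + 1) : F[X]).natDegree = 2 := by
    rw [natDegree_mul X_ne_zero hX10, natDegree_X, hX1]
  have hvX := vInf_X (F := F)
  refine eichlerWRFQ_isomorphic (cuspGL F)
    -- Again `0 - 1 = 0` is intended: for `i = 0` and `c = 1` it records the half edge.
    (fun i o => o.elim (i + 1) fun c => if i = 0 ∧ c = 0 then 1 else i - 1) ?_ ?_ ?_ ?_
  · rintro (_ | i) (_ | c)
    · exact NormalizerEquiv.of_eq (cuspGL_smul_neighborGL_none _)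
    · rcases eq_zero_or_eq_one_of_card hF c with rfl | rfl
      · change NormalizerEquiv _ _ _
        simpa using cuspGL_zero_smul_neighborGL_zero hf
      · simp only [Option.elim_some, true_and, one_ne_zero, if_false, Nat.zero_sub]
        rw [cuspGL_zero_smul_neighborGL_one, cuspGL_smul]
        -- The flip in the direction of `X` alone, `[X, 1; X(X + 1), X]`, sends the center `X⁻¹` to
        -- `0` because `2 = 0`, and so takes this neighbor back to the start of the ray.
        refine normalizerEquiv_ballVertex (g := X) (h := X + 1) 1 1 1 1 hf0 rfl (by simp) 1
          (X_zpow_ne_zero _) (X_zpow_ne_zero _) ?_ ?_ ?_ ?_ ?_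
        · simp only [mul_one, zero_mul, sub_zero, map_mul, vInf_X_zpow, map_one, one_mul,
            RatFunc.algebraMap_X, hvX, ← WithZero.exp_add, WithZero.exp_le_exp]
          norm_num
        · have e : algebraMap F[X] (RatFunc F) (X * 1) * RatFunc.X⁻¹ +
              algebraMap F[X] (RatFunc F) 1 = 0 := by
            rw [mul_one, map_one, RatFunc.algebraMap_X, mul_inv_cancel₀ RatFunc.X_ne_zero]
            linear_combination h2'
          rw [e]
          simp
        · rw [mul_one, map_mul, vInf_polynomial hf0, hf, vInf_X_zpow, map_one, ← WithZero.exp_add,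
            ← WithZero.exp_zero, WithZero.exp_le_exp]
          norm_num
        · have e : algebraMap F[X] (RatFunc F) (X * (X + 1) * 1) * RatFunc.X⁻¹ +
              algebraMap F[X] (RatFunc F) (X * 1) = 1 := by
            simp only [mul_one, map_mul, map_add, map_one, RatFunc.algebraMap_X]
            field_simp [RatFunc.X_ne_zero (K := F)]
            linear_combination RatFunc.X * h2'
          rw [e]
        · simp only [RatFunc.algebraMap_X, hvX, vInf_X_zpow, map_one, one_pow, one_mul,
            ← WithZero.exp_add]
          norm_num
    · exact NormalizerEquiv.of_eq (cuspGL_smul_neighborGL_none _)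
    · change NormalizerEquiv _ _ _
      simpa using cuspGL_succ_smul_neighborGL_some hf0 i c
  · intro i j n hn h
    exact cuspGL_injective hf0 (by omega) (by omega) ⟨n, hn, h⟩
  · intro i j
    rw [encard_fiber_option, encard_fiber_of_card_eq_two hF]
    simp only [tableSplit, and_true, one_ne_zero, and_false,
      if_false]
    split_ifs <;> first | omega | norm_num
  · intro z
    constructor
    · rintro (rfl | ⟨i, rfl⟩)
      · exact ⟨0, some 1, by simp⟩
      · exact ⟨i, none, rfl⟩
    · rintro ⟨i, _ | c, rfl⟩
      · exact Or.inr ⟨i, rfl⟩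
      · simp only [Option.elim_some]
        split_ifs with h
        · rw [h.1]
          exact Or.inr ⟨0, rfl⟩
        · cases i with
          | zero => exact Or.inl rfl
          | succ i => exact Or.inr ⟨i, Sym2.eq_swap⟩

theorem isomorphic_tableIrreducible [Fintype F] (hF : Fintype.card F = 2)
    (hirr : Irreducible (X ^ 2 + X + 1 : F[X])) :
    (eichlerWRFQ (X ^ 2 + X + 1 : F[X])).Isomorphic tableIrreducible := by
  classical
  have h2' := two_eq_zero_ratFunc_of_card hF
  have hf0 := hirr.ne_zero
  have hf : (X ^ 2 + X + 1 : F[X]).natDegree = 2 := by compute_degree!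
  have hX1 : (X + 1 : F[X]).natDegree = 1 := natDegree_X_add_C 1
  have hX10 : (X + 1 : F[X]) ≠ 0 := by intro h; simp [h] at hX1
  have hvX := vInf_X (F := F)
  have hX := RatFunc.X_ne_zero (K := F)
  have hιf : algebraMap F[X] (RatFunc F) (X ^ 2 + X + 1) = RatFunc.X ^ 2 + RatFunc.X + 1 := by
    simp [RatFunc.algebraMap_X]
  have hX2 : (RatFunc.X : RatFunc F) ^ (-2 : ℤ) = RatFunc.X⁻¹ * RatFunc.X⁻¹ := by
    rw [← zpow_neg_one, ← zpow_add₀ hX]; norm_num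
  -- The cusp is shifted by one to make room for the extra end vertex, the ball around `X⁻¹`.
  set ρ : ℕ → GL (Fin 2) (RatFunc F) := fun i =>
    if i = 0 then affGL (RatFunc.X ^ (-2 : ℤ)) RatFunc.X⁻¹ else cuspGL F (i - 1) with hρ
  have hρ0 : ρ 0 = affGL (RatFunc.X ^ (-2 : ℤ)) RatFunc.X⁻¹ := rfl
  have hρs : ∀ i, ρ (i + 1) = cuspGL F i := fun i => rfl
  have hno : ¬ HasIdempotentSection (X ^ 2 + X + 1 : F[X]) (ρ 0 • baseVertex F) :=
    not_hasIdempotentSection_irreducible hf hirr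
  have hyes : ∀ i, HasIdempotentSection (X ^ 2 + X + 1 : F[X]) (ρ (i + 1) • baseVertex F) :=
    fun i => hasIdempotentSection_cuspGL hf0 (by omega)
  refine eichlerWRFQ_isomorphic ρ
    (fun i o => o.elim (i + 1) fun c => if i = 0 then 1 else if i = 1 then (if c = 0 then 2 else 0)
      else i - 1) ?_ ?_ ?_ ?_
  · rintro (_ | _ | i) (_ | c)
    · refine NormalizerEquiv.of_eq ?_
      change (ρ 0 * _) • _ = cuspGL F 0 • baseVertex F
      rw [hρ0, affGL_smul_neighbor (X_zpow_ne_zero _), cuspGL_smul, ← zpow_add_one₀ hX,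
        ballVertex_eq_iff (X_zpow_ne_zero _) (X_zpow_ne_zero _), sub_zero, map_inv₀, hvX,
        vInf_X_zpow, vInf_X_zpow, ← WithZero.exp_neg]
      exact ⟨by norm_num, by norm_num⟩
    · change NormalizerEquiv _ ((ρ 0 * _) • _) (cuspGL F 0 • baseVertex F)
      rw [hρ0, affGL_smul_neighbor_some (X_zpow_ne_zero _), cuspGL_smul, ← zpow_sub_one₀ hX]
      rcases eq_zero_or_eq_one_of_card hF c with rfl | rfl
      · rw [map_zero, mul_zero, zero_add]
        -- As `f = X(X + 1) + 1`, the matrix `[X, 1; f, X + 1]` has determinant `-1`. In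
        -- characteristic 2 its trace is `1`, so it has order three. It sends the center `X⁻¹` to
        -- `0`.
        refine normalizerEquiv_ballVertex (g := 1) (h := X ^ 2 + X + 1) X 1 1 (X + 1) hf0
          (one_mul _) ?_ RatFunc.X⁻¹ (X_zpow_ne_zero _) (X_zpow_ne_zero _) ?_ ?_ ?_ ?_ ?_
        · have : 1 * X * (X + 1) - (X ^ 2 + X + 1) * 1 * 1 = (-1 : F[X]) := by ring
          rw [this]
          exact isUnit_one.neg
        · simp only [one_mul, zero_mul, sub_zero, map_mul, map_inv₀, RatFunc.algebraMap_X, hvX,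
            vInf_X_zpow, ← WithZero.exp_add, ← WithZero.exp_neg, WithZero.exp_le_exp]
          norm_num
        · have e : algebraMap F[X] (RatFunc F) (1 * X) * RatFunc.X⁻¹ +
              algebraMap F[X] (RatFunc F) 1 = 0 := by
            rw [one_mul, map_one, RatFunc.algebraMap_X, mul_inv_cancel₀ hX]
            linear_combination h2'
          rw [e]
          simp
        · rw [mul_one, map_mul, vInf_polynomial hf0, hf, vInf_X_zpow, map_inv₀, hvX,
            ← WithZero.exp_add, ← WithZero.exp_neg, WithZero.exp_le_exp]
          norm_num
        · have e : algebraMap F[X] (RatFunc F) ((X ^ 2 + X + 1) * 1) * RatFunc.X⁻¹ +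
              algebraMap F[X] (RatFunc F) (1 * (X + 1)) = RatFunc.X⁻¹ := by
            rw [mul_one, one_mul, hιf, map_add, map_one, RatFunc.algebraMap_X]
            field_simp
            linear_combination (RatFunc.X ^ 2 + RatFunc.X) * h2'
          rw [e]
        · simp only [map_one, vInf_X_zpow, map_inv₀, hvX, one_mul, ← WithZero.exp_neg, pow_two,
            ← WithZero.exp_add]
          norm_num
      · rw [map_one, mul_one]
        -- In characteristic 2 this is the inverse of the preceding matrix. It takes the third
        -- neighbor to the start of the cusp.
        refine normalizerEquiv_ballVertex (g := 1) (h := X ^ 2 + X + 1) (X + 1) 1 1 X hf0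
          (one_mul _) ?_ RatFunc.X⁻¹ (X_zpow_ne_zero _) (X_zpow_ne_zero _) ?_ ?_ ?_ ?_ ?_
        · have : 1 * (X + 1) * X - (X ^ 2 + X + 1) * 1 * 1 = (-1 : F[X]) := by ring
          rw [this]
          exact isUnit_one.neg
        · rw [zero_mul, sub_zero, one_mul, map_mul, vInf_polynomial hX10, map_inv₀, hvX,
            vInf_X_zpow, vInf_X_zpow, hX1, ← WithZero.exp_add, ← WithZero.exp_neg,
            ← WithZero.exp_add, WithZero.exp_le_exp]
          norm_num
        · have e : algebraMap F[X] (RatFunc F) (1 * (X + 1)) *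
              (RatFunc.X ^ (-2 : ℤ) + RatFunc.X⁻¹) + algebraMap F[X] (RatFunc F) 1 =
              RatFunc.X ^ (-2 : ℤ) := by
            rw [one_mul, map_add, map_one, RatFunc.algebraMap_X, hX2]
            field_simp
            linear_combination (RatFunc.X ^ 2 + RatFunc.X) * h2'
          rw [e, zero_mul, sub_zero, map_inv₀, hvX, vInf_X_zpow, vInf_X_zpow, ← WithZero.exp_neg,
            ← WithZero.exp_add, WithZero.exp_le_exp]
          norm_num
        · rw [mul_one, map_mul, vInf_polynomial hf0, hf, vInf_X_zpow, map_inv₀, hvX,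
            ← WithZero.exp_add, ← WithZero.exp_neg, WithZero.exp_le_exp]
          norm_num
        · have e : algebraMap F[X] (RatFunc F) ((X ^ 2 + X + 1) * 1) *
              (RatFunc.X ^ (-2 : ℤ) + RatFunc.X⁻¹) + algebraMap F[X] (RatFunc F) (1 * X) =
              RatFunc.X ^ (-2 : ℤ) := by
            rw [mul_one, one_mul, hιf, RatFunc.algebraMap_X, hX2]
            field_simp
            linear_combination (RatFunc.X ^ 3 + RatFunc.X ^ 2 + RatFunc.X) * h2'
          rw [e, map_inv₀, hvX, vInf_X_zpow, ← WithZero.exp_neg, WithZero.exp_le_exp]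
          norm_num
        · simp only [map_one, vInf_X_zpow, map_inv₀, hvX, one_mul, ← WithZero.exp_neg, pow_two,
            ← WithZero.exp_add]
          norm_num
    · exact NormalizerEquiv.of_eq (cuspGL_smul_neighborGL_none _)
    · rcases eq_zero_or_eq_one_of_card hF c with rfl | rfl
      · change NormalizerEquiv _ _ _
        simpa [hρ] using cuspGL_zero_smul_neighborGL_zero hf
      · refine NormalizerEquiv.of_eq ?_
        simpa [hρ, ballVertex] using cuspGL_zero_smul_neighborGL_one (F := F)
    · exact NormalizerEquiv.of_eq (cuspGL_smul_neighborGL_none _)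
    · exact cuspGL_succ_smul_neighborGL_some hf0 i c
  · rintro (_ | i) (_ | j) n hn h
    · rfl
    · exact absurd (NormalizerEquiv.hasIdempotentSection (.symm ⟨n, hn, h⟩) (hyes j)) hno
    · exact absurd (NormalizerEquiv.hasIdempotentSection ⟨n, hn, h⟩ (hyes i)) hno
    · exact congrArg _ (cuspGL_injective hf0 (by omega) (by omega) ⟨n, hn, h⟩)
  · intro i j
    rw [encard_fiber_option, encard_fiber_of_card_eq_two hF]
    simp only [tableIrreducible, if_true, one_ne_zero, if_false]
    split_ifs <;> first | omega | norm_num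
  · intro z
    constructor
    · rintro ⟨i, rfl⟩
      exact ⟨i, none, rfl⟩
    · rintro ⟨i, _ | c, rfl⟩
      · exact ⟨i, rfl⟩
      · simp only [Option.elim_some]
        split_ifs with h0 h1
        · exact ⟨0, by rw [h0]⟩
        · exact ⟨1, by rw [h1]⟩
        · exact ⟨0, by rw [h1]; exact Sym2.eq_swap⟩
        · obtain ⟨i, rfl⟩ := Nat.exists_eq_succ_of_ne_zero h0
          exact ⟨i, Sym2.eq_swap⟩

end Tables

/-! ### The line quotient for the square of a linear polynomial -/

section TableSquare

variable {F : Type*} [Field F]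

/-- Representatives of the vertices of the quotient for the square of a linear polynomial `p`: the
cusp at infinity on one side, and the cusp at `p⁻¹` on the other. -/
def squareGL (p : F[X]) : ℤ → GL (Fin 2) (RatFunc F)
  | .ofNat k => cuspGL F k
  | .negSucc m => affGL (algebraMap F[X] (RatFunc F) p ^ (-(m + 2 : ℤ)))
      (algebraMap F[X] (RatFunc F) p)⁻¹

theorem vInf_zpow_of_natDegree_eq_one {p : F[X]} (hp : p.natDegree = 1) (n : ℤ) :
    vInf F (algebraMap F[X] (RatFunc F) p ^ n) = WithZero.exp n := by
  have hp0 : p ≠ 0 := by rintro rfl; simp at hp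
  rw [map_zpow₀, vInf_polynomial hp0, hp, ← WithZero.exp_zsmul]
  simp

/-- Near the center of the line, the ball around `p⁻¹` is the ball around `0`. -/
theorem ballVertex_neg_one {p : F[X]} (hp : p.natDegree = 1) :
    ballVertex (algebraMap F[X] (RatFunc F) p ^ (-1 : ℤ)) (algebraMap F[X] (RatFunc F) p)⁻¹ =
      cuspGL F 0 • baseVertex F := by
  have hp0 : p ≠ 0 := by rintro rfl; simp at hp
  have hι := algebraMap_ratFunc_ne_zero hp0
  rw [cuspGL_smul, ballVertex_eq_iff (zpow_ne_zero _ hι) (X_zpow_ne_zero _), sub_zero,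
    ← zpow_neg_one, vInf_zpow_of_natDegree_eq_one hp, vInf_X_zpow]
  simp

/-- In characteristic 2 the matrix used is `1 + p ^ m [p, -1; p², -p]`, a unipotent element of
`Γ₀(p²)` fixing the cusp `p⁻¹`. It takes the neighbor pointing away from this cusp to the larger
ball around `p⁻¹`. -/
theorem normalizerEquiv_square_some_one [Fintype F] (hF : Fintype.card F = 2) {p : F[X]}
    (hp : p.natDegree = 1) (m : ℕ) :
    NormalizerEquiv (p ^ 2)
      (ballVertex (algebraMap F[X] (RatFunc F) p ^ (-(m + 2 : ℤ)) * RatFunc.X⁻¹)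
        (algebraMap F[X] (RatFunc F) p ^ (-(m + 2 : ℤ)) + (algebraMap F[X] (RatFunc F) p)⁻¹))
      (ballVertex (algebraMap F[X] (RatFunc F) p ^ (-(m + 1 : ℤ)))
        (algebraMap F[X] (RatFunc F) p)⁻¹) := by
  have h2 := two_eq_zero_ratFunc_of_card hF
  have h2p : (2 : F[X]) = 0 := by
    have := map_ofNat (C (R := F)) 2
    rw [two_eq_zero_of_card hF, map_zero] at this
    exact this.symm
  have hp0 : p ≠ 0 := by rintro rfl; simp at hp
  have hι := algebraMap_ratFunc_ne_zero hp0
  have hv := vInf_zpow_of_natDegree_eq_one hp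
  have hv1 : vInf F (algebraMap F[X] (RatFunc F) p)⁻¹ = WithZero.exp (-1 : ℤ) := by
    rw [← zpow_neg_one, hv]
  have hvX : vInf F (RatFunc.X⁻¹ : RatFunc F) = WithZero.exp (-1 : ℤ) := by
    rw [← zpow_neg_one, vInf_X_zpow]
  have hz : algebraMap F[X] (RatFunc F) p ^ (-(m + 2 : ℤ)) =
      (algebraMap F[X] (RatFunc F) p ^ (m + 2))⁻¹ := by
    rw [zpow_neg]
    norm_cast
  refine normalizerEquiv_ballVertex (g := 1) (h := p ^ 2) (1 + p ^ (m + 1)) (p ^ m) (p ^ m)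
    (1 + p ^ (m + 1)) (pow_ne_zero 2 hp0) (one_mul _) ?_ (algebraMap F[X] (RatFunc F) p)⁻¹
    (mul_ne_zero (zpow_ne_zero _ hι) (inv_ne_zero RatFunc.X_ne_zero)) (zpow_ne_zero _ hι)
    ?_ ?_ ?_ ?_ ?_
  · have : 1 * (1 + p ^ (m + 1)) * (1 + p ^ (m + 1)) - p ^ 2 * p ^ m * p ^ m = 1 := by
      linear_combination p ^ (m + 1) * h2p
    rw [this]
    exact isUnit_one
  · have e : algebraMap F[X] (RatFunc F) (1 * (1 + p ^ (m + 1))) -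
        (algebraMap F[X] (RatFunc F) p)⁻¹ * algebraMap F[X] (RatFunc F) (p ^ 2 * p ^ m) = 1 := by
      simp only [one_mul, map_mul, map_add, map_one, map_pow]
      field_simp
      ring
    rw [e, mul_one, map_mul, hv, hvX, hv1, hv, ← WithZero.exp_add, ← WithZero.exp_add,
      WithZero.exp_le_exp]
    omega
  · have e : algebraMap F[X] (RatFunc F) (p ^ 2 * p ^ m) *
        (algebraMap F[X] (RatFunc F) p ^ (-(m + 2 : ℤ)) + (algebraMap F[X] (RatFunc F) p)⁻¹) +
          algebraMap F[X] (RatFunc F) (1 * (1 + p ^ (m + 1))) = 0 := by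
      rw [hz]
      simp only [one_mul, map_mul, map_add, map_one, map_pow]
      field_simp
      linear_combination (algebraMap F[X] (RatFunc F) p ^ (m + 2) *
        (1 + algebraMap F[X] (RatFunc F) p ^ (m + 1))) * h2
    have e' : algebraMap F[X] (RatFunc F) (1 * (1 + p ^ (m + 1))) *
        (algebraMap F[X] (RatFunc F) p ^ (-(m + 2 : ℤ)) + (algebraMap F[X] (RatFunc F) p)⁻¹) +
          algebraMap F[X] (RatFunc F) (p ^ m) = algebraMap F[X] (RatFunc F) p ^ (-(m + 2 : ℤ)) := by
      rw [hz]
      simp only [one_mul, map_add, map_one, map_pow]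
      field_simp
      linear_combination (algebraMap F[X] (RatFunc F) p ^ (m + 2) *
        (1 + algebraMap F[X] (RatFunc F) p ^ (m + 1))) * h2
    rw [e, e', mul_zero, sub_zero, hv, hv1, hv, ← WithZero.exp_add, WithZero.exp_le_exp]
    omega
  · have e : algebraMap F[X] (RatFunc F) (p ^ 2 * p ^ m) *
        (algebraMap F[X] (RatFunc F) p ^ (-(m + 2 : ℤ)) * RatFunc.X⁻¹) = RatFunc.X⁻¹ := by
      rw [hz]
      simp only [map_mul, map_pow]
      field_simp
      ring
    rw [e, hvX, hv1]
  · have e : algebraMap F[X] (RatFunc F) (p ^ 2 * p ^ m) *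
        (algebraMap F[X] (RatFunc F) p ^ (-(m + 2 : ℤ)) + (algebraMap F[X] (RatFunc F) p)⁻¹) +
          algebraMap F[X] (RatFunc F) (1 * (1 + p ^ (m + 1))) = 0 := by
      rw [hz]
      simp only [one_mul, map_mul, map_add, map_one, map_pow]
      field_simp
      linear_combination (algebraMap F[X] (RatFunc F) p ^ (m + 2) *
        (1 + algebraMap F[X] (RatFunc F) p ^ (m + 1))) * h2
    rw [e]
    simp
  · rw [map_one, map_one, one_mul, map_mul, hv, hvX, hv1, hv, pow_two, ← WithZero.exp_add,
      ← WithZero.exp_add, ← WithZero.exp_add]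
    congr 1
    ring

theorem isomorphic_tableSquare [Fintype F] (hF : Fintype.card F = 2) {p : F[X]}
    (hp : p.natDegree = 1) : (eichlerWRFQ (p ^ 2)).Isomorphic tableSquare := by
  classical
  have hp0 : p ≠ 0 := by rintro rfl; simp at hp
  have hι := algebraMap_ratFunc_ne_zero hp0
  have hf0 : p ^ 2 ≠ 0 := pow_ne_zero 2 hp0
  have hf : (p ^ 2).natDegree = 2 := by rw [natDegree_pow, hp]
  have hv := vInf_zpow_of_natDegree_eq_one hp
  have hno : ∀ m, ¬ HasIdempotentSection (p ^ 2) (squareGL p (.negSucc m) • baseVertex F) :=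
    not_hasIdempotentSection_square (two_eq_zero_of_card hF) hp
  have hyes : ∀ k, HasIdempotentSection (p ^ 2) (squareGL p (.ofNat k) • baseVertex F) :=
    fun k => hasIdempotentSection_cuspGL hf0 (by omega)
  have hc : ∀ m : ℕ, ballVertex (algebraMap F[X] (RatFunc F) p ^ (-(m + 1 : ℤ)))
      (algebraMap F[X] (RatFunc F) p)⁻¹ = squareGL p (.negSucc m + 1) • baseVertex F := by
    rintro (_ | m)
    · exact ballVertex_neg_one hp
    · have : Int.negSucc (m + 1) + 1 = .negSucc m := by omega
      rw [this, squareGL, ballVertex]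
      congr 3
  refine eichlerWRFQ_isomorphic (squareGL p)
    (fun i o => o.elim (i + 1) fun c => if i = 0 then (if c = 0 then 1 else -1)
      else if 0 < i then i - 1 else if c = 0 then i - 1 else i + 1) ?_ ?_ ?_ ?_
  · rintro ((_ | k) | m) (_ | c)
    · exact NormalizerEquiv.of_eq (cuspGL_smul_neighborGL_none _)
    · rcases eq_zero_or_eq_one_of_card hF c with rfl | rfl
      · simp only [Option.elim_some, Int.ofNat_eq_natCast, Nat.cast_zero, if_true]
        exact cuspGL_zero_smul_neighborGL_zero hf
      · refine NormalizerEquiv.of_eq (cuspGL_zero_smul_neighborGL_one.trans ?_)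
        have : (if (Int.ofNat 0) = 0 then (if (1 : F) = 0 then 1 else -1)
            else if 0 < Int.ofNat 0 then Int.ofNat 0 - 1 else if (1 : F) = 0 then Int.ofNat 0 - 1
            else Int.ofNat 0 + 1) = .negSucc 0 := by simp
        simp only [Option.elim_some]
        rw [this]
        change _ = ballVertex _ _
        rw [ballVertex_eq_iff (X_zpow_ne_zero _) (zpow_ne_zero _ hι), hv, vInf_X_zpow]
        refine ⟨by simp, ?_⟩
        have hX := RatFunc.X_ne_zero (K := F)
        -- Over two elements `p` is monic, so `X⁻¹` and `p⁻¹` differ by `(p - X) / (X p)`, of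
        -- valuation at most `exp (-2)`: the two centers define the same ball.
        have hd : ∃ c : F, p - X = C c := by
          have h1 := eq_X_add_C_of_natDegree_le_one hp.le
          have h0 : p.coeff 1 = 1 := (eq_zero_or_eq_one_of_card hF _).resolve_left (by
            rw [← hp]; simpa using hp0)
          rw [h0] at h1
          exact ⟨p.coeff 0, by rw [h1]; simp⟩
        obtain ⟨c, hc'⟩ := hd
        have e : (RatFunc.X : RatFunc F)⁻¹ - (algebraMap F[X] (RatFunc F) p)⁻¹ =
            RatFunc.C c * (RatFunc.X ^ (-1 : ℤ) * algebraMap F[X] (RatFunc F) p ^ (-1 : ℤ)) := by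
          rw [← RatFunc.algebraMap_C, ← hc', map_sub, RatFunc.algebraMap_X, zpow_neg_one,
            zpow_neg_one]
          field_simp
        rw [e, map_mul, map_mul, hv, vInf_X_zpow, ← WithZero.exp_add]
        refine (mul_le_of_le_one_left' (vInf_C_le c)).trans ?_
        rw [WithZero.exp_le_exp]
        norm_num
    · exact NormalizerEquiv.of_eq (cuspGL_smul_neighborGL_none _)
    · have h0 : ¬ Int.ofNat (k + 1) = 0 := (Int.natCast_succ_pos k).ne'
      have h1 : 0 < Int.ofNat (k + 1) := Int.natCast_succ_pos k
      have h2 : Int.ofNat (k + 1) - 1 = .ofNat k := by simp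
      simp only [Option.elim_some, h0, h1, if_true, if_false, h2]
      exact cuspGL_succ_smul_neighborGL_some hf0 k c
    · refine NormalizerEquiv.of_eq ?_
      simp only [Option.elim_none]
      rw [← hc, squareGL, affGL_smul_neighbor (zpow_ne_zero _ hι),
        ballVertex_eq_iff (mul_ne_zero (zpow_ne_zero _ hι) RatFunc.X_ne_zero) (zpow_ne_zero _ hι),
        sub_self, map_mul, hv, hv, vInf_X, ← WithZero.exp_add]
      exact ⟨by congr 1, by simp⟩
    · have h0 : ¬ Int.negSucc m = 0 := by simp
      have h1 : ¬ 0 < Int.negSucc m := by omega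
      simp only [Option.elim_some, h0, h1, if_false]
      rw [squareGL, affGL_smul_neighbor_some (zpow_ne_zero _ hι)]
      rcases eq_zero_or_eq_one_of_card hF c with rfl | rfl
      · rw [if_pos rfl, map_zero, mul_zero, zero_add]
        refine NormalizerEquiv.of_eq ?_
        have h2 : Int.negSucc m - 1 = .negSucc (m + 1) := by omega
        rw [h2]
        change _ = ballVertex _ _
        rw [ballVertex_eq_iff (mul_ne_zero (zpow_ne_zero _ hι) (inv_ne_zero RatFunc.X_ne_zero))
          (zpow_ne_zero _ hι), sub_self, map_mul, hv, hv, ← zpow_neg_one, vInf_X_zpow,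
          ← WithZero.exp_add]
        exact ⟨by congr 1, by simp⟩
      · rw [if_neg one_ne_zero, map_one, mul_one, ← hc]
        exact normalizerEquiv_square_some_one hF hp m
  -- Within one half of the line the number of sections decides. Idempotent sections exist exactly
  -- on the nonnegative half, so the halves are not exchanged.
  · rintro (k | m) (k' | m') n hn h
    · exact congrArg _ (cuspGL_injective hf0 (by omega) (by omega) ⟨n, hn, h⟩)
    · exact absurd (NormalizerEquiv.hasIdempotentSection ⟨n, hn, h⟩ (hyes k)) (hno m')
    · exact absurd (NormalizerEquiv.hasIdempotentSection (.symm ⟨n, hn, h⟩) (hyes k')) (hno m)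
    · have h' := NormalizerEquiv.card_eq ⟨n, hn, h⟩
      rw [squareGL, squareGL, card_globalSections_square hp, card_globalSections_square hp] at h'
      have := Nat.pow_right_injective (Nat.succ_le_of_lt Fintype.one_lt_card) h'
      congr 1
      omega
  · intro i j
    rw [encard_fiber_option, encard_fiber_of_card_eq_two hF]
    simp only [tableSquare, if_true, one_ne_zero, if_false]
    split_ifs <;> first | omega | norm_num
  · intro z
    constructor
    · rintro ⟨i, rfl⟩
      exact ⟨i, none, rfl⟩
    · rintro ⟨i, _ | c, rfl⟩
      · exact ⟨i, rfl⟩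
      · simp only [Option.elim_some]
        split_ifs with h0 h1 h1 h2
        · exact ⟨0, by rw [h0]; rfl⟩
        · exact ⟨-1, by rw [h0]; exact Sym2.eq_swap⟩
        · exact ⟨i - 1, by rw [sub_add_cancel]; exact Sym2.eq_swap⟩
        · exact ⟨i - 1, by rw [sub_add_cancel]; exact Sym2.eq_swap⟩
        · exact ⟨i, rfl⟩

end TableSquare

/-! ### Polynomials of degree two over the field with two elements -/

section Classification

variable {F : Type*} [Field F]

theorem eq_of_natDegree_eq_two_of_card [Fintype F] (hF : Fintype.card F = 2) {f : F[X]}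
    (hf : f.natDegree = 2) :
    f = X ^ 2 ∨ f = (X + 1) ^ 2 ∨ f = X * (X + 1) ∨ f = X ^ 2 + X + 1 := by
  have h2 : (2 : F[X]) = 0 := by
    have := map_ofNat (C (R := F)) 2
    rw [two_eq_zero_of_card hF, map_zero] at this
    exact this.symm
  have e : f = C (f.coeff 2) * X ^ 2 + C (f.coeff 1) * X + C (f.coeff 0) :=
    eq_quadratic_of_degree_le_two (natDegree_le_iff_degree_le.1 hf.le)
  have h0 : f.coeff 2 = 1 := (eq_zero_or_eq_one_of_card hF _).resolve_left (by
    rw [← hf, coeff_natDegree, leadingCoeff_eq_zero]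
    rintro rfl
    simp at hf)
  rw [h0] at e
  rcases eq_zero_or_eq_one_of_card hF (f.coeff 1) with h1 | h1 <;>
  rcases eq_zero_or_eq_one_of_card hF (f.coeff 0) with h3 | h3 <;>
  simp only [h1, h3, map_one, map_zero, one_mul, zero_mul, add_zero] at e
  · exact Or.inl e
  · exact Or.inr (Or.inl (by rw [e]; linear_combination -X * h2))
  · exact Or.inr (Or.inr (Or.inl (by rw [e]; ring)))
  · exact Or.inr (Or.inr (Or.inr e))

theorem irreducible_X_sq_add_X_add_one [Fintype F] (hF : Fintype.card F = 2) :
    Irreducible (X ^ 2 + X + 1 : F[X]) := by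
  have hf : (X ^ 2 + X + 1 : F[X]).natDegree = 2 := by compute_degree!
  have h0 : (X ^ 2 + X + 1 : F[X]) ≠ 0 := by intro h; rw [h] at hf; simp at hf
  rw [irreducible_iff_roots_eq_zero_of_degree_le_three (by omega) (by omega),
    Multiset.eq_zero_iff_forall_notMem]
  intro c hc
  rw [mem_roots h0, IsRoot.def] at hc
  rcases eq_zero_or_eq_one_of_card hF c with rfl | rfl
  · simp at hc
  · have h2 := two_eq_zero_of_card hF
    simp only [eval_add, eval_pow, eval_X, eval_one] at hc
    exact one_ne_zero (α := F) (by linear_combination hc - h2)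

theorem isomorphic_table_of_natDegree_eq_two [Fintype F] (hF : Fintype.card F = 2) {f : F[X]}
    (hf : f.natDegree = 2) :
    (¬ Irreducible f → Squarefree f → (eichlerWRFQ f).Isomorphic tableSplit) ∧
    (¬ Squarefree f → (eichlerWRFQ f).Isomorphic tableSquare) ∧
    (Irreducible f → (eichlerWRFQ f).Isomorphic tableIrreducible) := by
  have hX1 : (X + 1 : F[X]).natDegree = 1 := natDegree_X_add_C 1
  have hsq : ∀ p : F[X], p.natDegree = 1 → ¬ Squarefree (p ^ 2) ∧ ¬ Irreducible (p ^ 2) := by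
    intro p hp
    have hu : ¬ IsUnit p := fun h => by simp [natDegree_eq_zero_of_isUnit h] at hp
    exact ⟨fun h => hu (h p (by rw [pow_two])), fun h => hu (h.isUnit_or_isUnit (pow_two p) |>.elim id id)⟩
  have hsquare : ∀ p : F[X], p.natDegree = 1 →
      (¬ Irreducible (p ^ 2) → Squarefree (p ^ 2) → (eichlerWRFQ (p ^ 2)).Isomorphic tableSplit) ∧
      (¬ Squarefree (p ^ 2) → (eichlerWRFQ (p ^ 2)).Isomorphic tableSquare) ∧
      (Irreducible (p ^ 2) → (eichlerWRFQ (p ^ 2)).Isomorphic tableIrreducible) :=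
    fun p hp => ⟨fun _ h => absurd h (hsq p hp).1, fun _ => isomorphic_tableSquare hF hp,
      fun h => absurd h (hsq p hp).2⟩
  rcases eq_of_natDegree_eq_two_of_card hF hf with rfl | rfl | rfl | rfl
  · exact hsquare X natDegree_X
  · exact hsquare _ hX1
  · have hc : IsCoprime (X : F[X]) (X + 1) := ⟨-1, 1, by ring⟩
    have hi : Irreducible (X + 1 : F[X]) := irreducible_of_degree_eq_one (degree_X_add_C 1)
    have hsf : Squarefree (X * (X + 1) : F[X]) :=
      squarefree_mul_iff.2 ⟨hc.isRelPrime, irreducible_X.squarefree, hi.squarefree⟩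
    refine ⟨fun _ _ => isomorphic_tableSplit hF, fun h => absurd hsf h, fun h => ?_⟩
    exact (h.isUnit_or_isUnit rfl).elim (fun h => absurd h irreducible_X.not_isUnit)
      (fun h => absurd h hi.not_isUnit)
  · have hi := irreducible_X_sq_add_X_add_one hF
    exact ⟨fun h => absurd hi h, fun h => absurd hi.squarefree h,
      fun _ => isomorphic_tableIrreducible hF hi⟩

end Classification

end

/-! ### Assembly -/

theorem mainTheorem7 {F : Type*} [Field F] [Fintype F] (f : F[X]) :
    (f.natDegree = 1 → (eichlerWRFQ f).Isomorphic (tableLinear (Fintype.card F))) ∧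
    (Fintype.card F = 2 → f.natDegree = 2 →
      (¬ Irreducible f → Squarefree f → (eichlerWRFQ f).Isomorphic tableSplit) ∧
      (¬ Squarefree f → (eichlerWRFQ f).Isomorphic tableSquare) ∧
      (Irreducible f → (eichlerWRFQ f).Isomorphic tableIrreducible)) ∧
    (f.natDegree = 1 ∨ (Fintype.card F = 2 ∧ f.natDegree = 2) →
      (∀ D : Subalgebra F[X] (Matrix (Fin 2) (Fin 2) (RatFunc F)),
        (IsMaximalOrder F[X] (RatFunc F) D ∧ eichlerOrder f ≤ D) ↔
          ∃ d : F[X], d ∣ f ∧ D = polyOrder d) ∧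
      (∀ d d' : F[X], d ∣ f → d' ∣ f → (polyOrder d = polyOrder d' ↔ Associated d d')) ∧
      (∀ n ∈ eichlerNormalizer f, ∃ g h : F[X], g * h = f ∧ IsCoprime g h ∧ ActsAsFlip n g h) ∧
      (∀ g h : F[X], g * h = f → IsCoprime g h → ∃ n ∈ eichlerNormalizer f, ActsAsFlip n g h) ∧
      (∀ n : GL (Fin 2) (RatFunc F),
        (n ∈ eichlerNormalizer f ∧
          ∀ D : Subalgebra F[X] (Matrix (Fin 2) (Fin 2) (RatFunc F)),
            IsMaximalOrder F[X] (RatFunc F) D → eichlerOrder f ≤ D → conjOrder n D = D) ↔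
        ∃ c : (RatFunc F)ˣ, ∃ γ ∈ heckeGamma0 f,
          (n : Matrix (Fin 2) (Fin 2) (RatFunc F)) =
            (c : RatFunc F) • (Matrix.GeneralLinearGroup.map (algebraMap F[X] (RatFunc F)) γ :
              Matrix (Fin 2) (Fin 2) (RatFunc F)))) := by
  have hf0 : f.natDegree = 1 ∨ (Fintype.card F = 2 ∧ f.natDegree = 2) → f ≠ 0 := by
    rintro h rfl
    simp at h
  refine ⟨isomorphic_tableLinear, fun hF hf => isomorphic_table_of_natDegree_eq_two hF hf,
    fun h => ⟨fun _ => isMaximalOrder_and_eichlerOrder_le_iff (hf0 h), fun d d' _ _ => polyOrder_eq_iff,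
      fun n hn => exists_factorization_actsAsFlip (hf0 h) hn,
      fun g k hgk hc => exists_actsAsFlip (hf0 h) hgk hc,
      mem_eichlerNormalizer_and_fixes_iff (hf0 h)⟩⟩
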